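/- A single-path linear-constraint loop (SLC) $\mathcal{R}$ over $n$ integer variables is given by a matrix $A\in\mathbb{Z}^{k\times 2n}$ and a vector $b\in\mathbb{Z}^{k}$; its transition polyhedron is the set of $(x,x')\in\mathbb{R}^{n}\times\mathbb{R}^{n}$ with $A\binom{x}{x'}\le b$, and there is a transition from a state $s\in\mathbb{Z}^{n}$ to a state $s'\in\mathbb{Z}^{n}$ if $(s,s')$ lies in this polyhedron. A cycle of length $m\ge 1$ is a finite sequence of states $s_1,\dots,s_m,s_1$ in which any two consecutive states form a transition. Let $|\mathcal{R}|$ denote the size of the binary encoding of $A$ and $b$. **Proposition.** Given an SLC $\mathcal{R}$ and $M\in\mathbb{N}$, deciding whether $\mathcal{R}$ has a cycle of length at most $M$ is in $\mathsf{NP}$ with respect to $|\mathcal{R}|\cdot M$. That is, there are a deterministic Turing machine $V$ and polynomials $p,q$ such that, for all $\mathcal{R}$ and $M$, the machine $V$, given $(\mathcal{R},M)$ and any bit string $c$ of length at most $p(|\mathcal{R}|\cdot M)$, halts within $q(|\mathcal{R}|\cdot M)$ steps, either accepting or rejecting; and $\mathcal{R}$ has a cycle of length at most $M$ if and only if $V$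 accepts $(\mathcal{R},M,c)$ for some such $c$. -/

import Mathlib

/-! ### Polynomial-time verification on Turing machines -/

namespace NPVerification

open Turing Computability

/-- The machine `V` (one of Mathlib's finite multi-stack Turing machines), started with the word `w`
on its input stack and all other stacks empty, halts after at most `t` steps with the one-symbol
word `b` on its output stack. The contents of the other stacks at that moment are irrelevant. -/
def OutputsBoolInTime {Γ : Type} (V : TM2ComputableAux Γ Bool) (w : List Γ) (b : Bool) (t : ℕ) :
    Prop :=
  ∃ c : V.tm.Cfg,
    Nonempty (StateTransition.EvalsToInTime V.tm.step
      (initList V.tm (w.map V.inputAlphabet.symm)) (some c) t) ∧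
    c.l = none ∧ (c.stk V.tm.k₁).map V.outputAlphabet = encodeBool b

/-- The decision problem `P` on instances `x : α`, presented to machines as words `enc x`, is in NP
with respect to the size measure `size`: there are a deterministic verifier `V` and polynomials
`p`, `q` such that, on every instance `x` together with a certificate (a bit string) `c` of length
at most `p (size x)`, the verifier halts within `q (size x)` steps with a verdict, and `P x` holds
if and only if some certificate of length at most `p (size x)` is accepted. Symbols of the
instance and of the certificate are told apart by the tags `Sum.inl` and `Sum.inr`. For
`size x = (enc x).length` this is the usual class NP. -/
def InNPWithRespectTo {α Γ : Type} (enc : α → List Γ) (size : α → ℕ) (P : α → Prop) : Prop :=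
  ∃ (V : TM2ComputableAux (Γ ⊕ Bool) Bool) (p q : Polynomial ℕ) (verdict : α → List Bool → Bool),
    (∀ (x : α) (c : List Bool), c.length ≤ p.eval (size x) →
      OutputsBoolInTime V ((enc x).map Sum.inl ++ c.map Sum.inr) (verdict x c)
        (q.eval (size x))) ∧
    ∀ x : α, P x ↔ ∃ c : List Bool, c.length ≤ p.eval (size x) ∧ verdict x c = true

end NPVerification

/-! ### Single-path linear-constraint loops -/

/-- A single-path linear-constraint loop in `n` integer variables, given by an integer system
`A (x, x') ≤ b` of `k` inequalities; the columns `Sum.inl j` of `A` belong to the current values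
`x` and the columns `Sum.inr j` to the next values `x'`. -/
structure SLC where
  /-- the number of variables -/
  n : ℕ
  /-- the number of inequalities -/
  k : ℕ
  /-- the coefficient matrix -/
  A : Matrix (Fin k) (Fin n ⊕ Fin n) ℤ
  /-- the right-hand side -/
  b : Fin k → ℤ

namespace SLC

open Computability

/-- States are integer vectors. -/
abbrev State (R : SLC) : Type := Fin R.n → ℤ

/-- The transition polyhedron in `ℝ²ⁿ`. -/
def polyhedron (R : SLC) : Set (Fin R.n ⊕ Fin R.n → ℝ) :=
  {z | ∀ i, (R.A.map (Int.cast : ℤ → ℝ)).mulVec z i ≤ (R.b i : ℝ)}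

/-- There is a transition from `s` to `s'` if the integer point `(s, s')` lies in the transition
polyhedron. -/
def Transition (R : SLC) (s s' : R.State) : Prop :=
  (fun j => ((Sum.elim s s' j : ℤ) : ℝ)) ∈ R.polyhedron

/-- A cycle of length `m`: a finite trace `s 0, …, s (m - 1), s m` whose last state
`s m` equals its first state `s 0`. There is at least one transition. -/
def HasCycleOfLength (R : SLC) (m : ℕ) : Prop :=
  0 < m ∧ ∃ s : ℕ → R.State, (∀ i < m, R.Transition (s i) (s (i + 1))) ∧ s m = s 0

/-- Some cycle has length at most `M`. -/
def HasCycleOfLengthAtMost (R : SLC) (M : ℕ) : Prop :=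
  ∃ m ≤ M, R.HasCycleOfLength m

/-- The binary digits of a natural number, least significant first, closed by a comma. -/
def encodeNatComma (a : ℕ) : List Γ' :=
  (encodeNat a).map Γ'.bit ++ [Γ'.comma]

/-- An integer as a sign bit (`true` for negative) followed by its absolute value in binary. -/
def encodeIntComma (z : ℤ) : List Γ' :=
  Γ'.bit (decide (z < 0)) :: encodeNatComma z.natAbs

/-- The `i`-th inequality: its `2n` coefficients and its right-hand side, between brackets. -/
def encodeRow (R : SLC) (i : Fin R.k) : List Γ' :=
  Γ'.bra ::
    ((List.ofFn fun j : Fin R.n => encodeIntComma (R.A i (Sum.inl j))).flatten ++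
      (List.ofFn fun j : Fin R.n => encodeIntComma (R.A i (Sum.inr j))).flatten ++
      encodeIntComma (R.b i) ++ [Γ'.ket])

/-- The binary encoding of `A` and `b`: the number `n` in binary, then the rows of `(A | b)`. -/
def encode (R : SLC) : List Γ' :=
  encodeNatComma R.n ++ (List.ofFn R.encodeRow).flatten

/-- The size of the binary encoding of `A` and `b`. -/
def size (R : SLC) : ℕ := R.encode.length

/-- An instance of the bounded cycle problem: the bound in binary, followed by the loop. -/
def encodeWithBound (x : SLC × ℕ) : List Γ' :=
  encodeNatComma x.2 ++ x.1.encode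

end SLC

/-! A cycle of length m is an integer solution of a linear system in m * n unknowns, with one copy
of the inequalities for every pair of cyclically consecutive states. The certificate is such a
solution in binary. It remains to see that a solvable system has a solution with polynomially many
bits, and that a machine can decode and check a certificate in polynomial time.

Small solutions (`SmallSolution.exists_small`). Adding sign constraints that a given solution
satisfies confines the system to one orthant and makes its rows have full column rank. While fewer
than N independent rows are nearly tight (have small slack), Siegel's lemma yields a small nonzero
integer vector w orthogonal to them. Walking from the current solution in steps of w keeps those
slacks fixed, and just before some inequality could fail, a row that is not orthogonal to w has
become nearly tight; it is independent of the others. Once N independent rows are nearly tight,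
Cramer's rule bounds the solution. With s = |R| * M, all numbers and the number of unknowns are
controlled by s, and `levelBound s + 1` binary digits suffice (`solution_bound_lt`).

Verification. A certificate announces a number of states, cut off at M, and a number of levels, both
in unary; then come the states, level by level from the most significant one, in signed digits. Each
state is paired with its cyclic successor, and each row is evaluated by Horner's rule, v becoming 2
* (v + digits * row). The right-hand side enters through an extra digit per level, -1 at the first
and 1 at all later ones, which represents -1 for any number of levels. The accumulator is a
redundant signed-digit number: it needs no subtraction, doubling is pushing a zero, and its sign is
that of its leading nonzero digit. Every bit string decodes to some list of between 1 and M states,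
so acceptance always exhibits a cycle (`hasCycle_of_verdictRows`), and the small solution gives
completeness (`exists_certificate`).

Unary conversion of M costs time polynomial in |R| * M. That of n does too if there is a row, since
a row has 2 * n + 1 entries; without rows n may be exponential in |R|, but then every positive bound
is accepted outright. The bound 0, for which the size measure vanishes, is rejected at once.

The checker is written as a structured stack program. The relation `Exec` records its result with a
time bound, and `Exec.reachesIn` transfers both to a multi-stack Turing machine. -/

/-! ### A structured language of stack programs and its compilation to multi-stack machines -/

namespace StackProgram

open Turing Function

/-- The memory of a stack program: an internal state and one stack for every name. -/
structure Store (K G σ : Type) where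
  /-- the internal state -/
  var : σ
  /-- the stacks -/
  stk : K → List G

/-- Elementary instructions. -/
inductive Instr (K G σ : Type)
  | push (k : K) (f : σ → G)
  | pop (k : K) (f : σ → Option G → σ)
  | load (f : σ → σ)

/-- Stack programs: straight-line blocks, sequencing, branching, and loops. The loop
`loop pre p body` runs `pre`, leaves if `p` then fails, and otherwise runs `body` and starts
again. -/
inductive Cmd (K G σ : Type)
  | block (l : List (Instr K G σ))
  | seq (a b : Cmd K G σ)
  | ite (p : σ → Bool) (a b : Cmd K G σ)
  | loop (pre : List (Instr K G σ)) (p : σ → Bool) (body : Cmd K G σ)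

/-! ### Big-step semantics with running times. -/

section Semantics

variable {K G σ : Type} [DecidableEq K]

/-- The effect of an instruction. -/
def Instr.run : Instr K G σ → Store K G σ → Store K G σ
  | .push k f, s => ⟨s.var, update s.stk k (f s.var :: s.stk k)⟩
  | .pop k f, s => ⟨f s.var (s.stk k).head?, update s.stk k (s.stk k).tail⟩
  | .load f, s => ⟨f s.var, s.stk⟩

/-- The effect of a straight-line block. -/
def runBlock (l : List (Instr K G σ)) (s : Store K G σ) : Store K G σ :=
  l.foldl (fun s i => i.run s) s

@[simp]
theorem runBlock_nil (s : Store K G σ) : runBlock [] s = s := rfl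

@[simp]
theorem runBlock_cons (i : Instr K G σ) (l : List (Instr K G σ)) (s : Store K G σ) :
    runBlock (i :: l) s = runBlock l (i.run s) := rfl

@[simp]
theorem Instr.run_push (k : K) (f : σ → G) (v : σ) (S : K → List G) :
    (Instr.push k f).run ⟨v, S⟩ = ⟨v, update S k (f v :: S k)⟩ := rfl

@[simp]
theorem Instr.run_pop (k : K) (f : σ → Option G → σ) (v : σ) (S : K → List G) :
    (Instr.pop k f).run ⟨v, S⟩ = ⟨f v (S k).head?, update S k (S k).tail⟩ := rfl

@[simp]
theorem Instr.run_load (f : σ → σ) (v : σ) (S : K → List G) :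
    (Instr.load (K := K) (G := G) f).run ⟨v, S⟩ = ⟨f v, S⟩ := rfl

/-- `Exec c s t s'`: started in `s`, the program `c` ends in `s'` within `t` steps. -/
inductive Exec : Cmd K G σ → Store K G σ → ℕ → Store K G σ → Prop
  | block {l s t} (ht : 1 ≤ t) : Exec (.block l) s t (runBlock l s)
  | seq {a b s s₁ s₂ t₁ t₂ t} (h₁ : Exec a s t₁ s₁) (h₂ : Exec b s₁ t₂ s₂) (ht : t₁ + t₂ ≤ t) :
      Exec (.seq a b) s t s₂
  | ite_true {p a b s s₁ t₁ t} (hp : p s.var = true) (h : Exec a s t₁ s₁) (ht : t₁ + 1 ≤ t) :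
      Exec (.ite p a b) s t s₁
  | ite_false {p a b s s₁ t₁ t} (hp : p s.var = false) (h : Exec b s t₁ s₁) (ht : t₁ + 1 ≤ t) :
      Exec (.ite p a b) s t s₁
  | loop_exit {pre p body s t} (hp : p (runBlock pre s).var = false) (ht : 1 ≤ t) :
      Exec (.loop pre p body) s t (runBlock pre s)
  | loop_step {pre p body s s₁ s₂ t₁ t₂ t} (hp : p (runBlock pre s).var = true)
      (h₁ : Exec body (runBlock pre s) t₁ s₁) (h₂ : Exec (.loop pre p body) s₁ t₂ s₂)
      (ht : t₁ + t₂ + 1 ≤ t) : Exec (.loop pre p body) s t s₂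

theorem Exec.mono {c : Cmd K G σ} {s s' : Store K G σ} {t t' : ℕ} (h : Exec c s t s')
    (ht : t ≤ t') : Exec c s t' s' := by
  cases h with
  | block h => exact .block (h.trans ht)
  | seq h₁ h₂ h => exact .seq h₁ h₂ (h.trans ht)
  | ite_true hp h₁ h => exact .ite_true hp h₁ (h.trans ht)
  | ite_false hp h₁ h => exact .ite_false hp h₁ (h.trans ht)
  | loop_exit hp h => exact .loop_exit hp (h.trans ht)
  | loop_step hp h₁ h₂ h => exact .loop_step hp h₁ h₂ (h.trans ht)

theorem Exec.to_eq {c : Cmd K G σ} {s s' s'' : Store K G σ} {t t' : ℕ} (h : Exec c s t s')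
    (hs : s' = s'') (ht : t ≤ t') : Exec c s t' s'' :=
  hs ▸ h.mono ht

theorem exec_block_seq {l : List (Instr K G σ)} {b : Cmd K G σ} {s s₁ s' : Store K G σ} {t t' : ℕ}
    (h : runBlock l s = s₁) (hb : Exec b s₁ t s') (ht : t + 1 ≤ t') :
    Exec (.seq (.block l) b) s t' s' :=
  .seq (.block le_rfl) (h ▸ hb) (by rwa [Nat.add_comm])

theorem exec_block {l : List (Instr K G σ)} {s s' : Store K G σ} (h : runBlock l s = s') :
    Exec (.block l) s 1 s' :=
  h ▸ .block le_rfl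

end Semantics

/-! ### Compilation to multi-stack machines and its correctness. -/

section Compilation

variable {K G σ : Type}

/-- The program points of a stack program. -/
def Cmd.Label : Cmd K G σ → Type
  | .block _ => Unit
  | .seq a b => a.Label ⊕ b.Label
  | .ite _ a b => Option (a.Label ⊕ b.Label)
  | .loop _ _ body => Option body.Label

/-- The first program point. -/
def Cmd.entry : (c : Cmd K G σ) → c.Label
  | .block _ => ()
  | .seq a _ => Sum.inl a.entry
  | .ite _ _ _ => none
  | .loop _ _ _ => none

/-- There are finitely many program points. -/
instance Cmd.fintypeLabel : (c : Cmd K G σ) → Fintype c.Label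
  | .block _ => inferInstanceAs (Fintype Unit)
  | .seq a b =>
    letI := a.fintypeLabel
    letI := b.fintypeLabel
    inferInstanceAs (Fintype (a.Label ⊕ b.Label))
  | .ite _ a b =>
    letI := a.fintypeLabel
    letI := b.fintypeLabel
    inferInstanceAs (Fintype (Option (a.Label ⊕ b.Label)))
  | .loop _ _ body =>
    letI := body.fintypeLabel
    inferInstanceAs (Fintype (Option body.Label))

/-- The stack alphabets of the compiled machine: the stack `none` is for the verdict. -/
@[reducible]
def alphabet (K G : Type) : Option K → Type
  | none => Bool
  | some _ => G

/-- The stacks of the compiled machine while the program is running. -/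
def liftStacks (S : K → List G) : ∀ k, List (alphabet K G k)
  | none => []
  | some k => S k

/-- Compilation of an instruction. -/
def Instr.toStmt {L : Type} : Instr K G σ → TM2.Stmt (alphabet K G) L σ →
    TM2.Stmt (alphabet K G) L σ
  | .push k f, q => .push (some k) f q
  | .pop k f, q => .pop (some k) f q
  | .load f, q => .load f q

/-- Compilation of a block. -/
def blockStmt {L : Type} (l : List (Instr K G σ)) (q : TM2.Stmt (alphabet K G) L σ) :
    TM2.Stmt (alphabet K G) L σ :=
  l.foldr Instr.toStmt q

/-- Compilation of a program whose points are embedded into `L` by `emb` and which continues at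
`exit`. -/
def Cmd.code {L : Type} : (c : Cmd K G σ) → (c.Label → L) → L → c.Label →
    TM2.Stmt (alphabet K G) L σ
  | .block l, _, exit => fun _ => blockStmt l (.goto fun _ => exit)
  | .seq a b, emb, exit =>
    Sum.elim (a.code (fun l => emb (.inl l)) (emb (.inr b.entry)))
      (b.code (fun l => emb (.inr l)) exit)
  | .ite p a b, emb, exit => fun l =>
    Option.elim l
      (.branch p (.goto fun _ => emb (some (.inl a.entry)))
        (.goto fun _ => emb (some (.inr b.entry))))
      (Sum.elim (a.code (fun l => emb (some (.inl l))) exit)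
        (b.code (fun l => emb (some (.inr l))) exit))
  | .loop pre p body, emb, exit => fun l =>
    Option.elim l
      (blockStmt pre (.branch p (.goto fun _ => emb (some body.entry)) (.goto fun _ => exit)))
      (body.code (fun l => emb (some l)) (emb none))

variable [DecidableEq K]

theorem update_liftStacks (S : K → List G) (k : K) (v : List G) :
    update (liftStacks S) (some k) v = liftStacks (update S k v) := by
  funext j
  cases j with
  | none => simp [liftStacks]
  | some j =>
    by_cases h : j = k
    · subst h; simp [liftStacks]
    · rw [update_of_ne (by simpa using h)]
      simp [liftStacks, h]

/-- One machine step executes a whole statement up to its jump. This is why `Exec` charges a single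
step for a block of any length. -/
theorem stepAux_blockStmt {L : Type} (l : List (Instr K G σ))
    (q : TM2.Stmt (alphabet K G) L σ) (s : Store K G σ) :
    TM2.stepAux (blockStmt l q) s.var (liftStacks s.stk) =
      TM2.stepAux q (runBlock l s).var (liftStacks (runBlock l s).stk) := by
  induction l generalizing s with
  | nil => rfl
  | cons i l ih =>
    have : runBlock (i :: l) s = runBlock l (i.run s) := rfl
    rw [this, ← ih]
    cases i with
    | push k f =>
      change TM2.stepAux (blockStmt l q) s.var
        (update (liftStacks s.stk) (some k) (f s.var :: s.stk k)) = _
      rw [update_liftStacks]; rfl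
    | pop k f =>
      change TM2.stepAux (blockStmt l q) (f s.var (s.stk k).head?)
        (update (liftStacks s.stk) (some k) (s.stk k).tail) = _
      rw [update_liftStacks]; rfl
    | load f => rfl

/-- Reachability in exactly `t` steps. -/
def ReachesIn {C : Type} (f : C → Option C) (a : C) (t : ℕ) (b : C) : Prop :=
  (flip bind f)^[t] (some a) = some b

theorem ReachesIn.trans {C : Type} {f : C → Option C} {a b c : C} {t₁ t₂ : ℕ}
    (h₁ : ReachesIn f a t₁ b) (h₂ : ReachesIn f b t₂ c) : ReachesIn f a (t₁ + t₂) c := by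
  unfold ReachesIn at *
  rw [Nat.add_comm, iterate_add_apply, h₁, h₂]

theorem ReachesIn.single {C : Type} {f : C → Option C} {a b : C} (h : f a = some b) :
    ReachesIn f a 1 b := h

/-- Correctness of the compilation, by induction on the execution. The embedding of program points
and the exit are arbitrary because a subprogram sits inside a larger machine: the first half of a
sequence exits to the entry of the second, a loop body to the head of its loop. -/
theorem Exec.reachesIn {c : Cmd K G σ} {s s' : Store K G σ} {t : ℕ} (h : Exec c s t s')
    {L : Type} (M : L → TM2.Stmt (alphabet K G) L σ) :
    ∀ (emb : c.Label → L) (exit : L), (∀ l, M (emb l) = c.code emb exit l) → ∃ t' ≤ t, ReachesIn (TM2.step M) ⟨some (emb c.entry), s.var, liftStacks s.stk⟩ t'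
      ⟨some exit, s'.var, liftStacks s'.stk⟩ := by
  induction h with (intro emb exit hM)
  | @block l s t ht =>
    refine ⟨1, ht, .single ?_⟩
    rw [TM2.step, hM]
    simp only [Cmd.code]
    rw [stepAux_blockStmt]; rfl
  | seq h₁ h₂ ht ih₁ ih₂ =>
    obtain ⟨t₁, ht₁, r₁⟩ := ih₁ (fun l => emb (.inl l)) (emb (.inr (Cmd.entry _)))
      (fun l => hM (.inl l))
    obtain ⟨t₂, ht₂, r₂⟩ := ih₂ (fun l => emb (.inr l)) exit (fun l => hM (.inr l))
    exact ⟨t₁ + t₂, by omega, r₁.trans r₂⟩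
  | ite_true hp h ht ih =>
    obtain ⟨t₁, ht₁, r₁⟩ := ih (fun l => emb (some (.inl l))) exit (fun l => hM (some (.inl l)))
    refine ⟨1 + t₁, by omega, ReachesIn.trans (.single ?_) r₁⟩
    rw [TM2.step, hM]
    simp [Cmd.code, Cmd.entry, hp]
  | ite_false hp h ht ih =>
    obtain ⟨t₁, ht₁, r₁⟩ := ih (fun l => emb (some (.inr l))) exit (fun l => hM (some (.inr l)))
    refine ⟨1 + t₁, by omega, ReachesIn.trans (.single ?_) r₁⟩
    rw [TM2.step, hM]
    simp [Cmd.code, Cmd.entry, hp]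
  | loop_exit hp ht =>
    refine ⟨1, ht, .single ?_⟩
    rw [TM2.step, hM]
    simp only [Cmd.code, Cmd.entry, Option.elim]
    rw [stepAux_blockStmt]
    simp [hp]
  | loop_step hp h₁ h₂ ht ih₁ ih₂ =>
    obtain ⟨t₁, ht₁, r₁⟩ := ih₁ (fun l => emb (some l)) (emb none) (fun l => hM (some l))
    obtain ⟨t₂, ht₂, r₂⟩ := ih₂ emb exit hM
    refine ⟨1 + t₁ + t₂, by omega, (ReachesIn.trans (.single ?_) r₁).trans r₂⟩
    rw [TM2.step, hM]
    simp only [Cmd.code, Cmd.entry, Option.elim]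
    rw [stepAux_blockStmt]
    simp [hp]

/-- The machine that runs the program `c` and then outputs the verdict `p`. -/
def Cmd.machine (c : Cmd K G σ) (p : σ → Bool) : Option c.Label →
    TM2.Stmt (alphabet K G) (Option c.Label) σ
  | none => .branch p (.push none (fun _ => true) .halt) (.push none (fun _ => false) .halt)
  | some l => c.code some none l

/-- The compiled machine in bundled form. -/
def Cmd.verifier [Fintype K] [Fintype G] [Fintype σ] (c : Cmd K G σ) (p : σ → Bool) (v₀ : σ)
    (k₀ : K) : TM2ComputableAux G Bool where
  tm :=
    { K := Option K
      k₀ := some k₀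
      k₁ := none
      Γ := alphabet K G
      Λ := Option c.Label
      main := some c.entry
      ΛFin := letI := c.fintypeLabel; inferInstanceAs (Fintype (Option c.Label))
      σ := σ
      initialState := v₀
      Γk₀Fin := inferInstanceAs (Fintype G)
      m := c.machine p }
  inputAlphabet := Equiv.refl G
  outputAlphabet := Equiv.refl Bool

theorem Exec.outputsBoolInTime [Fintype K] [Fintype G] [Fintype σ] {c : Cmd K G σ}
    {p : σ → Bool} {v₀ : σ} {k₀ : K} {w : List G} {t : ℕ} {s : Store K G σ}
    (h : Exec c ⟨v₀, update (fun _ => []) k₀ w⟩ t s) {T : ℕ} (hT : t + 1 ≤ T) :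
    NPVerification.OutputsBoolInTime (c.verifier p v₀ k₀) w (p s.var) T := by
  obtain ⟨t', ht', r⟩ := h.reachesIn (L := Option c.Label) (c.machine p) some none (fun l => rfl)
  -- The one step added to the running time: the verdict is pushed on the stack `none`, which is
  -- empty until then, and the machine halts.
  have hstep : TM2.step (c.machine p) ⟨some none, s.var, liftStacks s.stk⟩ =
      some ⟨none, s.var, update (liftStacks s.stk) none [p s.var]⟩ := by
    rw [TM2.step]
    cases hp : p s.var <;> simp [Cmd.machine, hp] <;> rfl
  have r' := r.trans (.single hstep)
  have hinit : initList (c.verifier p v₀ k₀).tm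
      (w.map (c.verifier p v₀ k₀).inputAlphabet.symm) =
      ⟨some (some c.entry), v₀, liftStacks (update (fun _ => []) k₀ w)⟩ := by
    unfold initList
    congr 1
    funext k
    rw [← update_liftStacks]
    have hw : w.map (c.verifier p v₀ k₀).inputAlphabet.symm = w := List.map_id w
    rw [hw]
    by_cases hk : k = some k₀
    · subst hk
      refine Eq.trans ?_ (update_self (some k₀) w (liftStacks fun _ : K => ([] : List G))).symm
      exact dif_pos rfl
    · have hk' : ¬ k = (c.verifier p v₀ k₀).tm.k₀ := hk
      refine (dif_neg hk').trans ?_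
      refine Eq.trans ?_ (update_of_ne (f := liftStacks fun _ : K => ([] : List G)) hk w).symm
      cases k <;> rfl
  refine ⟨⟨none, s.var, update (liftStacks s.stk) none [p s.var]⟩, ⟨⟨⟨t' + 1, ?_⟩, ?_⟩⟩, rfl, ?_⟩
  · rw [hinit]; exact r'
  · show t' + 1 ≤ T
    omega
  · change List.map id (update (liftStacks s.stk) none [p s.var] none) = _
    simp; rfl

end Compilation

end StackProgram

/-! ### Small integer solutions of systems of linear inequalities -/

namespace SmallSolution

open Matrix

open scoped Matrix.Norms.Elementwise in
/-- Siegel's lemma with a crude bound that also covers systems without equations. -/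
theorem exists_ne_zero_mulVec_eq_zero_abs_le {r N : ℕ} (B : Matrix (Fin r) (Fin N) ℤ) (hr : r < N)
    {H : ℕ} (hH : 1 ≤ H) (hB : ∀ i j, |B i j| ≤ H) :
    ∃ w : Fin N → ℤ, w ≠ 0 ∧ B *ᵥ w = 0 ∧ ∀ j, |w j| ≤ ((N * H) ^ N : ℕ) := by
  have hN : 1 ≤ N * H := Nat.mul_pos (by omega) hH
  -- Siegel's lemma needs at least one equation; without equations the all-ones vector serves.
  rcases Nat.eq_zero_or_pos r with rfl | hr0
  · refine ⟨fun _ => 1, fun h => ?_, ?_, fun j => ?_⟩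
    · have := congrFun h ⟨0, hr⟩
      simp at this
    · funext i; exact i.elim0
    · simpa using (by exact_mod_cast Nat.one_le_pow _ _ hN : (1 : ℤ) ≤ ((N * H) ^ N : ℕ))
  · obtain ⟨w, hw, hBw, hn⟩ := Int.Matrix.exists_ne_zero_int_vec_norm_le B (by simpa using hr)
      (by simpa using hr0)
    refine ⟨w, hw, hBw, fun j => ?_⟩
    simp only [Fintype.card_fin] at hn
    have hnorm : max 1 ‖B‖ ≤ (H : ℝ) := by
      refine max_le (by exact_mod_cast hH) ?_
      rw [Matrix.norm_le_iff (by positivity)]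
      intro i j
      rw [Int.norm_eq_abs]
      exact_mod_cast hB i j
    have hbase : (1 : ℝ) ≤ N * H := by exact_mod_cast hN
    -- The exponent r / (N - r) of Siegel's lemma is at most r, hence at most N, because N - r is at
    -- least 1.
    have h1 : ‖w‖ ≤ ((N : ℝ) * H) ^ (N : ℝ) := by
      refine hn.trans ?_
      have hNr : (1 : ℝ) ≤ (N : ℝ) - r := by
        have : (r : ℝ) + 1 ≤ N := by exact_mod_cast hr
        linarith
      calc ((N : ℝ) * max 1 ‖B‖) ^ ((r : ℝ) / (N - r))
          ≤ ((N : ℝ) * H) ^ ((r : ℝ) / (N - r)) := by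
            apply Real.rpow_le_rpow (by positivity) (by gcongr)
            positivity
        _ ≤ ((N : ℝ) * H) ^ (N : ℝ) := by
            apply Real.rpow_le_rpow_of_exponent_le hbase
            have : (r : ℝ) / (N - r) ≤ r := div_le_self (by positivity) hNr
            have h2 : (r : ℝ) ≤ N := by exact_mod_cast hr.le
            linarith
    have h2 : ‖w j‖ ≤ ‖w‖ := norm_le_pi_norm w j
    rw [Int.norm_eq_abs] at h2
    have h3 := h2.trans h1
    rw [Real.rpow_natCast] at h3
    exact_mod_cast h3

/-- A linear functional with bounded coefficients on a bounded vector. -/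
theorem abs_dotProduct_le {N : ℕ} {u v : Fin N → ℤ} {a b : ℕ} (hu : ∀ j, |u j| ≤ a)
    (hv : ∀ j, |v j| ≤ b) : |u ⬝ᵥ v| ≤ (N * (a * b) : ℕ) := by
  calc |u ⬝ᵥ v| ≤ ∑ j, |u j * v j| := Finset.abs_sum_le_sum_abs _ _
    _ ≤ ∑ _j : Fin N, ((a : ℤ) * b) := by
        refine Finset.sum_le_sum fun j _ => ?_
        rw [abs_mul]
        exact mul_le_mul (hu j) (hv j) (abs_nonneg _) (by positivity)
    _ = (N * (a * b) : ℕ) := by simp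

/-- Walking from a solution along `w`, which is orthogonal to the rows `f`, until a row that is not
orthogonal to `w` becomes nearly tight. -/
theorem exists_nearly_tight {ι : Type} {N : ℕ} {A : ι → Fin N → ℤ} {b : ι → ℤ} {x w : Fin N → ℤ}
    (hx : ∀ i, A i ⬝ᵥ x ≤ b i) {Δ : ℕ} (hw : ∀ i, |A i ⬝ᵥ w| ≤ Δ) {i₀ : ι}
    (hi₀ : A i₀ ⬝ᵥ w ≠ 0) :
    ∃ (y : Fin N → ℤ) (i : ι), (∀ i, A i ⬝ᵥ y ≤ b i) ∧ A i ⬝ᵥ w ≠ 0 ∧ b i - A i ⬝ᵥ y ≤ Δ ∧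
      ∀ i, A i ⬝ᵥ w = 0 → A i ⬝ᵥ y = A i ⬝ᵥ x := by
  wlog hpos : 0 < A i₀ ⬝ᵥ w generalizing w
  · obtain ⟨y, i, h1, h2, h3, h4⟩ := this (w := -w) (fun i => by simpa using hw i)
      (by simpa using hi₀) (by
        have := lt_of_le_of_ne (not_lt.1 hpos) hi₀
        simpa using this)
    exact ⟨y, i, h1, by simpa using h2, h3, fun i hi => h4 i (by simpa using hi)⟩
  have hlin : ∀ (k : ℕ) i, A i ⬝ᵥ (x + (k : ℤ) • w) = A i ⬝ᵥ x + k * (A i ⬝ᵥ w) := by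
    intro k i
    rw [dotProduct_add, dotProduct_smul, smul_eq_mul]
  -- Every step along w lowers the slack of row `i₀` by at least 1, so as many steps as its initial
  -- slack are enough.
  have hex : ∃ k : ℕ, ∃ i, A i ⬝ᵥ w ≠ 0 ∧ b i - A i ⬝ᵥ (x + (k : ℤ) • w) ≤ Δ := by
    refine ⟨(b i₀ - A i₀ ⬝ᵥ x).toNat, i₀, hi₀, ?_⟩
    rw [hlin, Int.toNat_of_nonneg (by linarith [hx i₀])]
    have : (b i₀ - A i₀ ⬝ᵥ x) * 1 ≤ (b i₀ - A i₀ ⬝ᵥ x) * (A i₀ ⬝ᵥ w) :=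
      mul_le_mul_of_nonneg_left hpos (by linarith [hx i₀])
    have : (0 : ℤ) ≤ Δ := by positivity
    linarith
  classical
  obtain ⟨i, hi, hik⟩ := Nat.find_spec hex
  refine ⟨x + (Nat.find hex : ℤ) • w, i, fun j => ?_, hi, hik, fun j hj => ?_⟩
  · rcases Nat.eq_zero_or_pos (Nat.find hex) with h0 | h0
    · rw [h0]; simpa using hx j
    · by_cases hj : A j ⬝ᵥ w = 0
      · rw [hlin, hj]; simpa using hx j
      -- One step before the first near-tightness, every row not orthogonal to w still had slack
      -- more than Δ. A single step changes each row by at most Δ, so none is violated.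
      · have hmin := Nat.find_min hex (Nat.sub_lt h0 one_pos)
        push Not at hmin
        have h1 := hmin j hj
        rw [hlin] at h1 ⊢
        rw [Nat.cast_sub (show 1 ≤ Nat.find hex from h0)] at h1
        have h2 := (abs_le.1 (hw j)).2
        push_cast at h1
        linarith
  · rw [hlin, hj]; simp

/-- As long as they do not have full rank, the nearly tight rows can be extended. -/
theorem exists_nearly_tight_rows {ι : Type} {N : ℕ} {A : ι → Fin N → ℤ} {b : ι → ℤ} {H : ℕ}
    (hH : 1 ≤ H) (hA : ∀ i j, |A i j| ≤ H) (hinj : ∀ w : Fin N → ℤ, w ≠ 0 → ∃ i, A i ⬝ᵥ w ≠ 0)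
    (hx : ∃ x : Fin N → ℤ, ∀ i, A i ⬝ᵥ x ≤ b i) (r : ℕ) (hr : r ≤ N) :
    ∃ (x : Fin N → ℤ) (f : Fin r → ι), (∀ i, A i ⬝ᵥ x ≤ b i) ∧
      (∀ i, b (f i) - A (f i) ⬝ᵥ x ≤ (N * (H * (N * H) ^ N) : ℕ)) ∧
      LinearIndependent ℚ (fun i j => (A (f i) j : ℚ)) := by
  induction r with
  | zero =>
    obtain ⟨x, hx⟩ := hx
    exact ⟨x, Fin.elim0, hx, fun i => i.elim0, linearIndependent_empty_type⟩
  | succ r ih =>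
    obtain ⟨x, f, hx, hf, hli⟩ := ih (by omega)
    obtain ⟨w, hw, hfw, hwb⟩ := exists_ne_zero_mulVec_eq_zero_abs_le
      (B := fun i => A (f i)) (by omega) hH (fun i j => hA _ _)
    obtain ⟨i₀, hi₀⟩ := hinj w hw
    obtain ⟨y, i, hy, hi, hib, hyx⟩ := exists_nearly_tight hx
      (fun i => abs_dotProduct_le (hA i) hwb) hi₀
    have hfw' : ∀ i, A (f i) ⬝ᵥ w = 0 := fun i => congrFun hfw i
    refine ⟨y, Fin.cons i f, hy, fun j => ?_, ?_⟩
    · refine Fin.cases ?_ (fun j => ?_) j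
      · simpa using hib
      · simpa [hyx _ (hfw' j)] using hf j
    · have : (fun j k => ((A ((Fin.cons i f : Fin (r + 1) → ι) j) k : ℤ) : ℚ)) =
          Fin.cons (fun k => (A i k : ℚ)) (fun j k => (A (f j) k : ℚ)) := by
        funext j
        refine Fin.cases ?_ (fun j => ?_) j <;> rfl
      rw [this, linearIndependent_finCons]
      refine ⟨hli, fun hmem => ?_⟩
      -- The functional given by w vanishes on the span of the old rows but not on the new one.
      let φ : (Fin N → ℚ) →ₗ[ℚ] ℚ := ∑ k, (w k : ℚ) • LinearMap.proj k
      have hφ : ∀ u : Fin N → ℤ, φ (fun k => (u k : ℚ)) = ((u ⬝ᵥ w : ℤ) : ℚ) := by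
        intro u
        simp [φ, dotProduct, mul_comm]
      have hle : Submodule.span ℚ (Set.range fun j k => (A (f j) k : ℚ)) ≤ LinearMap.ker φ := by
        rw [Submodule.span_le]
        rintro _ ⟨j, rfl⟩
        simp only [SetLike.mem_coe, LinearMap.mem_ker, hφ, hfw']
        simp
      have := hle hmem
      rw [LinearMap.mem_ker, hφ] at this
      exact hi (by exact_mod_cast this)

/-- An integer system whose rows have full rank and which has an integer solution has a small one. -/
theorem exists_small_of_injective {ι : Type} {N : ℕ} {A : ι → Fin N → ℤ} {b : ι → ℤ} {H : ℕ}
    (hH : 1 ≤ H) (hA : ∀ i j, |A i j| ≤ H) (hb : ∀ i, |b i| ≤ H)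
    (hinj : ∀ w : Fin N → ℤ, w ≠ 0 → ∃ i, A i ⬝ᵥ w ≠ 0)
    (hx : ∃ x : Fin N → ℤ, ∀ i, A i ⬝ᵥ x ≤ b i) :
    ∃ x : Fin N → ℤ, (∀ i, A i ⬝ᵥ x ≤ b i) ∧
      ∀ j, |x j| ≤ (N.factorial * (H + N * (H * (N * H) ^ N)) ^ N : ℕ) := by
  obtain ⟨x, f, hx, hf, hli⟩ := exists_nearly_tight_rows hH hA hinj hx N le_rfl
  refine ⟨x, hx, fun j => ?_⟩
  set Δ := N * (H * (N * H) ^ N)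
  let B : Matrix (Fin N) (Fin N) ℤ := fun i => A (f i)
  have hdet : B.det ≠ 0 := by
    have h1 : IsUnit (B.map (Int.cast : ℤ → ℚ)) :=
      Matrix.linearIndependent_rows_iff_isUnit.1 hli
    rw [Matrix.isUnit_iff_isUnit_det, isUnit_iff_ne_zero] at h1
    intro h0
    apply h1
    have := (Int.castRingHom ℚ).map_det B
    rw [h0] at this
    simpa using this.symm
  -- Cramer's rule, applied with B x as right-hand side: near-tightness bounds B x although x itself
  -- is not yet bounded.
  have hcr : B.det • x = cramer B (B *ᵥ x) := by
    rw [cramer_eq_adjugate_mulVec, mulVec_mulVec, adjugate_mul, smul_mulVec, one_mulVec]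
  have hj : B.det * x j = (B.updateCol j (B *ᵥ x)).det := by
    have := congrFun hcr j
    rwa [cramer_apply] at this
  have hbound : |(B.updateCol j (B *ᵥ x)).det| ≤
      (Fintype.card (Fin N)).factorial • ((H + Δ : ℕ) : ℤ) ^ Fintype.card (Fin N) := by
    refine Matrix.det_le (abv := AbsoluteValue.abs) fun i k => ?_
    change |B.updateCol j (B *ᵥ x) i k| ≤ _
    rw [updateCol_apply]
    split_ifs
    -- The value lies between b - Δ and b.
    · change |A (f i) ⬝ᵥ x| ≤ _
      have h1 := hf i
      have h2 := hx (f i)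
      have h3 := abs_le.1 (hb (f i))
      push_cast
      rw [abs_le]
      constructor <;> linarith [h3.1, h3.2]
    · refine (hA _ _).trans ?_
      push_cast
      have : (0 : ℤ) ≤ Δ := by positivity
      linarith
  rw [← hj, abs_mul] at hbound
  -- A nonzero integer determinant can only make the bound on x smaller when divided out.
  have h1 : 1 ≤ |B.det| := Int.one_le_abs hdet
  have h2 : |x j| ≤ |B.det| * |x j| := le_mul_of_one_le_left (abs_nonneg _) h1
  refine (h2.trans hbound).trans_eq ?_
  simp

/-- An integer system which has an integer solution has a small one. -/
theorem exists_small {ι : Type} {N : ℕ} {A : ι → Fin N → ℤ} {b : ι → ℤ} {H : ℕ}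
    (hH : 1 ≤ H) (hA : ∀ i j, |A i j| ≤ H) (hb : ∀ i, |b i| ≤ H)
    (hx : ∃ x : Fin N → ℤ, ∀ i, A i ⬝ᵥ x ≤ b i) :
    ∃ x : Fin N → ℤ, (∀ i, A i ⬝ᵥ x ≤ b i) ∧
      ∀ j, |x j| ≤ (N.factorial * (H + N * (H * (N * H) ^ N)) ^ N : ℕ) := by
  obtain ⟨x, hx⟩ := hx
  -- The constraints ε j * x j ≤ 0 describe an orthant containing x. Their rows are signed unit
  -- vectors, so the enlarged system is injective.
  let ε : Fin N → ℤ := fun j => if 0 ≤ x j then -1 else 1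
  obtain ⟨y, hy, hyb⟩ := exists_small_of_injective
    (A := Sum.elim A fun j => Pi.single j (ε j)) (b := Sum.elim b fun _ => 0) hH
    (by
      rintro (i | i) j
      · exact hA i j
      · have hH' : (1 : ℤ) ≤ H := by exact_mod_cast hH
        rcases eq_or_ne j i with rfl | h
        · simp only [Sum.elim_inr, Pi.single_eq_same, ε]
          split_ifs <;> simpa using hH'
        · simp [h])
    (by
      rintro (i | i)
      · exact hb i
      · simp)
    (by
      intro w hw
      obtain ⟨j, hj⟩ := Function.ne_iff.1 hw
      refine ⟨Sum.inr j, ?_⟩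
      simp only [Sum.elim_inr, single_dotProduct, ε]
      split_ifs <;> simpa using hj)
    ⟨x, by
      rintro (i | i)
      · exact hx i
      · simp only [Sum.elim_inr, single_dotProduct, ε]
        split_ifs <;> linarith⟩
  exact ⟨y, fun i => hy (Sum.inl i), hyb⟩

end SmallSolution

/-! ### Stack programs over the alphabet of instances and certificates -/

namespace CycleVerifier

open Turing Computability StackProgram Function

/-- The alphabet of instances with certificates. -/
abbrev Sym : Type := Γ' ⊕ Bool

/-- The working stacks of the verifier. -/
inductive Reg
  | inp | a | b | c | mu | nu | nb | lu | lb | mm | x | y | z | zb | rows | r | rb | acc | out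
  deriving DecidableEq

instance : Fintype Reg :=
  Fintype.ofList [.inp, .a, .b, .c, .mu, .nu, .nb, .lu, .lb, .mm, .x, .y, .z, .zb, .rows, .r, .rb,
    .acc, .out] fun k => by cases k <;> simp

/-- The internal state of the verifier: the symbol read last, a digit, a carry, an output digit, the
sign of the accumulator, and the verdict. -/
structure Ctl where
  /-- the symbol read last -/
  sym : Option Sym
  /-- the current digit -/
  dig : SignType
  /-- the current carry -/
  car : SignType
  /-- the current output digit -/
  res : SignType
  /-- the sign found so far -/
  sgn : SignType
  /-- the verdict so far -/
  ok : Bool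
  deriving Fintype

/-- The symbol of a bit. -/
abbrev bitSym (b : Bool) : Sym := .inl (.bit b)

/-- The symbol closing a number or a level of digits. -/
abbrev commaSym : Sym := .inl .comma

/-- The symbol closing a row or a state. -/
abbrev ketSym : Sym := .inl .ket

/-- The mark of unary numbers. -/
abbrev mark : Sym := .inl .blank

/-- A signed digit as a symbol; in this way sign bits are the digits `1` and `-1`. -/
def digSym : SignType → Sym
  | 0 => .inl .blank
  | 1 => .inl (.bit false)
  | -1 => .inl (.bit true)

/-- The signed digit of a symbol. -/
def symDig : Sym → SignType
  | .inl (.bit false) => 1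
  | .inl (.bit true) => -1
  | _ => 0

@[simp]
theorem symDig_digSym (d : SignType) : symDig (digSym d) = d := by
  cases d <;> rfl

/-- Replace the symbol read last. -/
def Ctl.read (v : Ctl) (g : Option Sym) : Ctl := { v with sym := g }

@[simp] theorem Ctl.read_read (v : Ctl) (g h : Option Sym) : (v.read g).read h = v.read h := rfl
@[simp] theorem Ctl.sym_read (v : Ctl) (g : Option Sym) : (v.read g).sym = g := rfl
@[simp] theorem Ctl.dig_read (v : Ctl) (g : Option Sym) : (v.read g).dig = v.dig := rfl
@[simp] theorem Ctl.ok_read (v : Ctl) (g : Option Sym) : (v.read g).ok = v.ok := rfl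

/-- Read the top symbol of a stack. -/
def pop (k : Reg) : Instr Reg Sym Ctl := .pop k fun v g => v.read g

/-- Push the symbol read last. -/
def pushSym (k : Reg) : Instr Reg Sym Ctl := .push k fun v => v.sym.getD mark

/-- Push a fixed symbol. -/
def pushConst (k : Reg) (g : Sym) : Instr Reg Sym Ctl := .push k fun _ => g

/-- The symbol read last exists and satisfies `q`. -/
def symSat (q : Sym → Bool) (v : Ctl) : Bool := v.sym.any q

/-- Move symbols from `k` to `l` while they satisfy `q`. -/
def moveWhile (q : Sym → Bool) (k l : Reg) : Cmd Reg Sym Ctl :=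
  .loop [pop k] (symSat q) (.block [pushSym l])

/-- Move symbols from `k` to both `l` and `l'` while they satisfy `q`. -/
def moveWhile₂ (q : Sym → Bool) (k l l' : Reg) : Cmd Reg Sym Ctl :=
  .loop [pop k] (symSat q) (.block [pushSym l, pushSym l'])

/-- Reverse the whole stack `k` onto `l`. -/
abbrev move (k l : Reg) : Cmd Reg Sym Ctl := moveWhile (fun _ => true) k l

/-- Any symbol was read. -/
abbrev gotSym : Ctl → Bool := symSat fun _ => true

set_option linter.constructorNameAsVariable false

/-! ### Running loops, moving and copying stacks. -/

section Basic

variable {v : Ctl} {S : Reg → List Sym}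

theorem exec_loop_cons {q : Sym → Bool} {k : Reg} {body : Cmd Reg Sym Ctl} {g : Sym}
    {l : List Sym} {s₁ s₂ : Store Reg Sym Ctl} {t₁ t₂ t : ℕ} (hS : S k = g :: l) (hg : q g = true)
    (h₁ : Exec body ⟨v.read (some g), update S k l⟩ t₁ s₁)
    (h₂ : Exec (.loop [pop k] (symSat q) body) s₁ t₂ s₂) (ht : t₁ + t₂ + 1 ≤ t) :
    Exec (.loop [pop k] (symSat q) body) ⟨v, S⟩ t s₂ := by
  have : runBlock [pop k] ⟨v, S⟩ = ⟨v.read (some g), update S k l⟩ := by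
    simp [runBlock, pop, Instr.run, hS]
  refine .loop_step ?_ (this ▸ h₁) h₂ ht
  simp [this, symSat, hg]

/-- The loop pops before it tests, so the symbol that stops it is consumed as well and survives only
as the symbol read last. Programs that need it later push it back. -/
theorem exec_loop_stop {q : Sym → Bool} {k : Reg} {body : Cmd Reg Sym Ctl}
    (hS : ∀ g ∈ (S k).head?, q g = false) :
    Exec (.loop [pop k] (symSat q) body) ⟨v, S⟩ 1
      ⟨v.read ((S k).head?), update S k (S k).tail⟩ := by
  have : runBlock [pop k] ⟨v, S⟩ =
      ⟨v.read ((S k).head?), update S k (S k).tail⟩ := by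
    simp [runBlock, pop, Instr.run]
  rw [← this]
  refine .loop_exit ?_ le_rfl
  rw [this]
  cases h : (S k).head? with
  | none => simp [symSat]
  | some g => simpa [symSat, h] using hS g (by simp [h])

theorem exec_loop_nil {q : Sym → Bool} {k : Reg} {body : Cmd Reg Sym Ctl} (hS : S k = []) :
    Exec (.loop [pop k] (symSat q) body) ⟨v, S⟩ 1 ⟨v.read none, S⟩ := by
  refine (exec_loop_stop (v := v) (S := S) (k := k) (by simp [hS])).to_eq ?_ le_rfl
  rw [hS]
  congr 1
  rw [List.tail_nil, ← hS, update_eq_self]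

theorem exec_moveWhile {q : Sym → Bool} {k l : Reg} (hkl : k ≠ l) {w rest : List Sym}
    (hS : S k = w ++ rest) (hw : ∀ g ∈ w, q g = true) (hrest : ∀ g ∈ rest.head?, q g = false) :
    Exec (moveWhile q k l) ⟨v, S⟩ (2 * w.length + 1)
      ⟨v.read rest.head?, update (update S k rest.tail) l (w.reverse ++ S l)⟩ := by
  induction w generalizing v S with
  | nil =>
    have hS' : S k = rest := hS
    refine (exec_loop_stop (v := v) (S := S) (k := k) (by rwa [hS'])).to_eq ?_ (by simp)
    rw [hS']
    congr 1
    funext j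
    by_cases hj : j = l
    · subst hj; simp [hkl.symm]
    · simp [hj]
  | cons g w ih =>
    have hb : Exec (.block [pushSym l]) ⟨v.read (some g), update S k (w ++ rest)⟩ 1
        ⟨v.read (some g), update (update S k (w ++ rest)) l (g :: S l)⟩ :=
      exec_block (by simp [pushSym, hkl.symm])
    refine exec_loop_cons (t₂ := 2 * w.length + 1) hS (hw g (by simp)) hb
      ((ih (by simp [hkl]) (fun g hg => hw g (by simp [hg]))).to_eq ?_ le_rfl) (by simp; omega)
    congr 1
    funext j
    by_cases hj : j = l
    · subst hj; simp
    · by_cases hj' : j = k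
      · subst hj'; simp [hkl]
      · simp [hj, hj']

theorem exec_moveWhile₂ {q : Sym → Bool} {k l l' : Reg} (hkl : k ≠ l) (hkl' : k ≠ l')
    (hll' : l ≠ l') {w rest : List Sym}
    (hS : S k = w ++ rest) (hw : ∀ g ∈ w, q g = true) (hrest : ∀ g ∈ rest.head?, q g = false) :
    Exec (moveWhile₂ q k l l') ⟨v, S⟩ (2 * w.length + 1)
      ⟨v.read rest.head?, update (update (update S k rest.tail) l (w.reverse ++ S l))
        l' (w.reverse ++ S l')⟩ := by
  induction w generalizing v S with
  | nil =>
    have hS' : S k = rest := hS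
    refine (exec_loop_stop (v := v) (S := S) (k := k) (by rwa [hS'])).to_eq ?_ (by simp)
    rw [hS']
    congr 1
    funext j
    by_cases hj : j = l'
    · subst hj; simp [hkl'.symm]
    · by_cases hj' : j = l
      · subst hj'; simp [hkl.symm, hll']
      · simp [hj, hj']
  | cons g w ih =>
    have hb : Exec (.block [pushSym l, pushSym l'])
        ⟨v.read (some g), update S k (w ++ rest)⟩ 1
        ⟨v.read (some g),
          update (update (update S k (w ++ rest)) l (g :: S l)) l' (g :: S l')⟩ :=
      exec_block (by simp [pushSym, hkl.symm, hkl'.symm, hll'.symm])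
    refine exec_loop_cons (t₂ := 2 * w.length + 1) hS (hw g (by simp)) hb
      ((ih (by simp [hkl, hkl']) (fun g hg => hw g (by simp [hg]))).to_eq ?_ le_rfl)
      (by simp; omega)
    congr 1
    funext j
    by_cases hj : j = l'
    · subst hj; simp
    · by_cases hj' : j = l
      · subst hj'; simp [hj]
      · by_cases hj'' : j = k
        · subst hj''; simp [hj, hj']
        · simp [hj, hj', hj'']

theorem exec_move {k l : Reg} (hkl : k ≠ l) :
    Exec (move k l) ⟨v, S⟩ (2 * (S k).length + 1)
      ⟨v.read none, update (update S k []) l ((S k).reverse ++ S l)⟩ :=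
  exec_moveWhile hkl (rest := []) (by simp) (by simp) (by simp)

theorem exec_move₂ {k l l' : Reg} (hkl : k ≠ l) (hkl' : k ≠ l') (hll' : l ≠ l') :
    Exec (moveWhile₂ (fun _ => true) k l l') ⟨v, S⟩ (2 * (S k).length + 1)
      ⟨v.read none, update (update (update S k []) l ((S k).reverse ++ S l))
        l' ((S k).reverse ++ S l')⟩ :=
  exec_moveWhile₂ hkl hkl' hll' (rest := []) (by simp) (by simp) (by simp)

/-- Empty the stack `k`. -/
def clear (k : Reg) : Cmd Reg Sym Ctl := .loop [pop k] gotSym (.block [])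

theorem exec_clear {k : Reg} : Exec (clear k) ⟨v, S⟩ (2 * (S k).length + 1)
    ⟨v.read none, update S k []⟩ := by
  generalize hw : S k = w
  induction w generalizing v S with
  | nil => exact (exec_loop_nil hw).to_eq (by rw [← hw, update_eq_self]) (by simp)
  | cons g w ih =>
    refine exec_loop_cons (t₂ := 2 * w.length + 1) hw rfl (exec_block rfl)
      ((ih (by simp)).to_eq ?_ le_rfl) (by simp; omega)
    simp

/-! ### Unary numbers -/

/-- Convert the number on `k`, most significant bit first, into unary on `u`, using `a`. -/
def unary (k u a : Reg) : Cmd Reg Sym Ctl :=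
  .loop [pop k] gotSym
    (.seq (.ite (symSat fun g => g = bitSym true) (.block [pushConst a mark]) (.block []))
      (.seq (.loop [pop u] gotSym (.block [pushConst a mark, pushConst a mark])) (move a u)))

theorem exec_double {u a : Reg} (hua : u ≠ a) {n m : ℕ} (hu : S u = List.replicate n mark)
    (ha : S a = List.replicate m mark) :
    Exec (.loop [pop u] gotSym (.block [pushConst a mark, pushConst a mark])) ⟨v, S⟩ (2 * n + 1)
      ⟨v.read none, update (update S u []) a (List.replicate (2 * n + m) mark)⟩ := by
  induction n generalizing v S m with
  | zero =>
    refine (exec_loop_nil hu).to_eq ?_ le_rfl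
    congr 1
    have hu' : S u = [] := hu
    rw [← hu', update_eq_self, Nat.mul_zero, Nat.zero_add, ← ha, update_eq_self]
  | succ n ih =>
    have hb : Exec (.block [pushConst a mark, pushConst a mark])
        ⟨v.read (some mark), update S u (List.replicate n mark)⟩ 1
        ⟨v.read (some mark),
          update (update S u (List.replicate n mark)) a (List.replicate (m + 2) mark)⟩ :=
      exec_block (by simp [pushConst, hua.symm, ha, List.replicate_succ])
    refine exec_loop_cons (t₂ := 2 * n + 1) hu rfl hb
      ((ih (m := m + 2) (by simp [hua]) (by simp)).to_eq ?_ le_rfl) (by omega)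
    congr 1
    rw [show 2 * (n + 1) + m = 2 * n + (m + 2) by ring]
    funext j
    by_cases hj : j = a
    · subst hj; simp
    · by_cases hj' : j = u
      · subst hj'; simp [hj]
      · simp [hj, hj']

/-- The value of a list of bits, most significant bit first, starting from `n`. -/
def ofBits (n : ℕ) (l : List Bool) : ℕ := l.foldl (fun n b => 2 * n + b.toNat) n

theorem le_ofBits (n : ℕ) (l : List Bool) : n ≤ ofBits n l := by
  induction l generalizing n with
  | nil => exact le_rfl
  | cons b l ih =>
    have := ih (2 * n + b.toNat)
    simp only [ofBits, List.foldl_cons] at this ⊢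
    omega

/-- Each bit doubles the marks from `u` onto `a`, adds itself, and moves them back. By `le_ofBits`
no intermediate value exceeds the final one; with n' = 2 * n + b, doubling and moving cost about 2 *
n + 2 * n' ≤ 3 * n' steps, whence the factor 3. -/
theorem exec_unary {k u a : Reg} (hku : k ≠ u) (hka : k ≠ a) (hua : u ≠ a) {n : ℕ}
    {l : List Bool} (hk : S k = l.map bitSym) (hu : S u = List.replicate n mark)
    (ha : S a = []) :
    Exec (unary k u a) ⟨v, S⟩ (l.length * (3 * ofBits n l + 6) + 1)
      ⟨v.read none,
        update (update S k []) u (List.replicate (ofBits n l) mark)⟩ := by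
  induction l generalizing v S n with
  | nil =>
    have hk' : S k = [] := hk
    refine (exec_loop_nil hk).to_eq ?_ (by simp)
    congr 1
    rw [← hk', update_eq_self, show ofBits n [] = n from rfl, ← hu, update_eq_self]
  | cons b l ih =>
    set n' := 2 * n + b.toNat with hn'
    have hof : ofBits n (b :: l) = ofBits n' l := rfl
    have hle : n' ≤ ofBits n' l := le_ofBits _ _
    have h1 : Exec
        (.ite (symSat fun g => g = bitSym true) (.block [pushConst a mark]) (.block []))
        ⟨v.read (some (bitSym b)), update S k (l.map bitSym)⟩ 2
        ⟨v.read (some (bitSym b)),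
          update (update S k (l.map bitSym)) a (List.replicate b.toNat mark)⟩ := by
      cases b with
      | true =>
        refine .ite_true (t₁ := 1) (by simp [symSat]) (exec_block ?_) le_rfl
        simp [pushConst, hka.symm, ha]
      | false =>
        refine .ite_false (t₁ := 1) (by simp [symSat]) (exec_block ?_) le_rfl
        simp [ha, hka.symm]
    have h2 := exec_double (v := v.read (some (bitSym b))) (m := b.toNat) (n := n)
      (S := update (update S k (l.map bitSym)) a (List.replicate b.toNat mark)) hua
      (by simp [hua, hku.symm, hu]) (by simp)
    have h3 : Exec (move a u) ⟨v.read none, update (update (update (update S k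
          (l.map bitSym)) a (List.replicate b.toNat mark)) u []) a (List.replicate n' mark)⟩
        (2 * n' + 1) ⟨v.read none,
          update (update (update S k (l.map bitSym)) u (List.replicate n' mark)) a []⟩ := by
      refine (exec_move hua.symm).to_eq ?_ (by simp)
      congr 1
      funext j
      simp only [update_apply]
      split_ifs <;> simp_all
    have h4 := ih (v := v.read none) (n := n')
      (S := update (update (update S k (l.map bitSym)) u (List.replicate n' mark)) a [])
      (by simp [hku, hka]) (by simp [hua]) (by simp)
    refine exec_loop_cons hk rfl (Exec.seq h1 (Exec.seq h2 h3 le_rfl) le_rfl)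
      (Exec.to_eq (c := unary k u a) h4 (s'' := ⟨v.read none,
        update (update S k []) u (List.replicate (ofBits n (b :: l)) mark)⟩) ?_ le_rfl) ?_
    · congr 1
      funext j
      simp only [update_apply]
      split_ifs <;> simp_all
    · rw [hof, List.length_cons]
      nlinarith

end Basic

/-! ### Reading the certificate -/

/-- The internal state between two phases of the verifier. -/
def ctl (g : Option Sym) (ok : Bool) : Ctl := ⟨g, 0, 0, 0, 0, ok⟩

@[simp]
theorem ctl_read (g h : Option Sym) (ok : Bool) : (ctl g ok).read h = ctl h ok := rfl

@[simp]
theorem ctl_sym (g : Option Sym) (ok : Bool) : (ctl g ok).sym = g := rfl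

@[simp]
theorem ctl_ok (g : Option Sym) (ok : Bool) : (ctl g ok).ok = ok := rfl

/-- The symbol of a certificate bit. -/
abbrev certSym (b : Bool) : Sym := .inr b

/-- The condition that the symbol read last is a true certificate bit. -/
abbrev gotTrue : Ctl → Bool := symSat fun g => g = certSym true

/-- The number of leading true bits. -/
def ones (c : List Bool) : ℕ := (c.takeWhile id).length

/-- The bits after the leading true bits and their terminator. -/
def afterOnes (c : List Bool) : List Bool := (c.dropWhile id).tail

/-- Read a unary number from the certificate onto `lu`. -/
def readLevelCount : Cmd Reg Sym Ctl :=
  .loop [pop .inp] gotTrue (.block [pushConst .lu mark])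

/-- Read a unary number from the certificate onto `mm`, using up marks of `mu`. -/
def readStateCount : Cmd Reg Sym Ctl :=
  .loop [pop .inp] gotTrue
    (.seq (.block [pop .mu]) (.ite gotSym (.block [pushConst .mm mark]) (.block [])))

variable {S : Reg → List Sym} {g : Option Sym} {ok : Bool}

/-- A unary number may end with a false bit, which is consumed, or with the end of the certificate.
-/
theorem exec_readOnes_stop {body : Cmd Reg Sym Ctl} {c : List Bool} (hc : ∀ b ∈ c.head?, b = false)
    (hS : S .inp = c.map certSym) : ∃ g',
    Exec (.loop [pop .inp] gotTrue body) ⟨ctl g ok, S⟩ 1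
      ⟨ctl g' ok, update S .inp (c.tail.map certSym)⟩ := by
  refine ⟨_, (exec_loop_stop (v := ctl g ok) (S := S) (k := .inp) ?_).to_eq
    (s'' := ⟨ctl (S .inp).head? ok, _⟩) ?_ le_rfl⟩
  · intro g hg
    rw [hS] at hg
    cases c with
    | nil => simp at hg
    | cons b c =>
      have := hc b (by simp)
      subst this
      simp only [List.map_cons, List.head?_cons, Option.mem_some_iff] at hg
      subst hg
      rfl
  · simp [hS]

theorem exec_readLevelCount {c : List Bool} {k : ℕ} (hS : S .inp = c.map certSym)
    (hk : S .lu = List.replicate k mark) : ∃ g',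
    Exec readLevelCount ⟨ctl g ok, S⟩ (2 * c.length + 1)
      ⟨ctl g' ok, update (update S .inp ((afterOnes c).map certSym)) .lu
        (List.replicate (k + ones c) mark)⟩ := by
  induction c generalizing S g k with
  | nil =>
    obtain ⟨g', h⟩ := exec_readOnes_stop (g := g) (ok := ok) (c := []) (S := S)
      (body := .block [pushConst .lu mark]) (by simp) hS
    refine ⟨g', h.to_eq ?_ (by simp)⟩
    congr 1
    funext j; cases j <;> simp [hk, ones, afterOnes]
  | cons b c ih =>
    cases b with
    | false =>
      obtain ⟨g', h⟩ := exec_readOnes_stop (g := g) (ok := ok) (c := false :: c) (S := S)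
        (body := .block [pushConst .lu mark]) (by simp) hS
      refine ⟨g', h.to_eq ?_ (by simp)⟩
      congr 1
      funext j; cases j <;> simp [hk, ones, afterOnes]
    | true =>
      have hb : Exec (.block [pushConst .lu mark])
          ⟨ctl (some (certSym true)) ok, update S .inp (c.map certSym)⟩ 1
          ⟨ctl (some (certSym true)) ok, update (update S .inp (c.map certSym)) .lu
            (List.replicate (k + 1) mark)⟩ :=
        exec_block (by simp [pushConst, hk, List.replicate_succ])
      obtain ⟨g', h⟩ := ih (g := some (certSym true)) (k := k + 1)
        (S := update (update S .inp (c.map certSym)) .lu (List.replicate (k + 1) mark))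
        (by simp) (by simp)
      refine ⟨g', exec_loop_cons hS (by simp) hb (Exec.to_eq (c := readLevelCount) h
        (s'' := ⟨ctl g' ok, _⟩) ?_ le_rfl) ?_⟩
      · congr 1
        funext j; cases j <;> simp [ones, afterOnes, Nat.add_comm, Nat.add_left_comm]
      · simp only [List.length_cons]; omega

/-- The marks of `mu` are a budget. Once it is exhausted, further true bits are read but not
counted, so no certificate can announce more states than the bound permits. -/
theorem exec_readStateCount {c : List Bool} {k n : ℕ} (hS : S .inp = c.map certSym)
    (hk : S .mm = List.replicate k mark) (hn : S .mu = List.replicate n mark) : ∃ g',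
    Exec readStateCount ⟨ctl g ok, S⟩ (4 * c.length + 1)
      ⟨ctl g' ok, update (update (update S .inp ((afterOnes c).map certSym)) .mm
        (List.replicate (k + min n (ones c)) mark)) .mu (List.replicate (n - ones c) mark)⟩ := by
  induction c generalizing S g k n with
  | nil =>
    obtain ⟨g', h⟩ := exec_readOnes_stop (g := g) (ok := ok) (c := []) (S := S)
      (body := .seq (.block [pop .mu]) (.ite gotSym (.block [pushConst .mm mark]) (.block [])))
      (by simp) hS
    refine ⟨g', h.to_eq ?_ (by simp)⟩
    congr 1
    funext j; cases j <;> simp [hk, hn, ones, afterOnes]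
  | cons b c ih =>
    cases b with
    | false =>
      obtain ⟨g', h⟩ := exec_readOnes_stop (g := g) (ok := ok) (c := false :: c) (S := S)
        (body := .seq (.block [pop .mu]) (.ite gotSym (.block [pushConst .mm mark]) (.block [])))
        (by simp) hS
      refine ⟨g', h.to_eq ?_ (by simp)⟩
      congr 1
      funext j; cases j <;> simp [hk, hn, ones, afterOnes]
    | true =>
      have hb : ∃ g₁, Exec
          (.seq (.block [pop .mu]) (.ite gotSym (.block [pushConst .mm mark]) (.block [])))
          ⟨ctl (some (certSym true)) ok, update S .inp (c.map certSym)⟩ 3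
          ⟨ctl g₁ ok, update (update (update S .inp (c.map certSym)) .mm
            (List.replicate (k + min n 1) mark)) .mu (List.replicate (n - 1) mark)⟩ := by
        cases n with
        | zero =>
          refine ⟨none, .seq (t₁ := 1) (t₂ := 2) (s₁ := ⟨ctl none ok, update S .inp (c.map certSym)⟩)
            (exec_block ?_) (.ite_false (t₁ := 1) rfl (exec_block ?_) le_rfl) le_rfl⟩
          · simp [pop, hn, Ctl.read, ctl]
          · simp only [runBlock_nil]
            congr 1
            funext j; cases j <;> simp [hk, hn]
        | succ n =>
          refine ⟨some mark, .seq (t₁ := 1) (t₂ := 2)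
            (s₁ := ⟨ctl (some mark) ok,
              update (update S .inp (c.map certSym)) .mu (List.replicate n mark)⟩)
            (exec_block ?_) (.ite_true (t₁ := 1) rfl (exec_block ?_) le_rfl) le_rfl⟩
          · simp [pop, hn, List.replicate_succ]
          · simp only [runBlock_cons, runBlock_nil, pushConst, Instr.run_push]
            congr 1
            funext j; cases j <;> simp [hk, List.replicate_succ]
      obtain ⟨g₁, hb⟩ := hb
      obtain ⟨g', h⟩ := ih (g := g₁) (k := k + min n 1) (n := n - 1)
        (S := update (update (update S .inp (c.map certSym)) .mm
            (List.replicate (k + min n 1) mark)) .mu (List.replicate (n - 1) mark))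
        (by simp) (by simp) (by simp)
      refine ⟨g', exec_loop_cons hS (by simp) hb (Exec.to_eq (c := readStateCount) h
        (s'' := ⟨ctl g' ok, _⟩) ?_ le_rfl) ?_⟩
      · congr 1
        funext j
        cases j <;> simp [ones, afterOnes]
        · omega
        · omega
      · simp only [List.length_cons]; omega

/-- Run `body` once for every mark on `p`, using `q`, and restore `p`. -/
def forEach (p q : Reg) (body : Cmd Reg Sym Ctl) : Cmd Reg Sym Ctl :=
  .seq (.loop [pop p] gotSym (.seq (.block [pushConst q mark]) body)) (move q p)

/-- The family `F` describes the store by an abstract value, and `body` acts on that value by `f`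
whatever the counter stacks hold; hence the loop realises the n-th iterate of `f`. Demanding
arbitrary `P` and `Q` is what lets such loops be nested. -/
theorem exec_forEach {p q : Reg} (hpq : p ≠ q) {α : Type} {F : α → Reg → List Sym} {f : α → α}
    {body : Cmd Reg Sym Ctl} {t : ℕ}
    (h : ∀ a P Q g, Exec body ⟨ctl g ok, update (update (F a) p P) q Q⟩ t
      ⟨ctl none ok, update (update (F (f a)) p P) q Q⟩) (n : ℕ) (a : α) :
    Exec (forEach p q body) ⟨ctl g ok, update (update (F a) p (List.replicate n mark)) q []⟩
      (n * (t + 4) + 2)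
      ⟨ctl none ok, update (update (F (f^[n] a)) p (List.replicate n mark)) q []⟩ := by
  -- Generalised to m marks already transferred to `q`.
  have hloop : ∀ (n m : ℕ) (a : α) (g : Option Sym),
      Exec (.loop [pop p] gotSym (.seq (.block [pushConst q mark]) body))
        ⟨ctl g ok, update (update (F a) p (List.replicate n mark)) q (List.replicate m mark)⟩
        (n * (t + 2) + 1)
        ⟨ctl none ok, update (update (F (f^[n] a)) p []) q (List.replicate (n + m) mark)⟩ := by
    intro n
    induction n with
    | zero =>
      intro m a g
      refine (exec_loop_nil (by simp [hpq])).to_eq ?_ (by simp)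
      simp
    | succ n ih =>
      intro m a g
      have hb : Exec (.block [pushConst q mark])
          ⟨ctl (some mark) ok, update (update (update (F a) p (List.replicate (n + 1) mark)) q
            (List.replicate m mark)) p (List.replicate n mark)⟩ 1
          ⟨ctl (some mark) ok, update (update (F a) p (List.replicate n mark)) q
            (List.replicate (m + 1) mark)⟩ := by
        refine exec_block ?_
        simp only [runBlock_cons, runBlock_nil, pushConst, Instr.run_push]
        congr 1
        funext j
        simp only [update_apply]
        split_ifs <;> simp_all [List.replicate_succ]
      have h2 := ih (m + 1) (f a) none
      rw [show n + (m + 1) = n + 1 + m by ring] at h2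
      refine exec_loop_cons (by simp [hpq, List.replicate_succ]) rfl
        (Exec.seq hb (h a _ _ _) le_rfl) h2 ?_
      rw [Nat.succ_mul]; omega
  have h1 := hloop n 0 a g
  refine .seq h1 ((exec_move hpq.symm).to_eq ?_ le_rfl) ?_
  · congr 1
    funext j
    simp only [update_apply]
    split_ifs <;> simp_all
  · simp only [update_self, List.length_replicate]
    nlinarith

/-- The digit coded by two certificate bits. -/
def bitsDigit (g h : Option Sym) : SignType :=
  if g = some (certSym true) then (if h = some (certSym true) then -1 else 1) else 0

/-- Read one digit. -/
def readDigit : Cmd Reg Sym Ctl :=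
  .block [pop .inp, .pop .inp fun v h => { v with sym := none, dig := bitsDigit v.sym h },
    .push .x fun v => digSym v.dig, .load fun v => { v with dig := 0 }]

/-- Read all states. -/
def readStates : Cmd Reg Sym Ctl :=
  forEach .mm .c (.seq (.block [pushConst .x ketSym])
    (forEach .lu .lb (.seq (.block [pushConst .x commaSym]) (forEach .nu .nb readDigit))))

/-- The effect of reading a digit: the digits read so far, newest first, and the remaining
certificate. -/
def nextDigit (s : List SignType × List Bool) : List SignType × List Bool :=
  (bitsDigit (s.2.head?.map certSym) (s.2.tail.head?.map certSym) :: s.1, s.2.tail.tail)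

/-- The effect of reading a level of `n` digits. -/
def nextLevel (n : ℕ) (s : List (List SignType) × List Bool) :
    List (List SignType) × List Bool :=
  let r := nextDigit^[n] ([], s.2)
  (r.1 :: s.1, r.2)

/-- The effect of reading a state with `L` levels of `n` digits. -/
def nextState (n L : ℕ) (s : List (List (List SignType)) × List Bool) :
    List (List (List SignType)) × List Bool :=
  let r := (nextLevel n)^[L] ([], s.2)
  (r.1 :: s.1, r.2)

/-- A level of digits on a stack. -/
def showLevel (l : List SignType) : List Sym := l.map digSym ++ [commaSym]

/-- A state on a stack. -/
def showState (s : List (List SignType)) : List Sym := s.flatMap showLevel ++ [ketSym]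

/-- Missing bits count as the digit 0, so certificates of every length are decoded without an error
case. -/
theorem exec_readDigits (n : ℕ) (c : List Bool) (hnu : S .nu = List.replicate n mark)
    (hnb : S .nb = []) (hinp : S .inp = c.map certSym) :
    Exec (forEach .nu .nb readDigit) ⟨ctl g ok, S⟩ (n * 5 + 2)
      ⟨ctl none ok, update (update S .inp ((nextDigit^[n] ([], c)).2.map certSym)) .x
        ((nextDigit^[n] ([], c)).1.map digSym ++ S .x)⟩ := by
  have h := exec_forEach (p := .nu) (q := .nb) (g := g) (ok := ok) (by simp) (f := nextDigit)
    (F := fun s => update (update S .inp (s.2.map certSym)) .x (s.1.map digSym ++ S .x))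
    (body := readDigit) (t := 1) (fun s P Q g => exec_block (by
      simp [pop, Ctl.read, ctl]
      funext j; cases j <;> simp [nextDigit])) n ([], c)
  have hS : update (update (update (update S .inp (c.map certSym)) .x
      (([] : List SignType).map digSym ++ S .x)) .nu (List.replicate n mark)) .nb [] = S := by
    funext j; cases j <;> simp [hnu, hnb, hinp]
  rw [hS] at h
  refine h.to_eq ?_ le_rfl
  congr 1
  funext j; cases j <;> simp [hnu, hnb]

theorem exec_readLevels (n L : ℕ) (c : List Bool) (hnu : S .nu = List.replicate n mark)
    (hnb : S .nb = []) (hlu : S .lu = List.replicate L mark) (hlb : S .lb = [])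
    (hinp : S .inp = c.map certSym) :
    Exec (forEach .lu .lb (.seq (.block [pushConst .x commaSym]) (forEach .nu .nb readDigit)))
      ⟨ctl g ok, S⟩ (L * (n * 5 + 7) + 2)
      ⟨ctl none ok, update (update S .inp (((nextLevel n)^[L] ([], c)).2.map certSym)) .x
        (((nextLevel n)^[L] ([], c)).1.flatMap showLevel ++ S .x)⟩ := by
  have h := exec_forEach (p := .lu) (q := .lb) (g := g) (ok := ok) (by simp) (f := nextLevel n)
    (F := fun s => update (update S .inp (s.2.map certSym)) .x (s.1.flatMap showLevel ++ S .x))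
    (body := .seq (.block [pushConst .x commaSym]) (forEach .nu .nb readDigit)) (t := n * 5 + 3)
    (fun s P Q g => by
      have h := exec_readDigits n s.2 (g := g) (ok := ok) (S := update (update (update (update S
        .inp (s.2.map certSym)) .x (commaSym :: (s.1.flatMap showLevel ++ S .x))) .lu P) .lb Q)
        (by simp [hnu]) (by simp [hnb]) (by simp)
      refine exec_block_seq ?_ (h.to_eq ?_ le_rfl) le_rfl
      · simp only [runBlock_cons, runBlock_nil, pushConst, Instr.run_push]
        congr 1
        funext j; cases j <;> simp
      · congr 1
        funext j; cases j <;> simp [nextLevel, showLevel]) L ([], c)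
  have hS : update (update (update (update S .inp (c.map certSym)) .x
      (([] : List (List SignType)).flatMap showLevel ++ S .x)) .lu (List.replicate L mark)) .lb []
      = S := by
    funext j; cases j <;> simp [hlu, hlb, hinp]
  rw [hS] at h
  refine h.to_eq ?_ le_rfl
  congr 1
  funext j; cases j <;> simp [hlu, hlb]

theorem exec_readStates (n L m : ℕ) (c : List Bool) (hnu : S .nu = List.replicate n mark)
    (hnb : S .nb = []) (hlu : S .lu = List.replicate L mark) (hlb : S .lb = [])
    (hmm : S .mm = List.replicate m mark) (hc : S .c = [])
    (hinp : S .inp = c.map certSym) :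
    Exec readStates ⟨ctl g ok, S⟩ (m * (L * (n * 5 + 7) + 7) + 2)
      ⟨ctl none ok, update (update S .inp (((nextState n L)^[m] ([], c)).2.map certSym)) .x
        (((nextState n L)^[m] ([], c)).1.flatMap showState ++ S .x)⟩ := by
  have h := exec_forEach (p := .mm) (q := .c) (g := g) (ok := ok) (by simp) (f := nextState n L)
    (F := fun s => update (update S .inp (s.2.map certSym)) .x (s.1.flatMap showState ++ S .x))
    (body := .seq (.block [pushConst .x ketSym])
      (forEach .lu .lb (.seq (.block [pushConst .x commaSym]) (forEach .nu .nb readDigit))))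
    (t := L * (n * 5 + 7) + 3)
    (fun s P Q g => by
      have h := exec_readLevels n L s.2 (g := g) (ok := ok) (S := update (update (update (update S
        .inp (s.2.map certSym)) .x (ketSym :: (s.1.flatMap showState ++ S .x))) .mm P) .c Q)
        (by simp [hnu]) (by simp [hnb]) (by simp [hlu]) (by simp [hlb]) (by simp)
      refine exec_block_seq ?_ (h.to_eq ?_ le_rfl) le_rfl
      · simp only [runBlock_cons, runBlock_nil, pushConst, Instr.run_push]
        congr 1
        funext j; cases j <;> simp
      · congr 1
        funext j; cases j <;> simp [nextState, showState]) m ([], c)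
  have hS : update (update (update (update S .inp (c.map certSym)) .x
      (([] : List (List (List SignType))).flatMap showState ++ S .x)) .mm (List.replicate m mark))
      .c [] = S := by
    funext j; cases j <;> simp [hmm, hc, hinp]
  rw [hS] at h
  refine h.to_eq ?_ le_rfl
  congr 1
  funext j; cases j <;> simp [hmm, hc]

/-! ### Pairing consecutive states -/

/-- The symbol does not close a row or a state. -/
abbrev notKet (g : Sym) : Bool := g ≠ ketSym

/-- The symbol does not close a number or a level. -/
abbrev notComma (g : Sym) : Bool := g ≠ commaSym

theorem digSym_ne_ket (d : SignType) : digSym d ≠ ketSym := by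
  cases d <;> simp [digSym]

theorem digSym_ne_comma (d : SignType) : digSym d ≠ commaSym := by
  cases d <;> simp [digSym]

theorem notKet_of_mem_levels {u : List (List SignType)} {g : Sym} (h : g ∈ u.flatMap showLevel) :
    notKet g = true := by
  simp only [List.mem_flatMap, showLevel, List.mem_append, List.mem_map, List.mem_singleton] at h
  obtain ⟨l, -, ⟨d, -, rfl⟩ | rfl⟩ := h
  · simpa using digSym_ne_ket d
  · simp

/-- Put on `y` the states on `x`, the first one moved to the end. -/
def rotate : Cmd Reg Sym Ctl :=
  .seq (moveWhile notKet .x .a) <| .seq (.block [pushConst .a ketSym]) <| .seq (move .x .b) <|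
    .seq (moveWhile₂ (fun _ => true) .a .y .c) <| .seq (moveWhile₂ (fun _ => true) .b .x .y) <|
    .seq (move .c .a) (move .a .x)

/-- Moving reverses a stack, so every part is moved twice. The first state is put on `y` before the
others and thus ends up below them, while on `x` the original order is restored. -/
theorem exec_rotate {u : List (List SignType)} {rest : List Sym} (hx : S .x = showState u ++ rest)
    (ha : S .a = []) (hb : S .b = []) (hc : S .c = []) (hy : S .y = []) :
    Exec rotate ⟨ctl g ok, S⟩ (8 * (S .x).length + 7)
      ⟨ctl none ok, update S .y (rest ++ showState u)⟩ := by
  set U := showState u with hU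
  have h1 : Exec (moveWhile notKet .x .a) ⟨ctl g ok, S⟩ (2 * U.length)
      ⟨ctl (some ketSym) ok, update (update S .x rest) .a (u.flatMap showLevel).reverse⟩ := by
    refine (exec_moveWhile (v := ctl g ok) (w := u.flatMap showLevel) (rest := ketSym :: rest)
      (by simp) (by simp [hx, hU, showState])
      (fun g hg => notKet_of_mem_levels hg) (by simp)).to_eq ?_ ?_
    · simp [ha]
    · simp only [hU, showState, List.length_append, List.length_singleton]; omega
  -- The closing symbol swallowed by the preceding loop is replaced.
  have h2 : Exec (.block [pushConst .a ketSym])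
      ⟨ctl (some ketSym) ok, update (update S .x rest) .a (u.flatMap showLevel).reverse⟩ 1
      ⟨ctl (some ketSym) ok, update (update S .x rest) .a U.reverse⟩ :=
    exec_block (by simp [pushConst, hU, showState])
  have h3 : Exec (move .x .b)
      ⟨ctl (some ketSym) ok, update (update S .x rest) .a U.reverse⟩ (2 * rest.length + 1)
      ⟨ctl none ok, update (update (update S .x []) .a U.reverse) .b rest.reverse⟩ := by
    refine (exec_move (v := ctl (some ketSym) ok) (by simp)).to_eq ?_ (by simp)
    rw [ctl_read]
    congr 1
    funext j; cases j <;> simp [hb]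
  have h4 : Exec (moveWhile₂ (fun _ => true) .a .y .c)
      ⟨ctl none ok, update (update (update S .x []) .a U.reverse) .b rest.reverse⟩
      (2 * U.length + 1)
      ⟨ctl none ok, update (update (update (update S .x []) .b rest.reverse) .y U) .c U⟩ := by
    refine (exec_move₂ (v := ctl none ok) (by simp) (by simp) (by simp)).to_eq ?_ (by simp)
    rw [ctl_read]
    congr 1
    funext j; cases j <;> simp [hy, hc, ha]
  have h5 : Exec (moveWhile₂ (fun _ => true) .b .x .y)
      ⟨ctl none ok, update (update (update (update S .x []) .b rest.reverse) .y U) .c U⟩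
      (2 * rest.length + 1)
      ⟨ctl none ok, update (update (update S .x rest) .y (rest ++ U)) .c U⟩ := by
    refine (exec_move₂ (v := ctl none ok) (by simp) (by simp) (by simp)).to_eq ?_ (by simp)
    rw [ctl_read]
    congr 1
    funext j; cases j <;> simp [hb]
  have h6 : Exec (move .c .a)
      ⟨ctl none ok, update (update (update S .x rest) .y (rest ++ U)) .c U⟩
      (2 * U.length + 1)
      ⟨ctl none ok, update (update (update S .x rest) .y (rest ++ U)) .a U.reverse⟩ := by
    refine (exec_move (v := ctl none ok) (by simp)).to_eq ?_ (by simp)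
    rw [ctl_read]
    congr 1
    funext j; cases j <;> simp [hc, ha]
  have h7 : Exec (move .a .x)
      ⟨ctl none ok, update (update (update S .x rest) .y (rest ++ U)) .a U.reverse⟩
      (2 * U.length + 1) ⟨ctl none ok, update S .y (rest ++ U)⟩ := by
    refine (exec_move (v := ctl none ok) (by simp)).to_eq ?_ (by simp)
    rw [ctl_read]
    congr 1
    funext j; cases j <;> simp [hx, ha]
  refine (h1.seq (h2.seq (h3.seq (h4.seq (h5.seq (h6.seq h7 le_rfl) le_rfl) le_rfl) le_rfl) le_rfl)
    ?_)
  rw [hx, List.length_append]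
  omega

/-- Executing `c` from `s` leads to executing `c` from `s'` after at most `t` steps. -/
def Steps (c : Cmd Reg Sym Ctl) (s : Store Reg Sym Ctl) (t : ℕ) (s' : Store Reg Sym Ctl) : Prop :=
  ∀ T s'', Exec c s' T s'' → Exec c s (T + t) s''

theorem Steps.refl {c : Cmd Reg Sym Ctl} {s : Store Reg Sym Ctl} : Steps c s 0 s :=
  fun _ _ h => h

theorem Steps.trans {c : Cmd Reg Sym Ctl} {s₁ s₂ s₃ : Store Reg Sym Ctl} {t₁ t₂ t : ℕ}
    (h₁ : Steps c s₁ t₁ s₂) (h₂ : Steps c s₂ t₂ s₃) (ht : t₁ + t₂ ≤ t) : Steps c s₁ t s₃ :=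
  fun T s h => (h₁ _ _ (h₂ T s h)).mono (by omega)

theorem Steps.to_eq {c : Cmd Reg Sym Ctl} {s₁ s₂ s₃ : Store Reg Sym Ctl} {t t' : ℕ}
    (h : Steps c s₁ t s₂) (hs : s₂ = s₃) (ht : t ≤ t') : Steps c s₁ t' s₃ :=
  hs ▸ h.trans .refl ht

theorem steps_loop {q : Sym → Bool} {k : Reg} {body : Cmd Reg Sym Ctl} {g : Sym} {v : Ctl}
    {l : List Sym} {s₁ : Store Reg Sym Ctl} {t₁ : ℕ} (hS : S k = g :: l) (hg : q g = true)
    (h₁ : Exec body ⟨v.read (some g), update S k l⟩ t₁ s₁) :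
    Steps (.loop [pop k] (symSat q) body) ⟨v, S⟩ (t₁ + 1) s₁ :=
  fun _ _ h => exec_loop_cons hS hg h₁ h (by omega)

/-- The internal state while pairing states. -/
def ctlDig (g : Option Sym) (d : SignType) (ok : Bool) : Ctl := ⟨g, d, 0, 0, 0, ok⟩

@[simp]
theorem ctlDig_read (g h : Option Sym) (d : SignType) (ok : Bool) :
    (ctlDig g d ok).read h = ctlDig h d ok := rfl

@[simp]
theorem ctlDig_sym (g : Option Sym) (d : SignType) (ok : Bool) : (ctlDig g d ok).sym = g := rfl

/-- Pair the states on `x` and `y` level by level; every level gets an additional digit, so that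
these digits represent `-1`. -/
def mergeLoop : Cmd Reg Sym Ctl :=
  .loop [pop .x] gotSym <| .ite (symSat fun g => g = ketSym)
    (.block [pop .y, pushConst .zb ketSym, .load fun v => { v with dig := -1 }])
    (.ite (symSat fun g => g = commaSym)
      (.seq (moveWhile notComma .y .zb)
        (.block [.push .zb fun v => digSym v.dig, .load fun v => { v with dig := 1 }]))
      (.block [pushSym .zb]))

theorem steps_merge_digits {d : SignType} {l : List SignType} {w : List Sym}
    (hx : S .x = l.map digSym ++ w) : ∃ g',
    Steps mergeLoop ⟨ctlDig g d ok, S⟩ (4 * l.length)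
      ⟨ctlDig g' d ok, update (update S .x w) .zb ((l.map digSym).reverse ++ S .zb)⟩ := by
  induction l generalizing S g with
  | nil =>
    refine ⟨g, Steps.refl.to_eq ?_ (by simp)⟩
    congr 1
    funext j; cases j <;> simp [hx]
  | cons e l ih =>
    have h1 : Steps mergeLoop ⟨ctlDig g d ok, S⟩ 4 ⟨ctlDig (some (digSym e)) d ok,
        update (update S .x (l.map digSym ++ w)) .zb (digSym e :: S .zb)⟩ := by
      refine steps_loop hx rfl (.ite_false (t₁ := 2) ?_ (.ite_false (t₁ := 1) ?_ (exec_block ?_)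
        le_rfl) le_rfl)
      · simpa [symSat] using digSym_ne_ket e
      · simpa [symSat] using digSym_ne_comma e
      · simp [pushSym]
    obtain ⟨g', h2⟩ := ih (g := some (digSym e)) (S := update (update S .x (l.map digSym ++ w)) .zb
      (digSym e :: S .zb)) (by simp)
    refine ⟨g', (h1.trans h2 le_rfl).to_eq ?_ (by simp; omega)⟩
    congr 1
    funext j; cases j <;> simp

/-- The comma on `x` triggers the transfer of the level on `y` and of the extra digit, which is 1
from then on. The extra digits -1, 1, ..., 1 have value -2^(L-1) + 2^(L-2) + ... + 1 = -1; in this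
form only the first level needs to be recognised, never the last. -/
theorem steps_merge_level {d : SignType} {p q : List SignType} {w w' : List Sym}
    (hx : S .x = showLevel p ++ w) (hy : S .y = showLevel q ++ w') : ∃ g',
    Steps mergeLoop ⟨ctlDig g d ok, S⟩ (5 * (showLevel p).length + 2 * (showLevel q).length)
      ⟨ctlDig g' 1 ok, update (update (update S .x w) .y w') .zb
        (((p ++ q ++ [d]).map digSym).reverse ++ S .zb)⟩ := by
  obtain ⟨g₁, h1⟩ := steps_merge_digits (g := g) (d := d) (ok := ok) (l := p) (w := commaSym :: w)
    (S := S) (by simp [hx, showLevel])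
  set S₁ := update (update S .x (commaSym :: w)) .zb ((p.map digSym).reverse ++ S .zb) with hS₁
  have h2 : Exec (moveWhile notComma .y .zb) ⟨ctlDig (some commaSym) d ok, update S₁ .x w⟩
      (2 * q.length + 1) ⟨ctlDig (some commaSym) d ok, update (update (update S .x w) .y w') .zb
        (((p ++ q).map digSym).reverse ++ S .zb)⟩ := by
    refine (exec_moveWhile (v := ctlDig (some commaSym) d ok) (w := q.map digSym)
      (rest := commaSym :: w') (by simp) (by simp [hS₁, hy, showLevel]) ?_ (by simp)).to_eq ?_
      (by simp)
    · intro g hg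
      obtain ⟨e, -, rfl⟩ := List.mem_map.1 hg
      simpa using digSym_ne_comma e
    · simp only [List.head?_cons, ctlDig_read]
      congr 1
      funext j; cases j <;> simp [hS₁]
  have h3 : Steps mergeLoop ⟨ctlDig g₁ d ok, S₁⟩ (2 * q.length + 5)
      ⟨ctlDig (some commaSym) 1 ok, update (update (update S .x w) .y w') .zb
        (((p ++ q ++ [d]).map digSym).reverse ++ S .zb)⟩ := by
    refine (steps_loop (g := commaSym) (l := w) (by simp [hS₁]) rfl
      (.ite_false (t₁ := 2 * q.length + 3) (by simp [symSat, ctlDig, Ctl.read])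
        (.ite_true (by simp [symSat, ctlDig, Ctl.read])
      (h2.seq (exec_block rfl) le_rfl) le_rfl) le_rfl)).to_eq ?_ (by omega)
    simp [ctlDig]
  refine ⟨_, h1.trans h3 ?_⟩
  simp [showLevel]
  omega

/-- The paired levels of two states, with the additional digits. -/
def mergeLevels : SignType → List (List SignType) → List (List SignType) → List (List SignType)
  | d, p :: ps, q :: qs => (p ++ q ++ [d]) :: mergeLevels 1 ps qs
  | _, _, _ => []

theorem steps_merge_levels {d : SignType} {ps qs : List (List SignType)} {w w' : List Sym}
    (hlen : ps.length = qs.length)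
    (hx : S .x = ps.flatMap showLevel ++ w) (hy : S .y = qs.flatMap showLevel ++ w') : ∃ g' d',
    Steps mergeLoop ⟨ctlDig g d ok, S⟩
      (5 * (ps.flatMap showLevel).length + 2 * (qs.flatMap showLevel).length)
      ⟨ctlDig g' d' ok, update (update (update S .x w) .y w') .zb
        (((mergeLevels d ps qs).flatten.map digSym).reverse ++ S .zb)⟩ := by
  induction ps generalizing S g d qs with
  | nil =>
    obtain rfl : qs = [] := List.eq_nil_of_length_eq_zero hlen.symm
    refine ⟨g, d, Steps.refl.to_eq ?_ (by simp)⟩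
    congr 1
    funext j; cases j <;> simp [hx, hy, mergeLevels]
  | cons p ps ih =>
    cases qs with
    | nil => simp at hlen
    | cons q qs =>
      obtain ⟨g₁, h1⟩ := steps_merge_level (g := g) (d := d) (ok := ok) (S := S) (p := p) (q := q)
        (w := ps.flatMap showLevel ++ w) (w' := qs.flatMap showLevel ++ w')
        (by simp [hx]) (by simp [hy])
      obtain ⟨g', d', h2⟩ := ih (g := g₁) (d := 1) (qs := qs) (S := update (update (update S .x
        (ps.flatMap showLevel ++ w)) .y (qs.flatMap showLevel ++ w')) .zb
        (((p ++ q ++ [d]).map digSym).reverse ++ S .zb)) (by simpa using hlen)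
        (by simp) (by simp)
      refine ⟨g', d', (h1.trans h2 le_rfl).to_eq ?_ ?_⟩
      · congr 1
        funext j; cases j <;> simp [mergeLevels]
      · simp only [List.flatMap_cons, List.length_append]; omega

/-- A paired state on a stack. -/
def showBlock (b : List (List SignType)) : List Sym := b.flatten.map digSym ++ [ketSym]

/-- The symbol closing a state on `x` is matched by one on `y`, and it resets the extra digit to -1
for the next pair. -/
theorem steps_merge_states {P Q : List (List (List SignType))}
    (hlen : List.Forall₂ (fun p q => p.length = q.length) P Q)
    (hx : S .x = P.flatMap showState) (hy : S .y = Q.flatMap showState) : ∃ g',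
    Steps mergeLoop ⟨ctlDig g (-1) ok, S⟩
      (5 * (P.flatMap showState).length + 2 * (Q.flatMap showState).length)
      ⟨ctlDig g' (-1) ok, update (update (update S .x []) .y []) .zb
        (((List.zipWith (mergeLevels (-1)) P Q).flatMap showBlock).reverse ++ S .zb)⟩ := by
  induction hlen generalizing S g with
  | nil =>
    refine ⟨g, Steps.refl.to_eq ?_ (by simp)⟩
    congr 1
    funext j; cases j <;> simp_all
  | @cons p q P Q hpq _ ih =>
    obtain ⟨g₁, d₁, h1⟩ := steps_merge_levels (g := g) (d := -1) (ok := ok) (S := S) (ps := p)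
      (qs := q) (w := ketSym :: P.flatMap showState) (w' := ketSym :: Q.flatMap showState) hpq
      (by simp [hx, showState]) (by simp [hy, showState])
    set S₁ := update (update (update S .x (ketSym :: P.flatMap showState)) .y
      (ketSym :: Q.flatMap showState)) .zb
      (((mergeLevels (-1) p q).flatten.map digSym).reverse ++ S .zb) with hS₁
    have h2 : Steps mergeLoop ⟨ctlDig g₁ d₁ ok, S₁⟩ 3 ⟨ctlDig (some ketSym) (-1) ok,
        update (update (update S .x (P.flatMap showState)) .y (Q.flatMap showState)) .zb
          ((showBlock (mergeLevels (-1) p q)).reverse ++ S .zb)⟩ := by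
      refine steps_loop (g := ketSym) (l := P.flatMap showState) (by simp [hS₁]) rfl
        (.ite_true (t₁ := 1) (by simp [symSat, ctlDig, Ctl.read]) (exec_block ?_) le_rfl)
      simp only [runBlock_cons, runBlock_nil, pop, pushConst, Instr.run_pop, Instr.run_push,
        Instr.run_load]
      congr 1
      funext j; cases j <;> simp [hS₁, showBlock]
    obtain ⟨g', h3⟩ := ih (g := some ketSym) (S := update (update (update S .x
      (P.flatMap showState)) .y (Q.flatMap showState)) .zb
        ((showBlock (mergeLevels (-1) p q)).reverse ++ S .zb)) (by simp) (by simp)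
    refine ⟨g', (h1.trans (h2.trans h3 le_rfl) le_rfl).to_eq ?_ ?_⟩
    · congr 1
      funext j; cases j <;> simp
    · simp only [List.flatMap_cons, List.length_append, showState, List.length_singleton]; omega

/-- Pair the states on `x` and `y` and put the result on `z`. -/
def merge : Cmd Reg Sym Ctl :=
  .seq (.block [.load fun v => { v with dig := -1 }]) <| .seq mergeLoop <|
    .seq (.block [.load fun v => { v with dig := 0 }]) (move .zb .z)

theorem exec_merge {P Q : List (List (List SignType))}
    (hlen : List.Forall₂ (fun p q => p.length = q.length) P Q)
    (hx : S .x = P.flatMap showState) (hy : S .y = Q.flatMap showState) (hz : S .z = [])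
    (hzb : S .zb = []) :
    Exec merge ⟨ctl g ok, S⟩ (5 * (P.flatMap showState).length + 2 * (Q.flatMap showState).length +
        2 * ((List.zipWith (mergeLevels (-1)) P Q).flatMap showBlock).length + 4)
      ⟨ctl none ok, update (update (update S .x []) .y []) .z
        ((List.zipWith (mergeLevels (-1)) P Q).flatMap showBlock)⟩ := by
  set Z := (List.zipWith (mergeLevels (-1)) P Q).flatMap showBlock
  obtain ⟨g', h1⟩ := steps_merge_states (g := g) (ok := ok) hlen hx hy
  have h2 := h1 _ _ (exec_loop_nil (by simp))
  refine exec_block_seq (s₁ := ⟨ctlDig g (-1) ok, S⟩) rfl (h2.seq (t₂ := 2 * Z.length + 2)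
    (exec_block_seq (t := 2 * Z.length + 1)
    (s₁ := ⟨ctl none ok, update (update (update S .x []) .y []) .zb Z.reverse⟩) ?_
    ((exec_move (v := ctl none ok) (by simp)).to_eq ?_ (by simp)) le_rfl) le_rfl) (by omega)
  · simp [ctlDig, Ctl.read, ctl, hzb, Z]
  · rw [ctl_read]
    congr 1
    funext j; cases j <;> simp [hz, hzb]

/-! ### Signed-digit arithmetic -/

/-- The value of a list of signed digits, least significant first. -/
def val : List Sym → ℤ
  | [] => 0
  | g :: l => (symDig g : ℤ) + 2 * val l

theorem val_append (l l' : List Sym) : val (l ++ l') = val l + 2 ^ l.length * val l' := by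
  induction l with
  | nil => simp [val]
  | cons g l ih => simp only [List.cons_append, val, ih, List.length_cons]; ring

/-- The value of a list of bits, least significant first. -/
def bitsVal : List Bool → ℕ
  | [] => 0
  | b :: l => b.toNat + 2 * bitsVal l

/-- The carry of a sum of three signed digits. -/
def carryOf (d e f : SignType) : SignType :=
  if 2 ≤ (d : ℤ) + e + f then 1 else if (d : ℤ) + e + f ≤ -2 then -1 else 0

/-- The last digit of a sum of three signed digits. -/
def digitOf (d e f : SignType) : SignType :=
  if 0 < (d : ℤ) + e + f - 2 * carryOf d e f then 1
  else if (d : ℤ) + e + f - 2 * carryOf d e f < 0 then -1 else 0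

/-- A sum of three signed digits lies between -3 and 3, so a signed digit and a signed carry can
represent it. Addition and subtraction thereby become the same procedure. -/
theorem digitOf_add_carryOf (d e f : SignType) :
    (digitOf d e f : ℤ) + 2 * (carryOf d e f : ℤ) = d + e + f := by
  revert d e f; decide

/-- The symbol is a bit. -/
def isBit : Sym → Bool
  | .inl (.bit _) => true
  | _ => false

/-- Add the digit `e`, the carry, and the digit `g` of the accumulator. -/
def addStep (v : Ctl) (e : SignType) (g : Option Sym) : Ctl :=
  { v with
    res := digitOf e v.car (g.elim 0 symDig)
    car := carryOf e v.car (g.elim 0 symDig) }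

/-- Add the bits of a number on `r`, multiplied by the current digit, to the accumulator. -/
def addBits : Cmd Reg Sym Ctl :=
  .loop [pop .r] (symSat isBit) <| .block [pushSym .rb,
    .pop .acc fun v g => addStep v (if v.sym = some (bitSym true) then v.dig else 0) g,
    .push .out fun v => digSym v.res]

/-- Add the carry to the rest of the accumulator. -/
def addCarry : Cmd Reg Sym Ctl :=
  .loop [pop .acc] gotSym <| .block [.load fun v => addStep v 0 v.sym,
    .push .out fun v => digSym v.res]

/-- Schoolbook addition: the value of the digits already output, of the carry, and of the untouched
part of the accumulator is invariant once the bits read so far are accounted for. -/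
theorem exec_addBits {d c e : SignType} {l : List Bool} {w : List Sym}
    (hr : S .r = l.map bitSym ++ commaSym :: w) : ∃ (c' e' : SignType) (o : List Sym),
    o.length = l.length ∧
    val o + 2 ^ l.length * (c' + val ((S .acc).drop l.length)) =
      c + val (S .acc) + d * bitsVal l ∧
    Exec addBits ⟨⟨g, d, c, e, 0, ok⟩, S⟩ (2 * l.length + 1)
      ⟨⟨some commaSym, d, c', e', 0, ok⟩, update (update (update (update S .r w)
        .rb ((l.map bitSym).reverse ++ S .rb)) .out (o.reverse ++ S .out))
        .acc ((S .acc).drop l.length)⟩ := by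
  induction l generalizing S g c e with
  | nil =>
    refine ⟨c, e, [], rfl, by simp [val, bitsVal], (exec_loop_stop (v := ⟨g, d, c, e, 0, ok⟩)
      (S := S) (k := .r) (by simp [hr, isBit])).to_eq ?_ (by simp)⟩
    rw [hr]
    congr 1
    funext j; cases j <;> simp
  | cons b l ih =>
    -- An accumulator shorter than the number is continued by zeros.
    set t : SignType := (S .acc).head?.elim 0 symDig with ht
    set f : SignType := if b then d else 0 with hf
    have hacc : val (S .acc) = t + 2 * val (S .acc).tail := by
      rw [ht]
      cases S .acc <;> simp [val]
    have hfb : (f : ℤ) = d * b.toNat := by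
      rw [hf]; cases b <;> simp
    have hsum := digitOf_add_carryOf f c t
    set S₁ : Reg → List Sym := update (update (update (update S .r (l.map bitSym ++ commaSym :: w))
        .rb (bitSym b :: S .rb)) .out (digSym (digitOf f c t) :: S .out))
        .acc (S .acc).tail with hS₁
    have hb : Exec (.block [pushSym .rb,
        .pop .acc fun v g => addStep v (if v.sym = some (bitSym true) then v.dig else 0) g,
        .push .out fun v => digSym v.res])
        ⟨⟨some (bitSym b), d, c, e, 0, ok⟩, update S .r (l.map bitSym ++ commaSym :: w)⟩ 1
        ⟨⟨some (bitSym b), d, carryOf f c t, digitOf f c t, 0, ok⟩, S₁⟩ := by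
      refine exec_block ?_
      simp only [runBlock_cons, runBlock_nil, pushSym, Instr.run_pop, Instr.run_push]
      have e1 : (if (some (bitSym b) : Option Sym) = some (bitSym true) then d else 0) = f := by
        rw [hf]; cases b <;> simp
      simp only [addStep, e1]
      congr 1
      funext j; cases j <;> simp [hS₁, ht]
    obtain ⟨c', e', o, ho, hval, h⟩ := ih (S := S₁) (g := some (bitSym b)) (c := carryOf f c t)
      (e := digitOf f c t) (by simp [hS₁])
    refine ⟨c', e', digSym (digitOf f c t) :: o, by simp [ho], ?_, exec_loop_cons hr rfl hb
      (Exec.to_eq (c := addBits) h (s'' := ⟨⟨some commaSym, d, c', e', 0, ok⟩, _⟩) ?_ le_rfl) ?_⟩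
    · simp only [hS₁, update_self, ← List.drop_one, List.drop_drop] at hval
      rw [hacc]
      simp only [val, symDig_digSym, List.length_cons, bitsVal, Nat.cast_add, Nat.cast_mul,
        Nat.cast_ofNat]
      rw [Nat.add_comm 1] at hval
      rw [← List.drop_one]
      rw [pow_succ]
      linear_combination 2 * hval + hsum + hfb
    · congr 1
      funext j; cases j <;> simp [hS₁]
    · simp only [List.length_cons]; omega

theorem exec_addCarry {d c e : SignType} : ∃ (c' e' : SignType) (o : List Sym),
    o.length = (S .acc).length ∧ val o + 2 ^ o.length * (c' : ℤ) = c + val (S .acc) ∧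
    Exec addCarry ⟨⟨g, d, c, e, 0, ok⟩, S⟩ (2 * (S .acc).length + 1)
      ⟨⟨none, d, c', e', 0, ok⟩, update (update S .acc []) .out (o.reverse ++ S .out)⟩ := by
  generalize hl : S .acc = l
  induction l generalizing S g c e with
  | nil =>
    refine ⟨c, e, [], rfl, by simp [val], (exec_loop_nil hl).to_eq ?_ (by simp)⟩
    congr 1
    funext j; cases j <;> simp [hl]
  | cons x l ih =>
    set t := symDig x with ht
    have hsum := digitOf_add_carryOf 0 c t
    set S₁ : Reg → List Sym := update (update S .acc l) .out (digSym (digitOf 0 c t) :: S .out)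
      with hS₁
    have hb : Exec (.block [.load fun v => addStep v 0 v.sym, .push .out fun v => digSym v.res])
        ⟨⟨some x, d, c, e, 0, ok⟩, update S .acc l⟩ 1
        ⟨⟨some x, d, carryOf 0 c t, digitOf 0 c t, 0, ok⟩, S₁⟩ := by
      refine exec_block ?_
      simp [addStep, hS₁, ht]
    obtain ⟨c', e', o, ho, hval, h⟩ := ih (S := S₁) (g := some x) (c := carryOf 0 c t)
      (e := digitOf 0 c t) (by simp [hS₁])
    refine ⟨c', e', digSym (digitOf 0 c t) :: o, by simp [ho], ?_, exec_loop_cons hl rfl hb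
      (Exec.to_eq (c := addCarry) h (s'' := ⟨⟨none, d, c', e', 0, ok⟩, _⟩) ?_ le_rfl) ?_⟩
    · simp only [val, symDig_digSym, List.length_cons, pow_succ]
      rw [← ht]
      have : ((0 : SignType) : ℤ) = 0 := rfl
      linear_combination 2 * hval + hsum + this
    · congr 1
      funext j; cases j <;> simp [hS₁]
    · simp only [List.length_cons]; omega

/-- An integer on a stack. -/
def showInt (z : ℤ) : List Sym := (SLC.encodeIntComma z).map .inl

theorem showInt_eq (z : ℤ) : showInt z =
    bitSym (decide (z < 0)) :: ((encodeNat z.natAbs).map bitSym ++ [commaSym]) := by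
  simp [showInt, SLC.encodeIntComma, SLC.encodeNatComma, bitSym]

theorem bitsVal_encodePosNum (n : PosNum) : bitsVal (encodePosNum n) = n := by
  induction n with
  | one => rfl
  | bit0 n ih => simp [encodePosNum, bitsVal, ih, PosNum.cast_bit0]; ring
  | bit1 n ih => simp [encodePosNum, bitsVal, ih, PosNum.cast_bit1]; ring

theorem bitsVal_encodeNat (n : ℕ) : bitsVal (encodeNat n) = n := by
  unfold encodeNat
  conv_rhs => rw [← Num.to_of_nat n]
  cases (n : Num) with
  | zero => rfl
  | pos p => exact bitsVal_encodePosNum p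

/-- The sign bit, read as a digit, is 1 or -1 (and 1 for zero), so it can be multiplied directly
into the digit of the state. -/
theorem sign_mul_bitsVal (z : ℤ) :
    (symDig (bitSym (decide (z < 0))) : ℤ) * bitsVal (encodeNat z.natAbs) = z := by
  rw [bitsVal_encodeNat]
  rcases lt_or_ge z 0 with h | h
  · simp [bitSym, symDig, h]
    rw [abs_of_neg h]; ring
  · simp [bitSym, symDig, not_lt.2 h, abs_of_nonneg h]

/-- Add the next integer on `r`, multiplied by the digit read last, to the accumulator. -/
def addInt : Cmd Reg Sym Ctl :=
  .seq (.block [.load fun v => { v with dig := symDig (v.sym.getD mark) }, pop .r, pushSym .rb,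
    .load fun v => { v with dig := v.dig * symDig (v.sym.getD mark) }]) <|
  .seq addBits <| .seq (.block [pushSym .rb]) <| .seq addCarry <|
  .seq (.block [.push .out fun v => digSym v.car,
    .load fun v => { v with dig := 0, car := 0, res := 0 }]) <| move .out .acc

/-- The digit times the sign of the integer is -1, 0 or 1, so multiplication needs no shifts. The
accumulator is never normalised, but it grows by fewer symbols than the integer occupies, which
keeps the evaluation of a row linear in space. The integer is kept on `rb` for rewinding. -/
theorem exec_addInt {d : SignType} {z : ℤ} {w : List Sym} (hr : S .r = showInt z ++ w)
    (hout : S .out = []) : ∃ o : List Sym,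
    o.length + 1 ≤ (S .acc).length + (showInt z).length ∧ val o = val (S .acc) + d * z ∧
    Exec addInt ⟨ctl (some (digSym d)) ok, S⟩ (4 * (S .acc).length + 4 * (showInt z).length + 4)
      ⟨ctl none ok, update (update (update S .r w) .rb ((showInt z).reverse ++ S .rb)) .acc o⟩ := by
  rw [showInt_eq] at hr ⊢
  set l := encodeNat z.natAbs with hl
  set s := bitSym (decide (z < 0)) with hs
  set S₁ : Reg → List Sym := update (update S .r (l.map bitSym ++ commaSym :: w)) .rb (s :: S .rb)
    with hS₁
  obtain ⟨c₁, e₁, o₁, ho₁, hv₁, h1⟩ := exec_addBits (S := S₁) (g := some s) (ok := ok)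
    (d := d * symDig s) (c := 0) (e := 0) (l := l) (w := w) (by simp [hS₁])
  set S₂ : Reg → List Sym := update (update (update (update S .r w)
    .rb (commaSym :: ((l.map bitSym).reverse ++ s :: S .rb))) .out o₁.reverse)
    .acc ((S .acc).drop l.length) with hS₂
  obtain ⟨c₂, e₂, o₂, ho₂, hv₂, h2⟩ := exec_addCarry (S := S₂) (g := some commaSym) (ok := ok)
    (d := d * symDig s) (c := c₁) (e := e₁)
  have hacc1 : S₁ .acc = S .acc := by simp [hS₁]
  have hacc2 : S₂ .acc = (S .acc).drop l.length := by simp [hS₂]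
  rw [hacc1] at hv₁ h1
  rw [hacc2] at hv₂ h2 ho₂
  -- Digits where the number has bits, digits of the remaining accumulator, and the final carry.
  refine ⟨o₁ ++ o₂ ++ [digSym c₂], ?_, ?_, ?_⟩
  · simp only [List.length_append, ho₁, ho₂, List.length_drop, List.length_cons, List.length_nil,
      List.length_map]
    omega
  · have hz := sign_mul_bitsVal z
    rw [← hl, ← hs] at hz
    rw [val_append, val_append, List.length_append, pow_add, ho₁]
    simp only [val, symDig_digSym]
    have h0 : ((0 : SignType) : ℤ) = 0 := rfl
    have hmul : ((d * symDig s : SignType) : ℤ) = d * symDig s := by simp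
    rw [hmul] at hv₁
    linear_combination hv₁ + 2 ^ l.length * hv₂ + d * hz + h0
  · have h3 : Exec (.block [pushSym .rb]) ⟨⟨some commaSym, d * symDig s, c₁, e₁, 0, ok⟩,
        update (update (update (update S₁ .r w)
        .rb ((l.map bitSym).reverse ++ S₁ .rb)) .out (o₁.reverse ++ S₁ .out))
        .acc ((S .acc).drop l.length)⟩ 1 ⟨⟨some commaSym, d * symDig s, c₁, e₁, 0, ok⟩, S₂⟩ := by
      refine exec_block ?_
      simp only [runBlock_cons, runBlock_nil, pushSym, Instr.run_push]
      congr 1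
      funext j; cases j <;> simp [hS₁, hS₂, hout]
    have h4 : Exec (move .out .acc) ⟨ctl none ok,
        update (update (update (update S .r w) .rb ((s :: (l.map bitSym ++ [commaSym])).reverse ++
          S .rb)) .out (o₁ ++ o₂ ++ [digSym c₂]).reverse) .acc []⟩
        (2 * (l.length + ((S .acc).length - l.length) + 1) + 1)
        ⟨ctl none ok, update (update (update S .r w) .rb
          ((s :: (l.map bitSym ++ [commaSym])).reverse ++ S .rb)) .acc
          (o₁ ++ o₂ ++ [digSym c₂])⟩ := by
      refine (exec_move (v := ctl none ok) (by simp)).to_eq ?_ ?_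
      · rw [ctl_read]
        congr 1
        funext j; cases j <;> simp [hout]
      · simp [ho₁, ho₂]
        omega
    refine exec_block_seq (s₁ := ⟨⟨some s, d * symDig s, 0, 0, 0, ok⟩, S₁⟩) ?_ (h1.seq (h3.seq
      (h2.seq (exec_block_seq ?_ h4 le_rfl) le_rfl) le_rfl) le_rfl) ?_
    · simp only [runBlock_cons, runBlock_nil, pushSym, pop, Instr.run_push, Instr.run_load,
        Instr.run_pop]
      congr 1
      · simp [ctl, Ctl.read, hr]
      · funext j; cases j <;> simp [hr, hS₁]
    · simp only [runBlock_cons, runBlock_nil, Instr.run_push, Instr.run_load]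
      congr 1
      funext j; cases j <;> simp [hS₂]
    · simp only [List.length_drop, List.length_cons, List.length_append, List.length_map,
        List.length_nil]
      omega

/-! ### Evaluation of the rows -/

/-- The scalar product of digits and integers. -/
def dot : List SignType → List ℤ → ℤ
  | d :: ds, z :: zs => d * z + dot ds zs
  | _, _ => 0

/-- At the end of a row, go back to its beginning and double the accumulator. -/
def rewind : Cmd Reg Sym Ctl :=
  .seq (.block [pop .r]) <| .ite gotSym (.block [pushSym .r]) <|
    .seq (move .rb .r) (.block [pushConst .acc (digSym 0)])

/-- Clear the accumulator, and reject if its value is positive. -/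
def signTest : Cmd Reg Sym Ctl :=
  .seq (.loop [pop .acc] gotSym (.block [.load fun v =>
      { v with
        sgn := if symDig (v.sym.getD mark) = 0 then v.sgn else symDig (v.sym.getD mark) }]))
    (.block [.load fun v => { v with ok := v.ok && decide (v.sgn ≠ 1), sgn := 0 }])

/-- Evaluate the row on `r` at all paired states on `z`. -/
def evalLoop : Cmd Reg Sym Ctl :=
  .loop [pop .z] gotSym <| .seq (.block [pushSym .zb]) <|
    .ite (symSat fun g => g = ketSym) signTest (.seq addInt rewind)

/-- A row on a stack. -/
def showRow (I : List ℤ) : List Sym := I.flatMap showInt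

theorem showRow_cons (z : ℤ) (I : List ℤ) : showRow (z :: I) = showInt z ++ showRow I := by
  simp [showRow]

theorem exists_showRow {I : List ℤ} (hI : I ≠ []) : ∃ h l, showRow I = h :: l := by
  cases I with
  | nil => exact absurd rfl hI
  | cons z I => exact ⟨_, _, by rw [showRow_cons, showInt_eq]; rfl⟩

theorem exec_rewind_of_ne {h : Sym} {l : List Sym} (hr : S .r = h :: l) :
    Exec rewind ⟨ctl g ok, S⟩ 3 ⟨ctl (some h) ok, S⟩ := by
  refine exec_block_seq (s₁ := ⟨ctl (some h) ok, update S .r l⟩) (by simp [pop, hr])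
    (.ite_true (t₁ := 1) rfl (exec_block ?_) le_rfl) le_rfl
  simp only [runBlock_cons, runBlock_nil, pushSym, Instr.run_push]
  congr 1
  funext j; cases j <;> simp [hr]

/-- An empty `r` marks the end of a level. The digits are stored least significant first, so the
pushed zero doubles the accumulator as Horner's rule demands. -/
theorem exec_rewind_of_nil (hr : S .r = []) :
    Exec rewind ⟨ctl g ok, S⟩ (2 * (S .rb).length + 4) ⟨ctl none ok,
      update (update (update S .r (S .rb).reverse) .rb []) .acc (digSym 0 :: S .acc)⟩ := by
  have h : Exec (.seq (move .rb .r) (.block [pushConst .acc (digSym 0)])) ⟨ctl none ok, S⟩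
      (2 * (S .rb).length + 2) ⟨ctl none ok,
        update (update (update S .r (S .rb).reverse) .rb []) .acc (digSym 0 :: S .acc)⟩ := by
    refine (exec_move (v := ctl none ok) (by simp)).seq ((exec_block rfl).to_eq ?_ le_rfl) le_rfl
    simp only [runBlock_cons, runBlock_nil, pushConst, Instr.run_push, ctl_read]
    congr 1
    funext j; cases j <;> simp [hr]
  refine exec_block_seq (s₁ := ⟨ctl none ok, S⟩) ?_ (.ite_false rfl h le_rfl) le_rfl
  simp only [runBlock_cons, runBlock_nil, pop, Instr.run_pop, hr]
  congr 1
  funext j; cases j <;> simp [hr]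

/-- The induction runs over a split of the row into a part already used, reversed on `rb`, and a
part still on `r`. The quantity in `hB`, accumulator length plus symbols still to be read, does not
increase, so one bound `B` serves for the time of all digits. -/
theorem steps_eval_level {I pre suf : List ℤ} {ds : List SignType} {w : List Sym} {B : ℕ}
    (hI : I = pre ++ suf) (hsuf : suf ≠ []) (hlen : ds.length = suf.length)
    (hr : S .r = showRow suf) (hrb : S .rb = (showRow pre).reverse)
    (hz : S .z = ds.map digSym ++ w) (hout : S .out = [])
    (hB : (S .acc).length + (showRow suf).length ≤ B) (hIB : (showRow I).length ≤ B) :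
    ∃ (g' : Option Sym) (o : List Sym), val o = 2 * (val (S .acc) + dot ds suf) ∧
      o.length ≤ (S .acc).length + (showRow suf).length + 1 ∧
      Steps evalLoop ⟨ctl g ok, S⟩ (ds.length * (10 * B + 20))
        ⟨ctl g' ok, update (update (update (update (update S .r (showRow I)) .rb []) .z w)
          .zb ((ds.map digSym).reverse ++ S .zb)) .acc o⟩ := by
  induction ds generalizing S g pre suf with
  | nil => exact absurd (List.eq_nil_of_length_eq_zero hlen.symm) hsuf
  | cons d ds ih =>
    cases suf with
    | nil => exact absurd rfl hsuf
    | cons x suf =>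
      rw [showRow_cons] at hr hB
      rw [List.length_append] at hB
      set S₁ := update (update S .z (ds.map digSym ++ w)) .zb (digSym d :: S .zb) with hS₁
      obtain ⟨o, ho, hv, h1⟩ := exec_addInt (S := S₁) (d := d) (ok := ok) (z := x)
        (w := showRow suf) (by simp [hS₁, hr]) (by simp [hS₁, hout])
      have hacc : S₁ .acc = S .acc := by simp [hS₁]
      rw [hacc] at ho hv h1
      set S₂ := update (update (update S₁ .r (showRow suf)) .rb
        ((showInt x).reverse ++ S₁ .rb)) .acc o with hS₂
      have hstep : ∀ {t : ℕ} {s : Store Reg Sym Ctl},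
          Exec rewind ⟨ctl none ok, S₂⟩ t s → t ≤ 2 * B + 4 →
          Steps evalLoop ⟨ctl g ok, S⟩ (10 * B + 20) s := by
        intro t s hrew ht
        refine (steps_loop (g := digSym d) (l := ds.map digSym ++ w) (by simpa using hz) rfl
          (exec_block_seq (s₁ := ⟨ctl (some (digSym d)) ok, S₁⟩) ?_
            (.ite_false ?_ (h1.seq hrew le_rfl) le_rfl) le_rfl)).to_eq rfl ?_
        · simp only [runBlock_cons, runBlock_nil, pushSym, Instr.run_push, ctl_read]
          congr 1
        · simpa [symSat] using digSym_ne_ket d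
        · omega
      -- The level and the row have equal length, so the last digit meets the last integer and only
      -- then the row is rewound.
      rcases eq_or_ne suf [] with rfl | hne
      · obtain rfl : ds = [] := List.eq_nil_of_length_eq_zero (by simpa using hlen)
        have hrb₂ : (S₂ .rb).reverse = showRow I := by
          simp [hS₂, hS₁, hrb, hI, showRow]
        have hrb₂' : (S₂ .rb).length = (showRow I).length := by
          rw [← hrb₂, List.length_reverse]
        refine ⟨none, digSym 0 :: o, ?_, ?_, (hstep (exec_rewind_of_nil (by simp [hS₂, showRow]))
          (by omega)).to_eq ?_ (by simp)⟩
        · have h0 : ((0 : SignType) : ℤ) = 0 := rfl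
          simp only [val, symDig_digSym, dot, hv]
          linear_combination h0
        · rw [showRow_cons, List.length_append, List.length_cons]
          omega
        · rw [hrb₂]
          congr 1
          funext j; cases j <;> simp [hS₂, hS₁]
      · obtain ⟨h, l, hhl⟩ := exists_showRow hne
        have h2 := hstep (exec_rewind_of_ne (h := h) (l := l) (by simp [hS₂, hhl])) (by omega)
        obtain ⟨g', o', hv', ho', h3⟩ := ih (S := S₂) (g := some h) (pre := pre ++ [x])
          (suf := suf) (by simp [hI]) hne (by simpa using hlen) (by simp [hS₂])
          (by simp [hS₂, hS₁, hrb, showRow]) (by simp [hS₂, hS₁]) (by simp [hS₂, hS₁, hout])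
          (by simp only [hS₂, update_self]; omega)
        have hacc₂ : S₂ .acc = o := by simp [hS₂]
        rw [hacc₂] at hv' ho'
        refine ⟨g', o', ?_, ?_, (h2.trans h3 le_rfl).to_eq ?_ ?_⟩
        · rw [hv', hv]; simp only [dot]; ring
        · rw [showRow_cons, List.length_append]
          omega
        · congr 1
          funext j; cases j <;> simp [hS₂, hS₁]
        · rw [List.length_cons, Nat.add_mul ds.length, one_mul, Nat.add_comm]

/-- The value of a row at a paired state, starting from `v`, up to a factor of two. -/
def evalLevels (I : List ℤ) (v : ℤ) (ls : List (List SignType)) : ℤ :=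
  ls.foldl (fun v ds => 2 * (v + dot ds I)) v

/-- Every level lengthens the accumulator by at most the length of the row plus one; the additional
summand in `hB` is room for the row itself. -/
theorem steps_eval_levels {I : List ℤ} {ls : List (List SignType)} {w : List Sym} {B : ℕ}
    (hI : I ≠ []) (hlen : ∀ ds ∈ ls, ds.length = I.length)
    (hr : S .r = showRow I) (hrb : S .rb = []) (hz : S .z = ls.flatten.map digSym ++ w)
    (hout : S .out = [])
    (hB : (S .acc).length + (ls.length + 1) * ((showRow I).length + 1) ≤ B) :
    ∃ (g' : Option Sym) (o : List Sym), val o = evalLevels I (val (S .acc)) ls ∧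
      o.length ≤ B ∧
      Steps evalLoop ⟨ctl g ok, S⟩ (ls.flatten.length * (10 * B + 20))
        ⟨ctl g' ok, update (update (update S .z w)
          .zb ((ls.flatten.map digSym).reverse ++ S .zb)) .acc o⟩ := by
  induction ls generalizing S g with
  | nil =>
    refine ⟨g, S .acc, rfl, by omega, Steps.refl.to_eq ?_ (by simp)⟩
    congr 1
    funext j; cases j <;> simp [hz]
  | cons ds ls ih =>
    rw [List.length_cons, Nat.succ_mul] at hB
    have hpos : (showRow I).length + 1 ≤ (ls.length + 1) * ((showRow I).length + 1) :=
      Nat.le_mul_of_pos_left _ (by omega)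
    obtain ⟨g₁, o₁, hv₁, ho₁, h1⟩ := steps_eval_level (S := S) (g := g) (ok := ok) (I := I)
      (pre := []) (suf := I) (ds := ds) (w := ls.flatten.map digSym ++ w) (B := B) rfl hI
      (hlen ds (by simp)) hr (by simp [hrb, showRow]) (by simp [hz]) hout (by omega) (by omega)
    set S₁ := update (update (update (update (update S .r (showRow I)) .rb []) .z
      (ls.flatten.map digSym ++ w)) .zb ((ds.map digSym).reverse ++ S .zb)) .acc o₁ with hS₁
    have hacc : S₁ .acc = o₁ := by simp [hS₁]
    obtain ⟨g', o, hv, ho, h2⟩ := ih (S := S₁) (g := g₁) (fun l hl => hlen l (by simp [hl]))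
      (by simp [hS₁]) (by simp [hS₁]) (by simp [hS₁]) (by simp [hS₁, hout])
      (by rw [hacc]; omega)
    refine ⟨g', o, ?_, ho, (h1.trans h2 le_rfl).to_eq ?_ ?_⟩
    · rw [hv, hacc, hv₁]; rfl
    · congr 1
      funext j; cases j <;> simp [hS₁, hr, hrb]
    · simp only [List.flatten_cons, List.length_append]
      rw [Nat.add_mul]

/-- A digit is too small to change the sign of a nonzero even number. Hence a signed-digit number
has the sign of its most significant nonzero digit, found by overwriting a variable with each
nonzero digit while reading upwards. -/
theorem sign_digit_add (d s : SignType) (k : ℤ) :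
    (if (d : ℤ) + 2 * k = 0 then s else SignType.sign ((d : ℤ) + 2 * k)) =
      if k = 0 then (if d = 0 then s else d) else SignType.sign k := by
  rcases lt_trichotomy k 0 with hk | rfl | hk
  · have h1 : (d : ℤ) + 2 * k < 0 := by
      have : (d : ℤ) ≤ 1 := by cases d <;> decide
      omega
    rw [if_neg hk.ne, if_neg h1.ne, sign_neg hk, sign_neg h1]
  · cases d <;> simp
  · have h1 : 0 < (d : ℤ) + 2 * k := by
      have : -1 ≤ (d : ℤ) := by cases d <;> decide
      omega
    rw [if_neg hk.ne', if_neg h1.ne', sign_pos hk, sign_pos h1]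

theorem exec_sign {s : SignType} : Exec (.loop [pop .acc] gotSym (.block [.load fun v =>
      { v with
        sgn := if symDig (v.sym.getD mark) = 0 then v.sgn else symDig (v.sym.getD mark) }]))
    ⟨⟨g, 0, 0, 0, s, ok⟩, S⟩ (2 * (S .acc).length + 1)
    ⟨⟨none, 0, 0, 0, if val (S .acc) = 0 then s else SignType.sign (val (S .acc)), ok⟩,
      update S .acc []⟩ := by
  generalize hl : S .acc = l
  induction l generalizing S g s with
  | nil =>
    refine (exec_loop_nil hl).to_eq ?_ (by simp)
    rw [← hl, update_eq_self, hl]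
    simp [val, Ctl.read]
  | cons x l ih =>
    have h := ih (S := update S .acc l) (g := some x)
      (s := if symDig x = 0 then s else symDig x) (by simp)
    refine exec_loop_cons hl rfl (exec_block rfl) (h.to_eq ?_ le_rfl)
      (by simp only [List.length_cons]; omega)
    rw [update_idem, val, sign_digit_add]

theorem exec_signTest : Exec signTest ⟨ctl g ok, S⟩ (2 * (S .acc).length + 2)
    ⟨ctl none (ok && decide (val (S .acc) ≤ 0)), update S .acc []⟩ := by
  refine (exec_sign (s := 0)).seq (exec_block ?_) le_rfl
  simp only [runBlock_cons, runBlock_nil, Instr.run_load, ctl]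
  congr 3
  rcases lt_trichotomy (val (S .acc)) 0 with hk | hk | hk
  · simp [hk, hk.le, hk.ne]
  · simp [hk]
  · simp [hk, hk.ne', not_le.2 hk]

/-- The row `I` is satisfied at the paired state `b`. -/
def satisfies (I : List ℤ) (b : List (List SignType)) : Bool := decide (evalLevels I 0 b ≤ 0)

theorem steps_eval_block {I : List ℤ} {b : List (List SignType)} {w : List Sym} {B : ℕ}
    (hI : I ≠ []) (hlen : ∀ ds ∈ b, ds.length = I.length)
    (hr : S .r = showRow I) (hrb : S .rb = []) (hz : S .z = showBlock b ++ w)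
    (hout : S .out = []) (hacc : S .acc = [])
    (hB : (b.length + 1) * ((showRow I).length + 1) ≤ B) :
    Steps evalLoop ⟨ctl g ok, S⟩ ((showBlock b).length * (10 * B + 20))
      ⟨ctl none (ok && satisfies I b), update (update S .z w)
          .zb ((showBlock b).reverse ++ S .zb)⟩ := by
  obtain ⟨g₁, o, hv, ho, h1⟩ := steps_eval_levels (S := S) (g := g) (ok := ok) (w := ketSym :: w) hI
    hlen hr hrb (by simp [hz, showBlock]) hout (by simpa [hacc] using hB)
  set S₁ := update (update (update S .z (ketSym :: w)) .zb
    ((b.flatten.map digSym).reverse ++ S .zb)) .acc o with hS₁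
  have h2 : Steps evalLoop ⟨ctl g₁ ok, S₁⟩ (10 * B + 20)
      ⟨ctl none (ok && satisfies I b), update (update S .z w)
          .zb ((showBlock b).reverse ++ S .zb)⟩ := by
    refine (steps_loop (g := ketSym) (l := w) (by simp [hS₁]) rfl
      (exec_block_seq (s₁ := ⟨ctl (some ketSym) ok, update (update S₁ .z w) .zb
        ((showBlock b).reverse ++ S .zb)⟩) ?_
        (.ite_true ?_ exec_signTest le_rfl) le_rfl)).to_eq ?_ ?_
    · simp only [runBlock_cons, runBlock_nil, pushSym, Instr.run_push, ctl_read]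
      congr 1
      funext j; cases j <;> simp [hS₁, showBlock]
    · simp [symSat]
    · have : val ((update (update S₁ .z w) .zb ((showBlock b).reverse ++ S .zb)) .acc) =
          evalLevels I 0 b := by
        rw [show (0 : ℤ) = val (S .acc) by simp [hacc, val], ← hv]
        simp [hS₁]
      rw [this]
      congr 1
      funext j; cases j <;> simp [hS₁, hacc]
    · simp [hS₁]; omega
  refine h1.trans h2 ?_
  rw [showBlock, List.length_append, List.length_map, Nat.add_mul, List.length_singleton, one_mul]

theorem exec_eval {I : List ℤ} {bs : List (List (List SignType))} {B : ℕ}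
    (hI : I ≠ []) (hlen : ∀ b ∈ bs, ∀ ds ∈ b, ds.length = I.length)
    (hr : S .r = showRow I) (hrb : S .rb = []) (hz : S .z = bs.flatMap showBlock)
    (hout : S .out = []) (hacc : S .acc = [])
    (hB : ∀ b ∈ bs, (b.length + 1) * ((showRow I).length + 1) ≤ B) :
    Exec evalLoop ⟨ctl g ok, S⟩ ((bs.flatMap showBlock).length * (10 * B + 20) + 1)
      ⟨ctl none (ok && bs.all (satisfies I)), update (update S .z [])
          .zb ((bs.flatMap showBlock).reverse ++ S .zb)⟩ := by
  induction bs generalizing S g ok with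
  | nil =>
    refine (exec_loop_nil hz).to_eq ?_ (by simp)
    simp only [ctl_read, List.all_nil, Bool.and_true]
    congr 1
    funext j; cases j <;> simp [hz]
  | cons b bs ih =>
    have h1 := steps_eval_block (S := S) (g := g) (ok := ok) (I := I) (b := b)
      (w := bs.flatMap showBlock) hI (hlen b (by simp)) hr hrb (by simpa using hz) hout hacc
      (hB b (by simp))
    have h2 := ih (S := update (update S .z (bs.flatMap showBlock)) .zb
      ((showBlock b).reverse ++ S .zb)) (g := none) (ok := ok && satisfies I b)
      (fun b hb => hlen b (by simp [hb])) (by simp [hr]) (by simp [hrb]) (by simp)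
      (by simp [hout]) (by simp [hacc]) (fun b hb => hB b (by simp [hb]))
    refine (h1 _ _ h2).to_eq ?_ ?_
    · rw [List.all_cons, Bool.and_assoc]
      congr 1
      funext j; cases j <;> simp
    · simp only [List.flatMap_cons, List.length_append]
      rw [Nat.add_mul]; omega

/-- Evaluate all rows on `rows` at the paired states on `z`. -/
def evalRows : Cmd Reg Sym Ctl :=
  .loop [pop .rows] gotSym <| .seq (moveWhile notKet .rows .rb) <| .seq (move .rb .r) <|
    .seq evalLoop <| .seq (clear .r) (move .zb .z)

/-- A row between brackets. -/
def showBracketed (I : List ℤ) : List Sym := .inl .bra :: (showRow I ++ [ketSym])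

theorem notKet_of_mem_showRow {I : List ℤ} {g : Sym} (h : g ∈ showRow I) : notKet g = true := by
  simp only [showRow, List.mem_flatMap, showInt_eq, List.mem_cons, List.mem_append,
    List.mem_map, List.not_mem_nil, or_false] at h
  obtain ⟨z, -, rfl | ⟨b, -, rfl⟩ | rfl⟩ := h <;> simp

/-- Evaluation transfers the paired states from `z` to `zb`; moving them back readies them for the
next row. The failure of any row at any pair is remembered in `ok`. -/
theorem exec_evalRows {Is : List (List ℤ)} {bs : List (List (List SignType))} {B Z : ℕ}
    (hI : ∀ I ∈ Is, I ≠ []) (hlen : ∀ I ∈ Is, ∀ b ∈ bs, ∀ ds ∈ b, ds.length = I.length)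
    (hrows : S .rows = Is.flatMap showBracketed) (hr : S .r = []) (hrb : S .rb = [])
    (hz : S .z = bs.flatMap showBlock) (hzb : S .zb = [])
    (hout : S .out = []) (hacc : S .acc = [])
    (hB : ∀ I ∈ Is, ∀ b ∈ bs, (b.length + 1) * ((showRow I).length + 1) ≤ B)
    (hZ : (bs.flatMap showBlock).length ≤ Z) :
    Exec evalRows ⟨ctl g ok, S⟩
      ((Is.flatMap showBracketed).length * (Z * (10 * B + 22) + 12) + 1)
      ⟨ctl none (ok && Is.all fun I => bs.all (satisfies I)), update S .rows []⟩ := by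
  induction Is generalizing S g ok with
  | nil =>
    refine (exec_loop_nil hrows).to_eq ?_ (by simp)
    simp only [ctl_read, List.all_nil, Bool.and_true]
    congr 1
    funext j; cases j <;> simp [hrows]
  | cons I Is ih =>
    set rest := Is.flatMap showBracketed with hrest
    set R := showRow I with hR
    have hrows' : S .rows = .inl .bra :: (R ++ ketSym :: rest) := by
      simp [hrows, showBracketed, ← hrest, ← hR]
    have h1 : Exec (moveWhile notKet .rows .rb)
        ⟨(ctl g ok).read (some (.inl .bra)), update S .rows (R ++ ketSym :: rest)⟩
        (2 * R.length + 1) ⟨ctl (some ketSym) ok, update (update S .rows rest) .rb R.reverse⟩ := by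
      refine (exec_moveWhile (w := R) (rest := ketSym :: rest) (by simp) (by simp)
        (fun g hg => notKet_of_mem_showRow hg) (by simp)).to_eq ?_ le_rfl
      simp only [ctl_read, List.head?_cons, List.tail_cons]
      congr 1
      funext j; cases j <;> simp [hrb]
    have h2 : Exec (move .rb .r)
        ⟨ctl (some ketSym) ok, update (update S .rows rest) .rb R.reverse⟩
        (2 * R.length + 1) ⟨ctl none ok, update (update S .rows rest) .r R⟩ := by
      refine (exec_move (by simp)).to_eq ?_ (by simp)
      rw [ctl_read]
      congr 1
      funext j; cases j <;> simp [hr, hrb]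
    have h3 := exec_eval (S := update (update S .rows rest) .r R) (g := none) (ok := ok) (B := B)
      (hI I (by simp)) (hlen I (by simp)) (by simp [hR]) (by simp [hrb]) (by simp [hz])
      (by simp [hout]) (by simp [hacc]) (hB I (by simp))
    set ok₁ := ok && bs.all (satisfies I) with hok₁
    have h4 := exec_clear (k := .r) (v := ctl none ok₁) (S := update (update (update (update S .rows
      rest) .r R) .z []) .zb ((bs.flatMap showBlock).reverse ++ (update (update S .rows rest) .r R)
      .zb))
    have h5 : Exec (move .zb .z) ⟨ctl none ok₁, update (update (update (update (update S .rows
      rest) .r R) .z []) .zb ((bs.flatMap showBlock).reverse ++ (update (update S .rows rest) .r R)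
      .zb)) .r []⟩ (2 * Z + 1) ⟨ctl none ok₁, update S .rows rest⟩ := by
      refine (exec_move (by simp)).to_eq ?_ (by simpa [hzb] using hZ)
      rw [ctl_read]
      congr 1
      funext j; cases j <;> simp [hr, hz, hzb]
    have h6 := ih (S := update S .rows rest) (g := none) (ok := ok₁)
      (fun I hI' => hI I (by simp [hI'])) (fun I hI' => hlen I (by simp [hI']))
      (by simp [hrest]) (by simp [hr]) (by simp [hrb]) (by simp [hz]) (by simp [hzb])
      (by simp [hout]) (by simp [hacc]) (fun I hI' => hB I (by simp [hI']))
    refine exec_loop_cons hrows' rfl (h1.seq (h2.seq (h3.seq (h4.seq h5 le_rfl) le_rfl) le_rfl)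
      le_rfl) (h6.to_eq ?_ le_rfl) ?_
    · rw [List.all_cons, ← Bool.and_assoc, update_idem]
    · have e1 : ((I :: Is).flatMap showBracketed).length = R.length + 2 + rest.length := by
        simp only [List.flatMap_cons, showBracketed, List.length_append, List.length_cons,
          List.length_nil, ← hrest, ← hR]
      have e2 : (update (update (update (update S .rows rest) .r R) .z []) .zb
          ((bs.flatMap showBlock).reverse ++ (update (update S .rows rest) .r R) .zb) .r).length =
          R.length := by simp
      rw [e1, e2, Nat.add_mul]
      have e3 : (bs.flatMap showBlock).length * (10 * B + 20) ≤ Z * (10 * B + 20) :=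
        Nat.mul_le_mul_right _ hZ
      have e4 : Z * (10 * B + 22) = Z * (10 * B + 20) + 2 * Z := by ring
      -- Two of the R.length + 2 copies of Z * (10 * B + 22) already pay for the evaluation; the
      -- others are discarded.
      have e5 : (R.length + 2) * (Z * (10 * B + 22) + 12) =
        R.length * (Z * (10 * B + 22)) + 12 * R.length + 2 * (Z * (10 * B + 22)) + 24 := by ring
      rw [e5, e4]
      have e6 := Nat.zero_le (R.length * (Z * (10 * B + 20) + 2 * Z))
      omega

/-! ### The shape of the states read from the certificate -/

theorem length_nextDigit_iterate (n : ℕ) (s : List SignType × List Bool) :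
    (nextDigit^[n] s).1.length = n + s.1.length := by
  induction n generalizing s with
  | zero => simp
  | succ n ih => rw [iterate_succ_apply, ih]; simp [nextDigit]; omega

theorem nextLevel_iterate_shape (n L : ℕ) (s : List (List SignType) × List Bool) :
    ((nextLevel n)^[L] s).1.length = L + s.1.length ∧
      ∀ l ∈ ((nextLevel n)^[L] s).1, l ∈ s.1 ∨ l.length = n := by
  induction L generalizing s with
  | zero => exact ⟨by simp, fun l hl => Or.inl hl⟩
  | succ L ih =>
    rw [iterate_succ_apply]
    obtain ⟨h1, h2⟩ := ih (nextLevel n s)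
    refine ⟨by rw [h1]; simp [nextLevel]; omega, fun l hl => ?_⟩
    rcases h2 l hl with h | h
    · simp only [nextLevel, List.mem_cons] at h
      rcases h with rfl | h
      · right; simp [length_nextDigit_iterate]
      · exact Or.inl h
    · exact Or.inr h

/-- A state with `L` levels of `n` digits. -/
def IsState (n L : ℕ) (p : List (List SignType)) : Prop :=
  p.length = L ∧ ∀ l ∈ p, l.length = n

theorem nextState_iterate_shape (n L m : ℕ) (s : List (List (List SignType)) × List Bool) :
    ((nextState n L)^[m] s).1.length = m + s.1.length ∧
      ∀ p ∈ ((nextState n L)^[m] s).1, p ∈ s.1 ∨ IsState n L p := by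
  induction m generalizing s with
  | zero => exact ⟨by simp, fun l hl => Or.inl hl⟩
  | succ m ih =>
    rw [iterate_succ_apply]
    obtain ⟨h1, h2⟩ := ih (nextState n L s)
    refine ⟨by rw [h1]; simp [nextState]; omega, fun p hp => ?_⟩
    rcases h2 p hp with h | h
    · simp only [nextState, List.mem_cons] at h
      rcases h with rfl | h
      · right
        obtain ⟨h3, h4⟩ := nextLevel_iterate_shape n L ([], s.2)
        exact ⟨by simpa using h3, fun l hl => by simpa using h4 l hl⟩
      · exact Or.inl h
    · exact Or.inr h

theorem length_flatMap_of_forall {α β : Type} {f : α → List β} {l : List α} {k : ℕ}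
    (h : ∀ a ∈ l, (f a).length = k) : (l.flatMap f).length = l.length * k := by
  induction l with
  | nil => simp
  | cons a l ih =>
    rw [List.flatMap_cons, List.length_append, h a (by simp), ih fun a ha => h a (by simp [ha]),
      List.length_cons]
    ring

theorem length_showState {n L : ℕ} {p : List (List SignType)} (hp : IsState n L p) :
    (showState p).length = L * (n + 1) + 1 := by
  rw [showState, List.length_append, length_flatMap_of_forall (k := n + 1), hp.1]
  · rfl
  · intro l hl
    simp [showLevel, hp.2 l hl]

theorem mergeLevels_shape {n L : ℕ} {d : SignType} {p q : List (List SignType)}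
    (hp : IsState n L p) (hq : IsState n L q) : IsState (2 * n + 1) L (mergeLevels d p q) := by
  induction L generalizing d p q with
  | zero =>
    obtain rfl := List.eq_nil_of_length_eq_zero hp.1
    exact ⟨rfl, by simp [mergeLevels]⟩
  | succ L ih =>
    cases p with
    | nil => exact absurd hp.1 (by simp)
    | cons a p =>
      cases q with
      | nil => exact absurd hq.1 (by simp)
      | cons b q =>
        obtain ⟨h1, h2⟩ := ih (d := 1) (p := p) (q := q)
          ⟨by simpa using hp.1, fun l hl => hp.2 l (by simp [hl])⟩
          ⟨by simpa using hq.1, fun l hl => hq.2 l (by simp [hl])⟩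
        refine ⟨by simp [mergeLevels, h1], fun l hl => ?_⟩
        simp only [mergeLevels, List.mem_cons] at hl
        rcases hl with rfl | hl
        · simp [hp.2 a (by simp), hq.2 b (by simp)]; omega
        · exact h2 l hl

theorem length_showBlock {n L : ℕ} {b : List (List SignType)} (hb : IsState n L b) :
    (showBlock b).length = L * n + 1 := by
  have : b.flatten = b.flatMap id := by simp
  rw [showBlock, List.length_append, List.length_map, this, length_flatMap_of_forall (k := n), hb.1]
  · rfl
  · exact fun l hl => hb.2 l hl

/-- The number of states announced by a certificate, at most `M`. -/
def stateCount (M : ℕ) (c : List Bool) : ℕ := 1 + min (M - 1) (ones c)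

/-- The number of levels announced by a certificate. -/
def levelCount (c : List Bool) : ℕ := 1 + ones (afterOnes c)

/-- The states announced by a certificate. -/
def statesOf (n M : ℕ) (c : List Bool) : List (List (List SignType)) :=
  ((nextState n (levelCount c))^[stateCount M c] ([], afterOnes (afterOnes c))).1

/-- The pairs of consecutive states. -/
def pairsOf (P : List (List (List SignType))) : List (List (List SignType)) :=
  List.zipWith (mergeLevels (-1)) P (P.rotate 1)

theorem statesOf_length (n M : ℕ) (c : List Bool) :
    (statesOf n M c).length = stateCount M c := by
  simpa [statesOf] using
    (nextState_iterate_shape n (levelCount c) (stateCount M c) ([], afterOnes (afterOnes c))).1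

theorem isState_of_mem_statesOf {n M : ℕ} {c : List Bool} {p : List (List SignType)}
    (hp : p ∈ statesOf n M c) : IsState n (levelCount c) p := by
  simpa using (nextState_iterate_shape n (levelCount c) (stateCount M c)
    ([], afterOnes (afterOnes c))).2 p hp

theorem isState_of_mem_pairsOf {n L : ℕ} {P : List (List (List SignType))}
    (hP : ∀ p ∈ P, IsState n L p) {b : List (List SignType)} (hb : b ∈ pairsOf P) :
    IsState (2 * n + 1) L b := by
  rw [pairsOf, ← List.map_uncurry_zip_eq_zipWith] at hb
  obtain ⟨⟨p, q⟩, hpq, rfl⟩ := List.mem_map.1 hb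
  obtain ⟨h1, h2⟩ := List.of_mem_zip hpq
  exact mergeLevels_shape (hP p h1) (hP q (List.mem_rotate.1 h2))

theorem length_pairsOf (P : List (List (List SignType))) : (pairsOf P).length = P.length := by
  simp [pairsOf]

/-! ### The verifier -/

/-- The symbol belongs to the instance. -/
def isInst (g : Sym) : Bool := g.isLeft

/-- The verifier for instances with at least one row and a positive bound: on `a` are the reversed
digits of the number of variables, and `mu` is one less than the bound in unary. -/
def verifyRows : Cmd Reg Sym Ctl :=
  .seq (unary .a .nu .b) <| .seq (moveWhile isInst .inp .a) <|
    .seq (.ite gotSym (.block [pushSym .inp]) (.block [])) <| .seq (move .a .rows) <|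
    .seq (.block [pushConst .mm mark]) <| .seq readStateCount <|
    .seq (.block [pushConst .lu mark]) <| .seq readLevelCount <|
    .seq readStates <| .seq rotate <| .seq merge evalRows

/-- A time bound for `verifyRows`. -/
def rowsTime (β n m L ρ κ : ℕ) : ℕ :=
  β * (3 * n + 6) + 4 * ρ + 6 * κ + 30 + m * (L * (n * 5 + 7) + 7) +
    15 * (m * (L * (n + 1) + 1)) + 2 * (m * (L * (2 * n + 1) + 1)) +
    ρ * ((m * (L * (2 * n + 1) + 1)) * (10 * ((L + 1) * (ρ + 1)) + 22) + 12)

/-- The encoding has the least significant bit first, and moving it to another stack reverses it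
into the order that `unary` expects. -/
theorem ofBits_reverse (l : List Bool) : ofBits 0 l.reverse = bitsVal l := by
  induction l with
  | nil => rfl
  | cons b l ih =>
    rw [List.reverse_cons, ofBits, List.foldl_append]
    change 2 * ofBits 0 l.reverse + b.toNat = _
    rw [ih, bitsVal]; ring

theorem exec_verifyRows {n M : ℕ} {Is : List (List ℤ)} (hIs : ∀ I ∈ Is, I.length = 2 * n + 1)
    (c : List Bool) (g : Option Sym) : ∃ g' S',
    Exec verifyRows ⟨ctl g true, update (update (update (fun _ => []) .inp
        (Is.flatMap showBracketed ++ c.map certSym)) .mu (List.replicate (M - 1) mark)) .a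
        ((encodeNat n).reverse.map bitSym)⟩
      (rowsTime (encodeNat n).length n (stateCount M c) (levelCount c)
        (Is.flatMap showBracketed).length c.length)
      ⟨ctl g' (Is.all fun I => (pairsOf (statesOf n M c)).all (satisfies I)), S'⟩ := by
  set E : Reg → List Sym := fun _ => [] with hE
  set ρ := Is.flatMap showBracketed with hρ
  set μ := List.replicate (M - 1) mark with hμ
  set N := List.replicate n mark with hN
  have h1 : Exec (unary .a .nu .b) ⟨ctl g true, update (update (update E .inp
      (ρ ++ c.map certSym)) .mu μ) .a ((encodeNat n).reverse.map bitSym)⟩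
      ((encodeNat n).length * (3 * n + 6) + 1)
      ⟨ctl none true, update (update (update E .inp (ρ ++ c.map certSym)) .mu μ) .nu N⟩ := by
    have h := exec_unary (k := .a) (u := .nu) (a := .b) (v := ctl g true) (n := 0)
      (l := (encodeNat n).reverse) (S := update (update (update E .inp
      (ρ ++ c.map certSym)) .mu μ) .a ((encodeNat n).reverse.map bitSym)) (by simp) (by simp)
      (by simp) (by simp) (by simp [hE]) (by simp [hE])
    rw [ofBits_reverse, bitsVal_encodeNat, List.length_reverse, ctl_read] at h
    refine h.to_eq ?_ le_rfl
    congr 1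
    funext j; cases j <;> simp [hE, hN]
  have h2 : Exec (moveWhile isInst .inp .a)
      ⟨ctl none true, update (update (update E .inp (ρ ++ c.map certSym)) .mu μ) .nu N⟩
      (2 * ρ.length + 1) ⟨ctl (c.map certSym).head? true, update (update (update (update E .inp
        (c.map certSym).tail) .mu μ) .nu N) .a ρ.reverse⟩ := by
    refine (exec_moveWhile (w := ρ) (rest := c.map certSym) (by simp) (by simp) ?_ ?_).to_eq ?_
      le_rfl
    · intro g hg
      simp only [hρ, List.mem_flatMap, showBracketed, List.mem_cons, List.mem_append, showRow,
        showInt, List.mem_map, List.not_mem_nil, or_false] at hg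
      obtain ⟨I, -, rfl | ⟨z, -, s, -, rfl⟩ | rfl⟩ := hg <;> rfl
    · intro g hg
      cases c with
      | nil => simp at hg
      | cons b c =>
        simp only [List.map_cons, List.head?_cons, Option.mem_some_iff] at hg
        subst hg; rfl
    · rw [ctl_read]
      congr 1
      funext j; cases j <;> simp [hE]
  -- Finding the end of the instance consumed the first certificate bit, if there is one; it is
  -- returned to the input.
  have h3 : Exec (.ite gotSym (.block [pushSym .inp]) (.block []))
      ⟨ctl (c.map certSym).head? true, update (update (update (update E .inp
        (c.map certSym).tail) .mu μ) .nu N) .a ρ.reverse⟩ 2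
      ⟨ctl (c.map certSym).head? true, update (update (update (update E .inp
        (c.map certSym)) .mu μ) .nu N) .a ρ.reverse⟩ := by
    cases c with
    | nil => exact .ite_false rfl (exec_block rfl) le_rfl
    | cons b c =>
      refine .ite_true rfl (exec_block ?_) le_rfl
      simp only [runBlock_cons, runBlock_nil, pushSym, Instr.run_push]
      congr 1
      funext j; cases j <;> simp
  have h4 : Exec (move .a .rows)
      ⟨ctl (c.map certSym).head? true, update (update (update (update E .inp
        (c.map certSym)) .mu μ) .nu N) .a ρ.reverse⟩ (2 * ρ.length + 1)
      ⟨ctl none true, update (update (update (update E .inp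
        (c.map certSym)) .mu μ) .nu N) .rows ρ⟩ := by
    refine (exec_move (by simp)).to_eq ?_ (by simp)
    rw [ctl_read]
    congr 1
    funext j; cases j <;> simp [hE]
  set S₅ := update (update (update (update (update E .inp
        (c.map certSym)) .mu μ) .nu N) .rows ρ) .mm [mark] with hS₅
  -- One state is always present; together with the budget M - 1 this gives between 1 and M states.
  have h5 : Exec (.block [pushConst .mm mark])
      ⟨ctl none true, update (update (update (update E .inp
        (c.map certSym)) .mu μ) .nu N) .rows ρ⟩ 1 ⟨ctl none true, S₅⟩ :=
    exec_block (by simp [pushConst, hS₅, hE])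
  obtain ⟨g₆, h6⟩ := exec_readStateCount (S := S₅) (g := none) (ok := true) (c := c) (k := 1)
    (n := M - 1) (by simp [hS₅]) (by simp [hS₅]) (by simp [hS₅, hμ])
  set S₇ := update (update (update (update (update (update E .inp
        ((afterOnes c).map certSym)) .mu (List.replicate (M - 1 - ones c) mark)) .nu N) .rows ρ) .mm
        (List.replicate (stateCount M c) mark)) .lu [mark] with hS₇
  -- One level is always present; otherwise the right-hand sides would not enter the evaluation.
  have h7 : Exec (.block [pushConst .lu mark]) ⟨ctl g₆ true, update (update (update S₅ .inp
      ((afterOnes c).map certSym)) .mm (List.replicate (1 + min (M - 1) (ones c)) mark)) .mu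
      (List.replicate (M - 1 - ones c) mark)⟩ 1 ⟨ctl g₆ true, S₇⟩ := by
    refine exec_block ?_
    simp only [runBlock_cons, runBlock_nil, pushConst, Instr.run_push]
    congr 1
    funext j; cases j <;> simp [hS₅, hS₇, hE, stateCount]
  have hones : (afterOnes c).length ≤ c.length := by
    have h := (List.dropWhile_suffix (l := c) id).length_le
    simp only [afterOnes, List.length_tail]
    omega
  obtain ⟨g₈, h8⟩ := exec_readLevelCount (S := S₇) (g := g₆) (ok := true) (c := afterOnes c)
    (k := 1) (by simp [hS₇]) (by simp [hS₇])
  set S₈ := update (update S₇ .inp ((afterOnes (afterOnes c)).map certSym)) .lu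
        (List.replicate (1 + ones (afterOnes c)) mark) with hS₈
  have h9 := exec_readStates (S := S₈) (g := g₈) (ok := true) n (levelCount c) (stateCount M c)
    (afterOnes (afterOnes c)) (by simp [hS₈, hS₇, hN]) (by simp [hS₈, hS₇, hE])
    (by simp [hS₈, levelCount]) (by simp [hS₈, hS₇, hE]) (by simp [hS₈, hS₇])
    (by simp [hS₈, hS₇, hE]) (by simp [hS₈])
  have hP : ((nextState n (levelCount c))^[stateCount M c] ([], afterOnes (afterOnes c))).1 =
    statesOf n M c := rfl
  rw [hP] at h9
  set P := statesOf n M c with hPdef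
  have hshape : ∀ p ∈ P, IsState n (levelCount c) p := fun p hp => isState_of_mem_statesOf hp
  have hXlen : (P.flatMap showState).length =
      stateCount M c * (levelCount c * (n + 1) + 1) := by
    rw [length_flatMap_of_forall fun p hp => length_showState (hshape p hp), hPdef,
      statesOf_length]
  have hbshape : ∀ b ∈ pairsOf P, IsState (2 * n + 1) (levelCount c) b :=
    fun b hb => isState_of_mem_pairsOf hshape hb
  have hZlen : ((pairsOf P).flatMap showBlock).length =
      stateCount M c * (levelCount c * (2 * n + 1) + 1) := by
    rw [length_flatMap_of_forall fun b hb => length_showBlock (hbshape b hb), length_pairsOf,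
      hPdef, statesOf_length]
  set S₉ := update (update S₈ .inp (((nextState n (levelCount c))^[stateCount M c]
    ([], afterOnes (afterOnes c))).2.map certSym)) .x (P.flatMap showState) with hS₉
  have h9' := h9.to_eq (s'' := ⟨ctl none true, S₉⟩) (by
    congr 1
    funext j; cases j <;> simp [hS₉, hS₈, hS₇, hE]) le_rfl
  obtain ⟨u, P', hPu⟩ : ∃ u P', P = u :: P' := by
    cases hPc : P with
    | nil =>
      have := statesOf_length n M c
      rw [← hPdef, hPc, stateCount] at this
      simp at this
      omega
    | cons u P' => exact ⟨u, P', rfl⟩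
  have hrot : (P.rotate 1).flatMap showState = P'.flatMap showState ++ showState u := by
    rw [hPu]; simp
  have h10 := exec_rotate (S := S₉) (g := none) (ok := true) (u := u)
    (rest := P'.flatMap showState) (by simp [hS₉, hPu]) (by simp [hS₉, hS₈, hS₇, hE])
    (by simp [hS₉, hS₈, hS₇, hE]) (by simp [hS₉, hS₈, hS₇, hE]) (by simp [hS₉, hS₈, hS₇, hE])
  rw [← hrot] at h10
  have hrotlen : ((P.rotate 1).flatMap showState).length = (P.flatMap showState).length := by
    rw [hrot, hPu]; simp [Nat.add_comm]
  have hforall : List.Forall₂ (fun p q => p.length = q.length) P (P.rotate 1) := by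
    rw [List.forall₂_iff_zip]
    refine ⟨by simp, fun {p q} hpq => ?_⟩
    obtain ⟨h1, h2⟩ := List.of_mem_zip hpq
    rw [(hshape p h1).1, (hshape q (List.mem_rotate.1 h2)).1]
  have h11 := exec_merge (S := update S₉ .y ((P.rotate 1).flatMap showState)) (g := none)
    (ok := true) hforall (by simp [hS₉]) (by simp) (by simp [hS₉, hS₈, hS₇, hE])
    (by simp [hS₉, hS₈, hS₇, hE])
  rw [show List.zipWith (mergeLevels (-1)) P (P.rotate 1) = pairsOf P from rfl] at h11
  set S₁₁ := update (update (update (update S₉ .y ((P.rotate 1).flatMap showState)) .x []) .y [])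
    .z ((pairsOf P).flatMap showBlock) with hS₁₁
  have hR : ∀ I ∈ Is, (showRow I).length ≤ ρ.length := by
    intro I hI
    have h := (List.sublist_flatten_of_mem (List.mem_map_of_mem (f := showBracketed) hI)).length_le
    rw [← List.flatMap_def] at h
    rw [← hρ] at h
    simp only [showBracketed, List.length_cons, List.length_append] at h
    omega
  have h12 := exec_evalRows (S := S₁₁) (g := none) (ok := true) (Is := Is) (bs := pairsOf P)
    (B := (levelCount c + 1) * (ρ.length + 1)) (Z := ((pairsOf P).flatMap showBlock).length)
    (fun I hI h => by have := hIs I hI; simp [h] at this)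
    (fun I hI b hb ds hds => by rw [(hbshape b hb).2 ds hds, hIs I hI])
    (by simp [hS₁₁, hS₉, hS₈, hS₇, hρ]) (by simp [hS₁₁, hS₉, hS₈, hS₇, hE])
    (by simp [hS₁₁, hS₉, hS₈, hS₇, hE]) (by simp [hS₁₁])
    (by simp [hS₁₁, hS₉, hS₈, hS₇, hE]) (by simp [hS₁₁, hS₉, hS₈, hS₇, hE])
    (by simp [hS₁₁, hS₉, hS₈, hS₇, hE])
    (fun I hI b hb => by
      rw [(hbshape b hb).1]
      exact Nat.mul_le_mul_left _ (Nat.succ_le_succ (hR I hI)))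
    le_rfl
  refine ⟨none, update S₁₁ .rows [], (h1.seq (h2.seq (h3.seq (h4.seq (h5.seq (h6.seq (h7.seq (h8.seq (h9'.seq (h10.seq
    (h11.seq h12 le_rfl) le_rfl) le_rfl) le_rfl) le_rfl) le_rfl) le_rfl) le_rfl) le_rfl) le_rfl)
    le_rfl).to_eq ?_ ?_⟩
  · rw [Bool.true_and]
  · have e9 : S₉ .x = P.flatMap showState := by simp [hS₉]
    rw [e9, hrotlen, hXlen, hZlen, rowsTime]
    rw [← hρ]
    omega

/-- The verifier: read the bound, reject if it is zero; read the number of variables, and accept if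
there are no rows. -/
def verify : Cmd Reg Sym Ctl :=
  .seq (moveWhile notComma .inp .a) <| .seq (unary .a .mu .b) <| .seq (.block [pop .mu]) <|
    .ite gotSym
      (.seq (moveWhile notComma .inp .a) <| .seq (.block [pop .inp]) <|
        .ite (symSat fun g => g = .inl .bra) (.seq (.block [pushSym .inp]) verifyRows) (.block []))
      (.block [.load fun v => { v with ok := false }])

/-- The verdict on the bound `M`, the rows `Is` in `n` variables, and the certificate `c`. -/
def verdictRows (n M : ℕ) (Is : List (List ℤ)) (c : List Bool) : Bool :=
  decide (0 < M) && Is.all fun I => (pairsOf (statesOf n M c)).all (satisfies I)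

/-- The symbols of an instance with a certificate. -/
def inputWord (n M : ℕ) (Is : List (List ℤ)) (c : List Bool) : List Sym :=
  (encodeNat M).map bitSym ++ commaSym :: ((encodeNat n).map bitSym ++
    commaSym :: (Is.flatMap showBracketed ++ c.map certSym))

/-- A time bound for `verify`. -/
def verifyTime (n M : ℕ) (Is : List (List ℤ)) (c : List Bool) : ℕ :=
  (encodeNat M).length * (3 * M + 8) + 10 + if M = 0 then 0 else
    2 * (encodeNat n).length + if Is = [] then 0 else
      rowsTime (encodeNat n).length n (stateCount M c) (levelCount c)
        (Is.flatMap showBracketed).length c.length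

theorem exec_verify {n M : ℕ} {Is : List (List ℤ)} (hIs : ∀ I ∈ Is, I.length = 2 * n + 1)
    (c : List Bool) : ∃ s, s.var.ok = verdictRows n M Is c ∧
      Exec verify ⟨ctl none true, update (fun _ => []) .inp (inputWord n M Is c)⟩
        (verifyTime n M Is c) s := by
  set E : Reg → List Sym := fun _ => [] with hE
  set w := Is.flatMap showBracketed ++ c.map certSym with hw
  set w' := (encodeNat n).map bitSym ++ commaSym :: w with hw'
  have hread : ∀ (l : List Bool) (rest : List Sym) (g : Option Sym) (S : Reg → List Sym),
      S .inp = l.map bitSym ++ commaSym :: rest → S .a = [] →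
      Exec (moveWhile notComma .inp .a) ⟨ctl g true, S⟩ (2 * l.length + 1)
        ⟨ctl (some commaSym) true, update (update S .inp rest) .a (l.reverse.map bitSym)⟩ := by
    intro l rest g S hS ha
    refine (exec_moveWhile (w := l.map bitSym) (rest := commaSym :: rest) (by simp) hS ?_
      (by simp)).to_eq ?_ (by simp)
    · intro g hg
      obtain ⟨b, -, rfl⟩ := List.mem_map.1 hg
      simp
    · simp [ha]
  have h1 := hread (encodeNat M) w' none (update E .inp (inputWord n M Is c))
    (by simp [inputWord, hw', hw]) (by simp [hE])
  have h2 := exec_unary (k := .a) (u := .mu) (a := .b) (v := ctl (some commaSym) true) (n := 0)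
    (l := (encodeNat M).reverse) (S := update (update (update E .inp (inputWord n M Is c)) .inp w')
      .a ((encodeNat M).reverse.map bitSym)) (by simp) (by simp) (by simp) (by simp)
      (by simp [hE]) (by simp [hE])
  rw [ofBits_reverse, bitsVal_encodeNat, List.length_reverse, ctl_read] at h2
  have h3 : Exec (.block [pop .mu]) ⟨ctl none true, update (update (update (update (update E .inp
      (inputWord n M Is c)) .inp w') .a ((encodeNat M).reverse.map bitSym)) .a []) .mu
      (List.replicate M mark)⟩ 1 ⟨ctl (List.replicate M mark).head? true,
        update (update E .inp w') .mu (List.replicate (M - 1) mark)⟩ := by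
    refine exec_block ?_
    simp only [runBlock_cons, runBlock_nil, pop, Instr.run_pop, ctl_read]
    simp only [update_idem, update_self, List.tail_replicate]
    congr 1
    funext j; cases j <;> simp [hE]
  have hstart : ∀ {s : Store Reg Sym Ctl} {t T : ℕ},
      Exec (.ite gotSym
      (.seq (moveWhile notComma .inp .a) <| .seq (.block [pop .inp]) <|
        .ite (symSat fun g => g = .inl .bra) (.seq (.block [pushSym .inp]) verifyRows) (.block []))
      (.block [.load fun v => { v with ok := false }])) ⟨ctl (List.replicate M mark).head? true,
        update (update E .inp w') .mu (List.replicate (M - 1) mark)⟩ t s →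
      (encodeNat M).length * (3 * M + 8) + 3 + t ≤ T →
      Exec verify ⟨ctl none true, update E .inp (inputWord n M Is c)⟩ T s := by
    intro s t T h ht
    refine h1.seq (h2.seq (h3.seq h le_rfl) le_rfl) (le_trans ?_ ht)
    have : (encodeNat M).length * (3 * M + 8) =
        (encodeNat M).length * (3 * M + 6) + 2 * (encodeNat M).length := by ring
    omega
  -- For M = 0 the size measure is 0 and only constant time is available, so neither n nor the rows
  -- are read.
  rcases Nat.eq_zero_or_pos M with hM | hM
  · refine ⟨_, ?_, hstart (.ite_false ?_ (.block le_rfl) le_rfl) ?_⟩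
    · simp [verdictRows, hM]
    · simp [hM, symSat]
    · simp [verifyTime, hM]
  have hhead : (List.replicate M mark).head? = some mark := by
    obtain ⟨k, rfl⟩ : ∃ k, M = k + 1 := ⟨M - 1, by omega⟩
    rfl
  rw [hhead] at hstart
  have h4 := hread (encodeNat n) w (some mark) (update (update E .inp w') .mu
    (List.replicate (M - 1) mark)) (by simp [hw']) (by simp [hE])
  have h5 : Exec (.block [pop .inp]) ⟨ctl (some commaSym) true, update (update (update (update E .inp
      w') .mu (List.replicate (M - 1) mark)) .inp w) .a ((encodeNat n).reverse.map bitSym)⟩ 1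
      ⟨ctl w.head? true, update (update (update E .inp w.tail) .mu
        (List.replicate (M - 1) mark)) .a ((encodeNat n).reverse.map bitSym)⟩ := by
    refine exec_block ?_
    simp only [runBlock_cons, runBlock_nil, pop, Instr.run_pop, ctl_read]
    congr 1
    funext j; cases j <;> simp
  -- Without rows the next symbol is a certificate bit or absent. The number of variables must not
  -- be converted to unary here, being possibly exponential in the size.
  rcases eq_or_ne Is [] with hI | hI
  · have hsat : symSat (fun g => g = .inl .bra) (ctl w.head? true) = false := by
      rw [hw, hI]
      cases c <;> simp [symSat]
    refine ⟨_, ?_, hstart (.ite_true (by simp [symSat]) (h4.seq (h5.seq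
      (.ite_false hsat (.block le_rfl) le_rfl) le_rfl) le_rfl) le_rfl) ?_⟩
    · simp [verdictRows, hM, hI]
    · rw [verifyTime, if_neg hM.ne', if_pos hI]
      omega
  · have hwh : w = .inl .bra :: w.tail := by
      obtain ⟨I, Is', rfl⟩ := List.exists_cons_of_ne_nil hI
      rfl
    have hsat : symSat (fun g => g = .inl .bra) (ctl w.head? true) = true := by
      rw [hwh]; simp [symSat]
    have h6 : Exec (.block [pushSym .inp]) ⟨ctl w.head? true, update (update (update E .inp w.tail)
        .mu (List.replicate (M - 1) mark)) .a ((encodeNat n).reverse.map bitSym)⟩ 1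
        ⟨ctl w.head? true, update (update (update E .inp w) .mu
          (List.replicate (M - 1) mark)) .a ((encodeNat n).reverse.map bitSym)⟩ := by
      refine exec_block ?_
      rw [hwh]
      simp only [runBlock_cons, runBlock_nil, pushSym, Instr.run_push]
      congr 1
      funext j; cases j <;> simp
    obtain ⟨g', S', h7⟩ := exec_verifyRows (M := M) hIs c w.head?
    refine ⟨_, ?_, hstart (.ite_true (by simp [symSat]) (h4.seq (h5.seq
      (.ite_true hsat (h6.seq h7 le_rfl) le_rfl) le_rfl) le_rfl) le_rfl) ?_⟩
    · simp [verdictRows, hM]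
    · rw [verifyTime, if_neg hM.ne', if_neg hI]
      omega

/-! ### The value of a state -/

/-- The vector of the digits of a level. -/
def levelVec (n : ℕ) (l : List SignType) : Fin n → ℤ := fun j => (l.getD j 0 : SignType)

/-- Append levels of digits to the entries of a vector. -/
def appendLevels (n : ℕ) (v : Fin n → ℤ) (p : List (List SignType)) : Fin n → ℤ :=
  p.foldl (fun v l => 2 * v + levelVec n l) v

theorem dot_append {ds ds' : List SignType} {I I' : List ℤ} (h : ds.length = I.length) :
    dot (ds ++ ds') (I ++ I') = dot ds I + dot ds' I' := by
  induction ds generalizing I with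
  | nil =>
    obtain rfl := List.eq_nil_of_length_eq_zero h.symm
    simp [dot]
  | cons d ds ih =>
    cases I with
    | nil => simp at h
    | cons z I =>
      simp only [List.cons_append, dot, ih (by simpa using h)]
      ring

theorem dot_ofFn {n : ℕ} {l : List SignType} (hl : l.length = n) (a : Fin n → ℤ) :
    dot l (List.ofFn a) = a ⬝ᵥ levelVec n l := by
  induction n generalizing l with
  | zero =>
    obtain rfl := List.eq_nil_of_length_eq_zero hl
    simp [dot]
  | succ n ih =>
    cases l with
    | nil => simp at hl
    | cons d l =>
      rw [List.ofFn_succ, dot, ih (by simpa using hl), dotProduct, dotProduct, Fin.sum_univ_succ]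
      simp [levelVec, mul_comm]

/-- The entries of a row. -/
def rowInts {n : ℕ} (a a' : Fin n → ℤ) (b : ℤ) : List ℤ := List.ofFn a ++ List.ofFn a' ++ [b]

theorem dot_rowInts {n : ℕ} {p q : List SignType} {d : SignType} (hp : p.length = n)
    (hq : q.length = n) (a a' : Fin n → ℤ) (b : ℤ) :
    dot (p ++ q ++ [d]) (rowInts a a' b) = a ⬝ᵥ levelVec n p + a' ⬝ᵥ levelVec n q + d * b := by
  rw [rowInts, dot_append (by simp [hp, hq]), dot_append (by simp [hp]), dot_ofFn hp, dot_ofFn hq]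
  simp [dot]

/-- Horner's invariant. The extra digit 1 turns the contribution -b into 2 * (-b) + b = -b, so both
state vectors advance by a level while b stays fixed. -/
theorem evalLevels_mergeLevels {n L : ℕ} {p q : List (List SignType)} (hp : IsState n L p)
    (hq : IsState n L q) (a a' : Fin n → ℤ) (b : ℤ) (u w : Fin n → ℤ) :
    evalLevels (rowInts a a' b) (2 * (a ⬝ᵥ u + a' ⬝ᵥ w - b)) (mergeLevels 1 p q) =
      2 * (a ⬝ᵥ appendLevels n u p + a' ⬝ᵥ appendLevels n w q - b) := by
  induction L generalizing p q u w with
  | zero =>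
    obtain rfl := List.eq_nil_of_length_eq_zero hp.1
    obtain rfl := List.eq_nil_of_length_eq_zero hq.1
    rfl
  | succ L ih =>
    obtain ⟨l, p, rfl⟩ := List.exists_cons_of_length_eq_add_one hp.1
    obtain ⟨l', q, rfl⟩ := List.exists_cons_of_length_eq_add_one hq.1
    have h := ih (p := p) (q := q) ⟨by simpa using hp.1, fun l hl => hp.2 l (by simp [hl])⟩
      ⟨by simpa using hq.1, fun l hl => hq.2 l (by simp [hl])⟩ (2 * u + levelVec n l)
      (2 * w + levelVec n l')
    simp only [mergeLevels, evalLevels, List.foldl_cons, appendLevels] at h ⊢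
    rw [← h, dot_rowInts (hp.2 l (by simp)) (hq.2 l' (by simp))]
    congr 1
    have h2 : ∀ v : Fin n → ℤ, 2 * v = (2 : ℤ) • v := fun v => by ext; simp
    simp only [h2, dotProduct_add, dotProduct_smul, smul_eq_mul, SignType.coe_one]
    ring

/-- The first level, with extra digit -1, establishes the invariant of `evalLevels_mergeLevels`,
which is why at least one level is required. The leftover factor 2 does not affect the sign. -/
theorem satisfies_mergeLevels {n L : ℕ} {p q : List (List SignType)} (hp : IsState n (L + 1) p)
    (hq : IsState n (L + 1) q) (a a' : Fin n → ℤ) (b : ℤ) :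
    satisfies (rowInts a a' b) (mergeLevels (-1) p q) = true ↔
      a ⬝ᵥ appendLevels n 0 p + a' ⬝ᵥ appendLevels n 0 q ≤ b := by
  obtain ⟨l, p, rfl⟩ := List.exists_cons_of_length_eq_add_one hp.1
  obtain ⟨l', q, rfl⟩ := List.exists_cons_of_length_eq_add_one hq.1
  have h := evalLevels_mergeLevels (p := p) (q := q)
    ⟨by simpa using hp.1, fun l hl => hp.2 l (by simp [hl])⟩
    ⟨by simpa using hq.1, fun l hl => hq.2 l (by simp [hl])⟩ a a' b (levelVec n l) (levelVec n l')
  have h' : evalLevels (rowInts a a' b) 0 (mergeLevels (-1) (l :: p) (l' :: q)) =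
      2 * (a ⬝ᵥ appendLevels n 0 (l :: p) + a' ⬝ᵥ appendLevels n 0 (l' :: q) - b) := by
    simp only [mergeLevels, evalLevels, List.foldl_cons, appendLevels] at h ⊢
    simp only [mul_zero, zero_add]
    rw [← h, dot_rowInts (hp.2 l (by simp)) (hq.2 l' (by simp))]
    congr 1
    simp
    ring
  rw [satisfies, h', decide_eq_true_iff]
  omega

/-- Split off the least significant digit, with the sign of the entry, and append it as the last
level; the truncated halves satisfy the bound for one level fewer. -/
theorem exists_isState {n : ℕ} (L : ℕ) {x : Fin n → ℤ} (hx : ∀ j, |x j| < 2 ^ L) :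
    ∃ p, IsState n L p ∧ appendLevels n 0 p = x := by
  induction L generalizing x with
  | zero =>
    refine ⟨[], ⟨rfl, by simp⟩, ?_⟩
    funext j
    have := hx j
    simp only [pow_zero, Int.abs_lt_one_iff] at this
    simp [appendLevels, this]
  | succ L ih =>
    have half : ∀ j, ∃ (y : ℤ) (d : SignType), x j = 2 * y + d ∧ |y| < 2 ^ L := by
      intro j
      have hj := hx j
      rw [pow_succ, abs_lt] at hj
      simp only [abs_lt]
      generalize (2 : ℤ) ^ L = B at *
      rcases le_or_gt 0 (x j) with h | h
      · rcases Int.emod_two_eq_zero_or_one (x j) with h2 | h2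
        · exact ⟨x j / 2, 0, by simp; omega, by omega, by omega⟩
        · exact ⟨x j / 2, 1, by simp; omega, by omega, by omega⟩
      · rcases Int.emod_two_eq_zero_or_one (x j) with h2 | h2
        · exact ⟨x j / 2, 0, by simp; omega, by omega, by omega⟩
        -- Integer division rounds down, so for negative odd entries the quotient is corrected
        -- upwards.
        · exact ⟨x j / 2 + 1, -1, by simp; omega, by omega, by omega⟩
    choose y d hxy hy using half
    obtain ⟨p, hp, hpx⟩ := ih hy
    refine ⟨p ++ [List.ofFn d], ⟨by simp [hp.1], fun l hl => ?_⟩, ?_⟩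
    · rcases List.mem_append.1 hl with hl | hl
      · exact hp.2 l hl
      · rw [List.mem_singleton.1 hl]; simp
    · rw [appendLevels, List.foldl_append]
      change 2 * appendLevels n 0 p + _ = _
      rw [hpx]
      funext j
      simp [levelVec, hxy j]

/-! ### Certificates of given states -/

/-- The two bits of a digit. -/
def digitBits : SignType → List Bool
  | 0 => [false, false]
  | 1 => [true, false]
  | -1 => [true, true]

/-- The bits of a level. -/
def levelBits (l : List SignType) : List Bool := l.reverse.flatMap digitBits

/-- The bits of a state. -/
def stateBits (p : List (List SignType)) : List Bool := p.reverse.flatMap levelBits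

/-- Unique decoding passes from items to lists. Decoders put the newest item first, so encodings
list the items in reverse order. -/
theorem iterate_decode {α : Type} {f : List α × List Bool → List α × List Bool}
    {e : α → List Bool} (l : List α)
    (h : ∀ a ∈ l, ∀ acc rest, f (acc, e a ++ rest) = (a :: acc, rest)) (acc : List α)
    (rest : List Bool) : f^[l.length] (acc, l.reverse.flatMap e ++ rest) = (l ++ acc, rest) := by
  induction l using List.reverseRecOn generalizing acc with
  | nil => rfl
  | append_singleton l a ih =>
    rw [List.length_append, List.length_singleton, iterate_succ_apply, List.reverse_append]
    simp only [List.reverse_singleton, List.singleton_append, List.flatMap_cons, List.append_assoc]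
    rw [h a (by simp), ih fun a ha => h a (by simp [ha])]

theorem nextDigit_digitBits (d : SignType) (acc : List SignType) (rest : List Bool) :
    nextDigit (acc, digitBits d ++ rest) = (d :: acc, rest) := by
  cases d <;> rfl

theorem nextLevel_levelBits (l : List SignType) (acc : List (List SignType)) (rest : List Bool) :
    nextLevel l.length (acc, levelBits l ++ rest) = (l :: acc, rest) := by
  simp only [nextLevel, levelBits]
  rw [iterate_decode l fun d _ => nextDigit_digitBits d]
  simp

theorem nextState_stateBits {n L : ℕ} {p : List (List SignType)} (hp : IsState n L p)
    (acc : List (List (List SignType))) (rest : List Bool) :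
    nextState n L (acc, stateBits p ++ rest) = (p :: acc, rest) := by
  obtain ⟨rfl, h⟩ := hp
  simp only [nextState, stateBits]
  rw [iterate_decode p fun l hl acc rest => by rw [← h l hl, nextLevel_levelBits]]
  simp

/-- A certificate that announces the states `P` with `L + 1` levels. -/
def certificate (L : ℕ) (P : List (List (List SignType))) : List Bool :=
  List.replicate (P.length - 1) true ++ false :: (List.replicate L true ++
    false :: P.reverse.flatMap stateBits)

theorem ones_replicate (k : ℕ) (l : List Bool) :
    ones (List.replicate k true ++ false :: l) = k := by
  induction k with
  | zero => rfl
  | succ k ih => simp [ones]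

theorem afterOnes_replicate (k : ℕ) (l : List Bool) :
    afterOnes (List.replicate k true ++ false :: l) = l := by
  induction k with
  | zero => rfl
  | succ k ih => simp [afterOnes]

/-- Both counts in the certificate are one less than the numbers they announce, and a length of at
most `M` is not cut off. -/
theorem statesOf_certificate {n L M : ℕ} {P : List (List (List SignType))}
    (hP : ∀ p ∈ P, IsState n (L + 1) p) (h0 : 0 < P.length) (hM : P.length ≤ M) :
    statesOf n M (certificate L P) = P := by
  have h1 : stateCount M (certificate L P) = P.length := by
    rw [stateCount, certificate, ones_replicate]; omega
  have h2 : levelCount (certificate L P) = L + 1 := by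
    rw [levelCount, certificate, afterOnes_replicate, ones_replicate]; omega
  rw [statesOf, h1, h2, certificate, afterOnes_replicate, afterOnes_replicate]
  have h := iterate_decode P (fun p hp => nextState_stateBits (hP p hp)) [] []
  rw [List.append_nil] at h
  rw [h]
  simp

theorem length_certificate {n L : ℕ} {P : List (List (List SignType))}
    (hP : ∀ p ∈ P, IsState n (L + 1) p) (h0 : 0 < P.length) :
    (certificate L P).length = P.length + (L + 1) + P.length * ((L + 1) * (n * 2)) := by
  have h : (P.reverse.flatMap stateBits).length = P.length * ((L + 1) * (n * 2)) := by
    rw [length_flatMap_of_forall (k := (L + 1) * (n * 2)), List.length_reverse]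
    intro p hp
    obtain ⟨hp1, hp2⟩ := hP p (by simpa using hp)
    rw [stateBits, length_flatMap_of_forall (k := n * 2), List.length_reverse, hp1]
    intro l hl
    rw [levelBits, length_flatMap_of_forall (k := 2), List.length_reverse, hp2 l (by simpa using hl)]
    intro d _
    cases d <;> rfl
  simp only [certificate, List.length_append, List.length_cons, List.length_replicate, h]
  omega

/-! ### Small cycles -/

/-- Bounded solutions of cyclic systems of inequalities. -/
theorem exists_small_cycle {m n k : ℕ} (a a' : Fin k → Fin n → ℤ) (b : Fin k → ℤ)
    (σ : Fin m → Fin m) {H : ℕ} (hH : 1 ≤ H) (ha : ∀ r j, 2 * |a r j| ≤ H)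
    (ha' : ∀ r j, 2 * |a' r j| ≤ H) (hb : ∀ r, |b r| ≤ H)
    (hx : ∃ y : Fin m → Fin n → ℤ, ∀ i r, a r ⬝ᵥ y i + a' r ⬝ᵥ y (σ i) ≤ b r) :
    ∃ y : Fin m → Fin n → ℤ, (∀ i r, a r ⬝ᵥ y i + a' r ⬝ᵥ y (σ i) ≤ b r) ∧ ∀ i j, |y i j| ≤
      ((m * n).factorial * (H + m * n * (H * (m * n * H) ^ (m * n))) ^ (m * n) : ℕ) := by
  let e : Fin m × Fin n ≃ Fin (m * n) := finProdFinEquiv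
  -- If σ fixes an index, as for a cycle of length 1, both coefficients fall on the same unknown.
  -- The hypotheses therefore bound twice their absolute values.
  let A : Fin m × Fin k → Fin (m * n) → ℤ := fun ir v =>
    (if (e.symm v).1 = ir.1 then a ir.2 (e.symm v).2 else 0) +
      if (e.symm v).1 = σ ir.1 then a' ir.2 (e.symm v).2 else 0
  have hdot : ∀ ir (x : Fin (m * n) → ℤ), A ir ⬝ᵥ x =
      a ir.2 ⬝ᵥ (fun j => x (e (ir.1, j))) + a' ir.2 ⬝ᵥ fun j => x (e (σ ir.1, j)) := by
    intro ir x
    simp only [dotProduct, A]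
    rw [← Equiv.sum_comp e, Fintype.sum_prod_type]
    simp only [Equiv.symm_apply_apply, add_mul, Finset.sum_add_distrib, ite_mul, zero_mul]
    congr 1 <;> rw [Finset.sum_comm] <;> simp
  obtain ⟨y, hy⟩ := hx
  obtain ⟨x, hx1, hx2⟩ := SmallSolution.exists_small (A := A) (b := fun ir => b ir.2) hH
    (fun ir v => by
      have h1 := ha ir.2 (e.symm v).2
      have h2 := ha' ir.2 (e.symm v).2
      refine (abs_add_le _ _).trans ?_
      split_ifs <;> (try rw [abs_zero]) <;> omega) (fun ir => hb ir.2)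
    ⟨fun v => y (e.symm v).1 (e.symm v).2, fun ir => by
      rw [hdot]; simpa using hy ir.1 ir.2⟩
  exact ⟨fun i j => x (e (i, j)), fun i r => by rw [← hdot (i, r)]; exact hx1 (i, r),
    fun i j => hx2 _⟩

/-! ### Cycles and the verdict -/

/-- The successor of an index on a cycle. -/
def cyclicNext {m : ℕ} (i : Fin m) : Fin m := ⟨(i + 1) % m, Nat.mod_lt _ i.pos⟩

/-- The coefficients of the current values. -/
def curr (R : SLC) (r : Fin R.k) : Fin R.n → ℤ := fun j => R.A r (.inl j)

/-- The coefficients of the next values. -/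
def next (R : SLC) (r : Fin R.k) : Fin R.n → ℤ := fun j => R.A r (.inr j)

theorem transition_iff (R : SLC) (s s' : R.State) :
    R.Transition s s' ↔ ∀ r, curr R r ⬝ᵥ s + next R r ⬝ᵥ s' ≤ R.b r := by
  refine forall_congr' fun r => ?_
  rw [← Int.cast_le (R := ℝ)]
  simp [Matrix.mulVec, dotProduct, curr, next, Fintype.sum_sum_type]

/-- A closed trace is a function on indices modulo m; conversely such a function is extended
periodically. -/
theorem hasCycleOfLengthAtMost_iff (R : SLC) (M : ℕ) :
    R.HasCycleOfLengthAtMost M ↔ ∃ m, 0 < m ∧ m ≤ M ∧ ∃ y : Fin m → R.State,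
      ∀ i r, curr R r ⬝ᵥ y i + next R r ⬝ᵥ y (cyclicNext i) ≤ R.b r := by
  constructor
  · rintro ⟨m, hm, h0, s, hs, hs0⟩
    refine ⟨m, h0, hm, fun i => s i, fun i r => ?_⟩
    have h := (transition_iff R _ _).1 (hs i i.2) r
    have hi : s (i + 1) = s ((i + 1) % m) := by
      rcases Nat.lt_or_ge (i + 1) m with h | h
      · rw [Nat.mod_eq_of_lt h]
      · have : (i : ℕ) + 1 = m := by omega
        rw [this, hs0, Nat.mod_self]
    rwa [hi] at h
  · rintro ⟨m, h0, hm, y, hy⟩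
    refine ⟨m, hm, h0, fun i => y ⟨i % m, Nat.mod_lt _ h0⟩, fun i hi => ?_, by simp⟩
    rw [transition_iff]
    have h := hy ⟨i, hi⟩
    have h1 : (⟨i % m, Nat.mod_lt _ h0⟩ : Fin m) = ⟨i, hi⟩ := Fin.ext (Nat.mod_eq_of_lt hi)
    change ∀ r, curr R r ⬝ᵥ y ⟨i % m, Nat.mod_lt _ h0⟩ + _ ≤ _
    rw [h1]
    exact h

/-- The rows of the system. -/
def rows (R : SLC) : List (List ℤ) := List.ofFn fun r => rowInts (curr R r) (next R r) (R.b r)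

theorem forall_mem_pairsOf {P : List (List (List SignType))} {Q : List (List SignType) → Prop} :
    (∀ b ∈ pairsOf P, Q b) ↔
      ∀ i : Fin P.length, Q (mergeLevels (-1) (P.get i) (P.get (cyclicNext i))) := by
  have key : ∀ i : Fin P.length, (pairsOf P)[(i : ℕ)]'(by simp [pairsOf]) =
      mergeLevels (-1) (P.get i) (P.get (cyclicNext i)) := by
    intro i
    simp [pairsOf, List.getElem_rotate, cyclicNext]
  constructor
  · intro h i
    rw [← key]
    exact h _ (List.getElem_mem _)
  · intro h b hb
    obtain ⟨i, hi, rfl⟩ := List.mem_iff_getElem.1 hb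
    exact (key ⟨i, by simpa [pairsOf] using hi⟩).symm ▸ h ⟨i, by simpa [pairsOf] using hi⟩

theorem verdictRows_iff {R : SLC} {M L : ℕ} {c : List Bool} {P : List (List (List SignType))}
    (hPc : statesOf R.n M c = P) (hP : ∀ p ∈ P, IsState R.n (L + 1) p) :
    verdictRows R.n M (rows R) c = true ↔ 0 < M ∧
      ∀ (i : Fin P.length) r, curr R r ⬝ᵥ appendLevels R.n 0 (P.get i) +
          next R r ⬝ᵥ appendLevels R.n 0 (P.get (cyclicNext i)) ≤ R.b r := by
  rw [verdictRows, Bool.and_eq_true, decide_eq_true_iff, List.all_eq_true, hPc]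
  refine and_congr_right fun _ => ?_
  simp only [rows, List.forall_mem_ofFn_iff, List.all_eq_true]
  rw [forall_comm (α := Fin P.length)]
  refine forall_congr' fun r => ?_
  rw [forall_mem_pairsOf]
  exact forall_congr' fun i => satisfies_mergeLevels (hP _ (P.get_mem i)) (hP _ (P.get_mem _)) _ _ _

/-- Soundness needs no bound on the certificate: whatever it contains, it decodes to a positive
number of states, at most `M`. -/
theorem hasCycle_of_verdictRows {R : SLC} {M : ℕ} {c : List Bool}
    (h : verdictRows R.n M (rows R) c = true) : R.HasCycleOfLengthAtMost M := by
  have hP : ∀ p ∈ statesOf R.n M c, IsState R.n (ones (afterOnes c) + 1) p := fun p hp => by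
    rw [Nat.add_comm]; exact isState_of_mem_statesOf hp
  obtain ⟨hM, h⟩ := (verdictRows_iff rfl hP).1 h
  have hlen := statesOf_length R.n M c
  rw [stateCount] at hlen
  exact (hasCycleOfLengthAtMost_iff R M).2 ⟨_, by omega, by omega, _, h⟩

/-- A number of levels that suffices for the small solutions of a system in at most `s` unknowns
with coefficients of at most `s` bits. -/
def levelBound (s : ℕ) : ℕ := s * s + s * (s + s + (s + s) * s + s + 1)

/-- Every factor is bounded by a power of 2 whose exponent is polynomial in s: s * s for the
factorial, and the s-fold second part of `levelBound` for the power. -/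
theorem solution_bound_lt {s N : ℕ} (hN : N ≤ s) :
    N.factorial * (2 ^ s + N * (2 ^ s * (N * 2 ^ s) ^ N)) ^ N < 2 ^ (levelBound s + 1) := by
  have hN2 : N ≤ 2 ^ s := hN.trans s.lt_two_pow_self.le
  have h1 : N.factorial ≤ 2 ^ (s * s) := by
    calc N.factorial ≤ N ^ N := Nat.factorial_le_pow N
      _ ≤ (2 ^ s) ^ N := Nat.pow_le_pow_left hN2 _
      _ ≤ (2 ^ s) ^ s := Nat.pow_le_pow_right (by positivity) hN
      _ = _ := by rw [← pow_mul]
  have h2 : (N * 2 ^ s) ^ N ≤ 2 ^ ((s + s) * s) := by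
    calc (N * 2 ^ s) ^ N ≤ (2 ^ s * 2 ^ s) ^ N := by gcongr
      _ ≤ (2 ^ s * 2 ^ s) ^ s := Nat.pow_le_pow_right (by positivity) hN
      _ = _ := by rw [← pow_add, ← pow_mul]
  have h3 : N * (2 ^ s * (N * 2 ^ s) ^ N) ≤ 2 ^ (s + s + (s + s) * s) := by
    calc N * (2 ^ s * (N * 2 ^ s) ^ N) ≤ 2 ^ s * (2 ^ s * 2 ^ ((s + s) * s)) := by gcongr
      _ = _ := by rw [← pow_add, ← pow_add]; ring_nf
  have h4 : 2 ^ s + N * (2 ^ s * (N * 2 ^ s) ^ N) ≤ 2 ^ (s + s + (s + s) * s + s + 1) := by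
    have h5 : 2 ^ s ≤ 2 ^ (s + s + (s + s) * s + s) :=
      Nat.pow_le_pow_right (by positivity) (by omega)
    have h6 : 2 ^ (s + s + (s + s) * s) ≤ 2 ^ (s + s + (s + s) * s + s) :=
      Nat.pow_le_pow_right (by positivity) (by omega)
    rw [pow_succ _ (s + s + (s + s) * s + s)]
    omega
  calc N.factorial * (2 ^ s + N * (2 ^ s * (N * 2 ^ s) ^ N)) ^ N
      ≤ 2 ^ (s * s) * (2 ^ (s + s + (s + s) * s + s + 1)) ^ s := by
        gcongr ?_ * ?_
        exact (Nat.pow_le_pow_left h4 _).trans (Nat.pow_le_pow_right (by positivity) hN)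
    _ = 2 ^ levelBound s := by rw [← pow_mul, ← pow_add, levelBound]; ring_nf
    _ < _ := Nat.pow_lt_pow_right (by omega) (by omega)

theorem exists_certificate {R : SLC} {M s : ℕ} (hM : M ≤ s) (hs : M * R.n ≤ s)
    (hc : ∀ r j, 2 * |curr R r j| ≤ 2 ^ s) (hn : ∀ r j, 2 * |next R r j| ≤ 2 ^ s)
    (hb : ∀ r, |R.b r| ≤ 2 ^ s) (h : R.HasCycleOfLengthAtMost M) :
    ∃ c : List Bool, c.length ≤ s + (levelBound s + 1) + s * ((levelBound s + 1) * 2) ∧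
      verdictRows R.n M (rows R) c = true := by
  obtain ⟨m, h0, hm, y, hy⟩ := (hasCycleOfLengthAtMost_iff R M).1 h
  have hmn : m * R.n ≤ s := (Nat.mul_le_mul_right _ hm).trans hs
  obtain ⟨y, hy, hy'⟩ := exists_small_cycle (curr R) (next R) R.b cyclicNext (H := 2 ^ s)
    Nat.one_le_two_pow (by exact_mod_cast hc) (by exact_mod_cast hn) (by exact_mod_cast hb) ⟨y, hy⟩
  have hlt : ∀ i j, |y i j| < 2 ^ (levelBound s + 1) := fun i j =>
    (hy' i j).trans_lt (by exact_mod_cast solution_bound_lt hmn)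
  choose p hp hpy using fun i => exists_isState (levelBound s + 1) (hlt i)
  have hP : ∀ q ∈ List.ofFn p, IsState R.n (levelBound s + 1) q := by
    rw [List.forall_mem_ofFn_iff]; exact hp
  have hst := statesOf_certificate (M := M) hP (by simpa using h0) (by simpa using hm)
  refine ⟨certificate (levelBound s) (List.ofFn p), ?_, ?_⟩
  · rw [length_certificate hP (by simpa using h0), List.length_ofFn]
    -- The product m * n must stay together: it is at most s, whereas bounding its factors
    -- separately would give s * s.
    have : m * ((levelBound s + 1) * (R.n * 2)) = m * R.n * ((levelBound s + 1) * 2) := by ring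
    rw [this]
    gcongr
    omega
  · refine (verdictRows_iff hst hP).2 ⟨by omega, fun i r => ?_⟩
    have h := hy (i.cast (by simp)) r
    rw [← hpy, ← hpy (cyclicNext _)] at h
    have h1 : (List.ofFn p).get i = p (i.cast (by simp)) := by
      rw [List.get_ofFn]
    have h2 : (List.ofFn p).get (cyclicNext i) = p (cyclicNext (i.cast (by simp))) := by
      rw [List.get_ofFn]
      congr 1
      ext
      simp [cyclicNext]
    rwa [h1, h2]

/-! ### The encoding -/

theorem map_encodeRow (R : SLC) (r : Fin R.k) :
    (R.encodeRow r).map Sum.inl = showBracketed (rowInts (curr R r) (next R r) (R.b r)) := by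
  have h : ∀ I : List ℤ, showRow I = ((I.map SLC.encodeIntComma).flatten).map Sum.inl := by
    intro I
    rw [showRow, List.map_flatten, List.map_map, ← List.flatMap_def]
    rfl
  simp [showBracketed, h, rowInts, SLC.encodeRow, List.map_ofFn, curr, next, Function.comp_def]

theorem map_encodeWithBound (R : SLC) (M : ℕ) (c : List Bool) :
    (SLC.encodeWithBound (R, M)).map Sum.inl ++ c.map Sum.inr = inputWord R.n M (rows R) c := by
  have h : ((List.ofFn R.encodeRow).flatten.map Sum.inl : List Sym) =
      (rows R).flatMap showBracketed := by
    rw [List.map_flatten, List.map_ofFn, List.flatMap_def, rows, List.map_ofFn]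
    congr 2
    funext r
    exact map_encodeRow R r
  simp [SLC.encodeWithBound, SLC.encode, SLC.encodeNatComma, inputWord, h, Function.comp_def]

theorem length_rows_le (R : SLC) :
    (encodeNat R.n).length + 1 + ((rows R).flatMap showBracketed).length = R.size := by
  have h := congrArg List.length (map_encodeWithBound R 0 [])
  simp only [SLC.encodeWithBound, inputWord, SLC.encodeNatComma, List.length_append,
    List.length_map, List.length_cons, List.length_nil] at h
  simp only [SLC.size]
  omega

theorem length_showRow_le {R : SLC} {I : List ℤ} (hI : I ∈ rows R) :
    (showRow I).length + 2 ≤ R.size := by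
  have h := (List.sublist_flatten_of_mem (List.mem_map_of_mem (f := showBracketed) hI)).length_le
  rw [← List.flatMap_def] at h
  simp only [showBracketed, List.length_cons, List.length_append, List.length_nil] at h
  have := length_rows_le R
  omega

theorem length_le_length_showRow (I : List ℤ) : I.length ≤ (showRow I).length := by
  induction I with
  | nil => simp
  | cons z I ih => rw [showRow_cons, showInt_eq]; simp; omega

theorem bitsVal_lt (l : List Bool) : bitsVal l < 2 ^ l.length := by
  induction l with
  | nil => simp [bitsVal]
  | cons b l ih =>
    rw [bitsVal, List.length_cons, pow_succ]
    have := b.toNat_le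
    omega

/-- The sign bit and the comma are symbols beyond the binary digits, so the size leaves room for the
factor 2 needed when two coefficients coincide. -/
theorem two_mul_abs_le {R : SLC} {I : List ℤ} (hI : I ∈ rows R) {z : ℤ} (hz : z ∈ I) :
    2 * |z| ≤ 2 ^ R.size := by
  have h1 := length_showRow_le hI
  have h2 := (List.sublist_flatten_of_mem (List.mem_map_of_mem (f := showInt) hz)).length_le
  rw [← List.flatMap_def] at h2
  change _ ≤ (showRow I).length at h2
  rw [showInt_eq] at h2
  simp only [List.length_cons, List.length_append, List.length_map, List.length_nil] at h2
  have h3 := bitsVal_lt (encodeNat z.natAbs)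
  rw [bitsVal_encodeNat] at h3
  have h4 : 2 * z.natAbs ≤ 2 ^ R.size := by
    calc 2 * z.natAbs ≤ 2 * 2 ^ (encodeNat z.natAbs).length := by omega
      _ = 2 ^ ((encodeNat z.natAbs).length + 1) := by rw [pow_succ, mul_comm]
      _ ≤ _ := Nat.pow_le_pow_right (by omega) (by omega)
  rw [Int.abs_eq_natAbs]
  exact_mod_cast h4

theorem length_encodePosNum_le (n : PosNum) : (encodePosNum n).length ≤ n := by
  induction n with
  | one => simp [encodePosNum]
  | bit0 n ih =>
    have := n.cast_pos (α := ℕ)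
    simp [encodePosNum]; omega
  | bit1 n ih =>
    simp [encodePosNum]; omega

theorem length_encodeNat_le (n : ℕ) : (encodeNat n).length ≤ n := by
  rw [encodeNat]
  have h : ((n : Num) : ℕ) = n := Num.to_of_nat n
  cases hn : (n : Num) with
  | zero => simp [encodeNum]
  | pos p =>
    rw [hn] at h
    simpa [encodeNum, ← h] using length_encodePosNum_le p

/-! ### Polynomial bounds -/

/-- The function is a polynomial with natural coefficients. -/
def IsPoly (f : ℕ → ℕ) : Prop := ∃ q : Polynomial ℕ, ∀ s, q.eval s = f s

theorem isPoly_id : IsPoly fun s => s := ⟨.X, by simp⟩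

theorem isPoly_const (a : ℕ) : IsPoly fun _ => a := ⟨.C a, by simp⟩

theorem IsPoly.add {f g : ℕ → ℕ} (hf : IsPoly f) (hg : IsPoly g) : IsPoly fun s => f s + g s := by
  obtain ⟨p, hp⟩ := hf
  obtain ⟨q, hq⟩ := hg
  exact ⟨p + q, by simp [hp, hq]⟩

theorem IsPoly.mul {f g : ℕ → ℕ} (hf : IsPoly f) (hg : IsPoly g) : IsPoly fun s => f s * g s := by
  obtain ⟨p, hp⟩ := hf
  obtain ⟨q, hq⟩ := hg
  exact ⟨p * q, by simp [hp, hq]⟩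

theorem isPoly_const_mul (a : ℕ) : IsPoly (HMul.hMul a) := (isPoly_const a).mul isPoly_id

/-- The permitted length of certificates. -/
def certBound (s : ℕ) : ℕ := s + (levelBound s + 1) + s * ((levelBound s + 1) * 2)

theorem isPoly_certBound : IsPoly certBound := by
  unfold certBound levelBound
  with_reducible repeat' first | exact isPoly_id | exact isPoly_const _ | apply IsPoly.add | apply IsPoly.mul

/-- The permitted running time. -/
def timeBound (s : ℕ) : ℕ :=
  s * (3 * s + 8) + 11 + (2 * s + rowsTime s s s (1 + certBound s) s (certBound s))

theorem isPoly_timeBound : IsPoly timeBound := by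
  unfold timeBound rowsTime
  with_reducible
    repeat' first
      | exact isPoly_id | exact isPoly_const _ | exact isPoly_const_mul _ | exact isPoly_certBound
      | apply IsPoly.add | apply IsPoly.mul

theorem rowsTime_mono {β β' n n' m m' L L' ρ ρ' κ κ' : ℕ} (hβ : β ≤ β') (hn : n ≤ n')
    (hm : m ≤ m') (hL : L ≤ L') (hρ : ρ ≤ ρ') (hκ : κ ≤ κ') :
    rowsTime β n m L ρ κ ≤ rowsTime β' n' m' L' ρ' κ' := by
  unfold rowsTime
  gcongr

theorem levelCount_le (c : List Bool) : levelCount c ≤ 1 + c.length := by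
  have h1 : ones (afterOnes c) ≤ (afterOnes c).length := (List.takeWhile_sublist _).length_le
  have h2 : (afterOnes c).length ≤ (c.dropWhile id).length := by simp [afterOnes]
  have h3 := (List.dropWhile_suffix (l := c) id).length_le
  rw [levelCount]
  omega

theorem length_of_mem_rows {R : SLC} {I : List ℤ} (hI : I ∈ rows R) : I.length = 2 * R.n + 1 := by
  obtain ⟨r, rfl⟩ := List.mem_ofFn.1 hI
  simp only [rowInts, List.length_append, List.length_ofFn, List.length_singleton]
  omega

/-- A row contains 2 * n + 1 integers, each of at least one symbol. Without a row this fails, since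
n itself is written in binary. -/
theorem vars_le_size {R : SLC} (hR : rows R ≠ []) : R.n ≤ R.size := by
  obtain ⟨I, hI⟩ := List.exists_mem_of_ne_nil _ hR
  have h1 := length_showRow_le hI
  have h2 := length_le_length_showRow I
  rw [length_of_mem_rows hI] at h2
  omega

theorem verifyTime_le (R : SLC) (M : ℕ) {c : List Bool} (hc : c.length ≤ certBound (R.size * M)) :
    verifyTime R.n M (rows R) c + 1 ≤ timeBound (R.size * M) := by
  have hlen := length_rows_le R
  rcases Nat.eq_zero_or_pos M with rfl | hM
  · rw [verifyTime, timeBound]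
    simp [encodeNat, encodeNum]
  have hMs : M ≤ R.size * M := Nat.le_mul_of_pos_left _ (by omega)
  have hRs : R.size ≤ R.size * M := Nat.le_mul_of_pos_right _ hM
  have hEM := (length_encodeNat_le M).trans hMs
  rw [verifyTime, timeBound, if_neg hM.ne']
  have h1 : (encodeNat M).length * (3 * M + 8) ≤ R.size * M * (3 * (R.size * M) + 8) := by gcongr
  have h2 : (if rows R = [] then 0 else rowsTime (encodeNat R.n).length R.n (stateCount M c)
      (levelCount c) ((rows R).flatMap showBracketed).length c.length) ≤
      rowsTime (R.size * M) (R.size * M) (R.size * M) (1 + certBound (R.size * M)) (R.size * M)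
        (certBound (R.size * M)) := by
    split_ifs with h
    · exact Nat.zero_le _
    · refine rowsTime_mono (by omega) ((vars_le_size h).trans hRs) ?_
        ((levelCount_le c).trans (by omega)) (by omega) hc
      rw [stateCount]
      omega
  omega

/-! ### The verifier accepts exactly the instances with a cycle -/

theorem hasCycle_iff (R : SLC) (M : ℕ) : R.HasCycleOfLengthAtMost M ↔
    ∃ c : List Bool, c.length ≤ certBound (R.size * M) ∧ verdictRows R.n M (rows R) c = true := by
  refine ⟨fun h => ?_, fun ⟨c, _, h⟩ => hasCycle_of_verdictRows h⟩
  have hM : 0 < M := by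
    obtain ⟨m, hm, h0, -⟩ := h
    omega
  rcases eq_or_ne (rows R) [] with hR | hR
  -- With no inequalities every certificate is accepted, so the empty one serves.
  · exact ⟨[], Nat.zero_le _, by simp [verdictRows, hR, hM]⟩
  have hlen := length_rows_le R
  have hRs : R.size ≤ R.size * M := Nat.le_mul_of_pos_right _ hM
  have hpow : (2 : ℤ) ^ R.size ≤ 2 ^ (R.size * M) := pow_le_pow_right₀ (by norm_num) hRs
  have hmem : ∀ r, rowInts (curr R r) (next R r) (R.b r) ∈ rows R :=
    fun r => List.mem_ofFn.2 ⟨r, rfl⟩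
  refine exists_certificate (Nat.le_mul_of_pos_left _ (by omega)) ?_ (fun r j => ?_) (fun r j => ?_)
    (fun r => ?_) h
  · rw [mul_comm]
    exact Nat.mul_le_mul_right _ (vars_le_size hR)
  · exact (two_mul_abs_le (hmem r) (by simp [rowInts, List.mem_ofFn])).trans hpow
  · exact (two_mul_abs_le (hmem r) (by simp [rowInts, List.mem_ofFn])).trans hpow
  -- The right-hand side is never added to another coefficient, so the factor 2 is dropped.
  · have h1 := two_mul_abs_le (hmem r) (z := R.b r) (by simp [rowInts])
    have h2 := abs_nonneg (R.b r)
    omega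

end CycleVerifier

open CycleVerifier in
theorem proposition3p1 :
    NPVerification.InNPWithRespectTo SLC.encodeWithBound
      (fun x : SLC × ℕ => x.1.size * x.2)
      (fun x : SLC × ℕ => x.1.HasCycleOfLengthAtMost x.2) := by
  obtain ⟨p, hp⟩ := isPoly_certBound
  obtain ⟨q, hq⟩ := isPoly_timeBound
  refine ⟨verify.verifier Ctl.ok (ctl none true) .inp, p, q,
    fun x c => verdictRows x.1.n x.2 (rows x.1) c, ?_, ?_⟩
  · rintro ⟨R, M⟩ c hc
    rw [hp] at hc
    obtain ⟨s, hs, h⟩ := exec_verify (n := R.n) (M := M) (fun _ => length_of_mem_rows) c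
    dsimp only
    rw [← hs, hq, map_encodeWithBound]
    exact h.outputsBoolInTime (verifyTime_le R M hc)
  · rintro ⟨R, M⟩
    simp only [hp]
    exact hasCycle_iff R M
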